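/- **Setting.** A plane graph $\mathbb G$ is a finite collection of edges, i.e. continuous maps $\gamma:[0,1]\to\mathbb R^2$, injective except that possibly $\gamma(0)=\gamma(1)$, with distinct edges meeting only at endpoints; the given edges are the positively oriented ones, and each edge also has an inverse (reversed) edge. The faces are the connected components of the complement of the union of the edges. Assume that every bounded face $F_i$ has connected boundary, so that one can choose a closed boundary walk going once around $\partial F_i$ (arbitrary starting point and direction). Let $K$ be a compact Lie group with a bi-invariant metric, Laplacian $\Delta$ and normalized Haar measure $dx$, and let $\rho_t$ ($t>0$) be its heat kernel: $\rho$ is smooth on $(0,\infty)\times K$, $\partial_t\rho_t=\tfrac12\Delta\rho_t$, and $\lim_{t\to0}\int_K f\rho_t\,dx=f(\mathrm{id})$ for all continuous $f$. Each positively oriented edge carries an edge variable in $K$, the inverse edge carries its inverse, and the holonomy of a path of edges is the product of the variables in reversed order. For positive numbers $t_i$ attached to the bounded faces $F_i$, the Yang--Mills measure on the edge variables is $$d\mu=\Big(\prod_i\rho_{t_i}(h_i)\Big)\,d\mathbf x ,$$ where $h_i$ is the holonomy around $F_i$ and $d\mathbf x$ is the product of normalized Haar measures. The measure of $\mathbb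 G$ itself is obtained for $t_i=|F_i|$, the area of $F_i$; derivatives with respect to the area of a face are taken with the other $t_j$ fixed. **Theorem (Unbounded Face Condition).** 1. Let $f$ be a smooth function of the edge variables of $\mathbb G$, and let $F$ be a bounded face that shares a positively oriented edge $e$ with the unbounded face. Let $a$ be the edge variable of $e$ and $t$ the area of $F$. Then, at all positive values of the areas, $$\frac{d}{dt}\int f\,d\mu=\frac12\int\Delta^a f\,d\mu,$$ where $\Delta^a$ is the Laplacian with respect to $a$, the other edge variables being held constant. 2. Let $K=U(N)$, $N\ge1$, with the metric given by $\langle X,Y\rangle=N\,\mathrm{trace}(X^*Y)$ on $\mathfrak u(N)$, and put $\mathrm{tr}=\frac1N\mathrm{trace}$, $\mathbb E\{f\}=\int f\,d\mu$. Let $F$, $e$, $t$ be as in 1 and let $L$ be a loop traced out on $\mathbb G$ that traverses $e$ exactly once (in either direction). Then $$\frac{d}{dt}\,\mathbb E\{\mathrm{tr}(\mathrm{hol}(L))\}=-\frac12\,\mathbb E\{\mathrm{tr}(\mathrm{hol}(L))\}.$$ 3. Let $K=U(N)$ be as in 2, and let $\mathbb G$ be a simple closed curve, subdivided into finitely many edges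 and traced out once by the loop $L$. If $L$ encloses area $t$ (the area of the bounded face), then $$\mathbb E\{\mathrm{tr}(\mathrm{hol}(L))\}=e^{-t/2},$$ the expectation being that for the actual area. -/

import Mathlib

open MeasureTheory Filter Topology
open scoped Matrix.Norms.L2Operator Manifold ContDiff

namespace PlanarYM

noncomputable section

section LieGroups

variable (V K : Type*) [NormedAddCommGroup V] [NormedSpace ℝ V] [TopologicalSpace K]
  [ChartedSpace V K] [Group K]

/-- The Lie algebra `T_1 K` of a Lie group `K` modelled on `V`. -/
abbrev LieAlg : Type _ := GroupLieAlgebra 𝓘(ℝ, V) K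

variable {V K}

/-- The adjoint action `Ad k`: the derivative at the identity of `x ↦ k x k⁻¹`. -/
def adjointAction (k : K) (X : LieAlg V K) : LieAlg V K :=
  mfderiv 𝓘(ℝ, V) 𝓘(ℝ, V) (fun x : K => k * x * k⁻¹) 1 X

variable (V K)
/-- A bi-invariant Riemannian metric on `K`, given by its value at the identity: an inner product
on the Lie algebra that is invariant under the adjoint action. -/
structure BiinvariantMetric where
  inner : LinearMap.BilinForm ℝ (LieAlg V K)
  symm : ∀ X Y, inner X Y = inner Y X
  pos : ∀ X, X ≠ 0 → 0 < inner X X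
  ad_invariant : ∀ k X Y, inner (adjointAction k X) (adjointAction k Y) = inner X Y
variable {V K}

theorem BiinvariantMetric.exists_orthonormal [FiniteDimensional ℝ V] (g : BiinvariantMetric V K) :
    ∃ b : Module.Basis (Fin (Module.finrank ℝ (LieAlg V K))) ℝ (LieAlg V K),
      ∀ i j, g.inner (b i) (b j) = if i = j then 1 else 0 := by
  have : FiniteDimensional ℝ (LieAlg V K) := inferInstanceAs (FiniteDimensional ℝ V)
  obtain ⟨v, hv⟩ := LinearMap.BilinForm.exists_orthogonal_basis (B := g.inner) ⟨g.symm⟩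
  have hp : ∀ i, 0 < g.inner (v i) (v i) := fun i => g.pos _ (v.ne_zero i)
  have hu : ∀ i, IsUnit (1 / Real.sqrt (g.inner (v i) (v i))) := fun i =>
    isUnit_iff_ne_zero.2 (one_div_ne_zero (Real.sqrt_ne_zero'.2 (hp i)))
  refine ⟨v.isUnitSMul hu, fun i j => ?_⟩
  rw [Module.Basis.isUnitSMul_apply, Module.Basis.isUnitSMul_apply]
  simp only [map_smul, LinearMap.smul_apply, smul_eq_mul]
  split_ifs with h
  · subst h
    have := Real.mul_self_sqrt (hp i).le
    have h0 := Real.sqrt_ne_zero'.2 (hp i)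
    field_simp
    rw [sq, this]
  · have : g.inner (v i) (v j) = 0 := hv h
    rw [this]; simp
/-- An orthonormal basis of the Lie algebra. -/
def BiinvariantMetric.orthonormalBasis [FiniteDimensional ℝ V] (g : BiinvariantMetric V K) :
    Module.Basis (Fin (Module.finrank ℝ (LieAlg V K))) ℝ (LieAlg V K) :=
  g.exists_orthonormal.choose

theorem BiinvariantMetric.orthonormalBasis_spec [FiniteDimensional ℝ V]
    (g : BiinvariantMetric V K) (i j : Fin (Module.finrank ℝ (LieAlg V K))) :
    g.inner (g.orthonormalBasis i) (g.orthonormalBasis j) = if i = j then 1 else 0 :=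
  g.exists_orthonormal.choose_spec i j

/-- The derivative of `f` along the left-invariant vector field of `X`, that is
`x ↦ d/ds f (x exp (s X))` at `s = 0`. -/
def leftDeriv {A : Type*} [NormedAddCommGroup A] [NormedSpace ℝ A] (X : LieAlg V K)
    (f : K → A) (x : K) : A :=
  mfderiv 𝓘(ℝ, V) 𝓘(ℝ, A) f x (mulInvariantVectorField X x)

/-- The Laplacian of a bi-invariant metric: the sum of the squares of the left-invariant vector
fields of an orthonormal basis of the Lie algebra. -/
def laplacian [FiniteDimensional ℝ V] {A : Type*} [NormedAddCommGroup A] [NormedSpace ℝ A]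
    (g : BiinvariantMetric V K) (f : K → A) (x : K) : A :=
  ∑ i, leftDeriv (g.orthonormalBasis i) (leftDeriv (g.orthonormalBasis i) f) x

/-- The Laplacian in the edge variable `e`, the other edge variables being held constant. -/
def edgeLaplacian [FiniteDimensional ℝ V] {A : Type*} [NormedAddCommGroup A] [NormedSpace ℝ A]
    {E : Type*} [DecidableEq E] (g : BiinvariantMetric V K) (e : E) (f : (E → K) → A)
    (x : E → K) : A :=
  laplacian g (fun a : K => f (Function.update x e a)) (x e)

/-- Normalized Haar measure on a compact group. -/
def haarProb (K : Type*) [TopologicalSpace K] [Group K] [IsTopologicalGroup K] [CompactSpace K]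
    [MeasurableSpace K] [BorelSpace K] : Measure K :=
  Measure.haarMeasure ⊤

/-- `ρ` is the heat kernel of `K` for the metric `g` (at times `t > 0`): a smooth solution of
`∂ρ/∂t = ½ Δρ` such that `ρ t` tends to the point mass at the identity as `t → 0`. -/
structure IsHeatKernel [FiniteDimensional ℝ V] [IsTopologicalGroup K] [CompactSpace K]
    [MeasurableSpace K] [BorelSpace K] (g : BiinvariantMetric V K) (ρ : ℝ → K → ℝ) : Prop where
  smooth : ContMDiffOn (𝓘(ℝ, ℝ).prod 𝓘(ℝ, V)) 𝓘(ℝ, ℝ) ∞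
    (fun p : ℝ × K => ρ p.1 p.2) (Set.Ioi 0 ×ˢ Set.univ)
  heat_equation : ∀ t > 0, ∀ x : K,
    HasDerivAt (fun s => ρ s x) (1 / 2 * laplacian g (ρ t) x) t
  initial : ∀ f : K → ℝ, Continuous f →
    Tendsto (fun t => ∫ x, f x * ρ t x ∂(haarProb K)) (𝓝[>] 0) (𝓝 (f 1))

end LieGroups

section UnitaryGroup

open scoped ComplexOrder

/-- Complex matrices of size `N`. -/
abbrev Mat (N : ℕ) := Matrix (Fin N) (Fin N) ℂ

variable {N : ℕ}

/-- The skew-Hermitian matrices, on which the manifold structure of `U(N)` is modelled. -/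
abbrev SkewMat (N : ℕ) : Type := skewAdjoint.submodule ℝ (Mat N)

/-- The skew-Hermitian part of a matrix. -/
def skewPart (N : ℕ) : Mat N →L[ℝ] SkewMat N :=
  (show Mat N →L[ℝ] SkewMat N from skewAdjointPartL ℝ (Mat N))

/-- The Cayley transform; it maps skew-Hermitian matrices to unitary ones. -/
def cay (X : Mat N) : Mat N := (1 + (1 / 2 : ℝ) • X) * Ring.inverse (1 - (1 / 2 : ℝ) • X)
/-- The inverse Cayley transform. -/
def cayInv (W : Mat N) : Mat N := (2 : ℝ) • ((W - 1) * Ring.inverse (W + 1))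

lemma isUnit_one_sub {Y : Mat N} (h : star Y = -Y) : IsUnit (1 - Y) := by
  have h1 : (1 - Y) * (1 + Y) = 1 + star Y * Y := by rw [h]; noncomm_ring
  have h2 : IsUnit ((1 - Y) * (1 + Y)) := by
    rw [h1]
    exact (Matrix.PosDef.one.add_posSemidef
      (Matrix.posSemidef_conjTranspose_mul_self Y)).isUnit
  have hc : Commute (1 - Y) (1 + Y) := by
    show _ * _ = _ * _
    noncomm_ring
  exact (hc.isUnit_mul_iff.1 h2).1

lemma star_half {X : Mat N} (h : star X = -X) :
    star ((1 / 2 : ℝ) • X) = -((1 / 2 : ℝ) • X) := by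
  rw [star_smul, h]; simp

lemma cay_mem {X : Mat N} (h : star X = -X) : cay X ∈ Matrix.unitaryGroup (Fin N) ℂ := by
  have h' := star_half h
  obtain ⟨u, hu⟩ := isUnit_one_sub h'
  have h2 : star ((1 / 2 : ℝ) • X) = -((1 / 2 : ℝ) • X) := h'
  set Y := (1 / 2 : ℝ) • X with hY
  have hcay : cay X = (1 + Y) * (↑u⁻¹ : Mat N) := by
    rw [cay, ← hY, ← hu, Ring.inverse_unit]
  have hs : star (u : Mat N) = 1 + Y := by rw [hu]; simp [h2]
  have hsu : star (↑u⁻¹ : Mat N) * (1 + Y) = 1 := by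
    rw [← hs, ← star_mul, Units.mul_inv, star_one]
  have hcomm : (1 + Y) * (u : Mat N) = u * (1 + Y) := by rw [hu]; noncomm_ring
  rw [Matrix.mem_unitaryGroup_iff', hcay, star_mul]
  have : star (1 + Y) = (u : Mat N) := by rw [← hs, star_star]
  rw [this]
  calc star (↑u⁻¹ : Mat N) * u * ((1 + Y) * (↑u⁻¹ : Mat N))
      = star (↑u⁻¹ : Mat N) * (u * (1 + Y)) * (↑u⁻¹ : Mat N) := by noncomm_ring
    _ = (star (↑u⁻¹ : Mat N) * (1 + Y)) * (u * (↑u⁻¹ : Mat N)) := by rw [← hcomm]; noncomm_ring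
    _ = 1 := by rw [hsu, Units.mul_inv, one_mul]

lemma cay_add_one {X : Mat N} (h : star X = -X) :
    cay X + 1 = (2 : ℝ) • Ring.inverse (1 - (1 / 2 : ℝ) • X) ∧
    cay X - 1 = X * Ring.inverse (1 - (1 / 2 : ℝ) • X) := by
  obtain ⟨u, hu⟩ := isUnit_one_sub (star_half h)
  rw [cay, ← hu, Ring.inverse_unit]
  have h1 : (u : Mat N) * (↑u⁻¹ : Mat N) = 1 := u.mul_inv
  constructor
  · nth_rewrite 2 [← h1]
    rw [← add_mul, hu]
    rw [show (1 + (1 / 2 : ℝ) • X + (1 - (1 / 2 : ℝ) • X)) = (2 : ℝ) • (1 : Mat N) by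
      rw [two_smul]; abel]
    simp
  · nth_rewrite 2 [← h1]
    rw [← sub_mul, hu]
    congr 1
    rw [show (1 + (1 / 2 : ℝ) • X - (1 - (1 / 2 : ℝ) • X)) = ((1 / 2 : ℝ) + (1 / 2)) • X by
      rw [add_smul]; abel]
    norm_num

lemma isUnit_cay_add_one {X : Mat N} (h : star X = -X) : IsUnit (cay X + 1) := by
  rw [(cay_add_one h).1]
  exact (IsUnit.smul (Units.mk0 (2 : ℝ) two_ne_zero) (isUnit_one_sub (star_half h)).ringInverse)

lemma cayInv_cay {X : Mat N} (h : star X = -X) : cayInv (cay X) = X := by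
  have h2 := isUnit_cay_add_one h
  obtain ⟨v, hv⟩ := h2
  obtain ⟨u, hu⟩ := isUnit_one_sub (star_half h)
  have e1 := (cay_add_one h).1
  have e2 := (cay_add_one h).2
  rw [cayInv, e2, ← hv, Ring.inverse_unit]
  rw [← hu, Ring.inverse_unit] at *
  rw [← hv] at e1
  rw [← smul_mul_assoc, ← mul_smul_comm, ← e1, mul_assoc, Units.mul_inv, mul_one]

lemma star_cayInv {W : Mat N} (hW : W ∈ Matrix.unitaryGroup (Fin N) ℂ) (h : IsUnit (W + 1)) :
    star (cayInv W) = -cayInv W := by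
  obtain ⟨u, hu⟩ := h
  have h1 : star W * W = 1 := Matrix.mem_unitaryGroup_iff'.1 hW
  have h1' : W * star W = 1 := Matrix.mem_unitaryGroup_iff.1 hW
  have e : cayInv W = (2 : ℝ) • ((W - 1) * (↑u⁻¹ : Mat N)) := by
    rw [cayInv, ← hu, Ring.inverse_unit]
  rw [e, star_smul, star_mul, ← smul_neg]
  simp only [star_trivial, star_sub, star_one]
  congr 1
  have hs : star (↑u⁻¹ : Mat N) * star (u : Mat N) = 1 := by
    rw [← star_mul, Units.mul_inv, star_one]
  have hsu : star (u : Mat N) = star W + 1 := by rw [hu]; simp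
  have key : (star W - 1) * u = -(star (u : Mat N) * (W - 1)) := by
    rw [hsu, hu, sub_mul, add_mul, mul_add, mul_sub, h1]; noncomm_ring
  calc star (↑u⁻¹ : Mat N) * (star W - 1)
      = star (↑u⁻¹ : Mat N) * ((star W - 1) * u) * (↑u⁻¹ : Mat N) := by
        rw [mul_assoc, mul_assoc, Units.mul_inv, mul_one]
    _ = -((star (↑u⁻¹ : Mat N) * star (u : Mat N)) * ((W - 1) * (↑u⁻¹ : Mat N))) := by
        rw [key]; noncomm_ring
    _ = _ := by rw [hs, one_mul]

lemma cay_cayInv {W : Mat N} (hW : W ∈ Matrix.unitaryGroup (Fin N) ℂ) (h : IsUnit (W + 1)) :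
    cay (cayInv W) = W := by
  have hs := star_cayInv hW h
  obtain ⟨u, hu⟩ := h
  have e : (1 / 2 : ℝ) • cayInv W = (W - 1) * (↑u⁻¹ : Mat N) := by
    rw [cayInv, ← hu, Ring.inverse_unit, smul_smul]; norm_num
  have h1 : (u : Mat N) * (↑u⁻¹ : Mat N) = 1 := u.mul_inv
  have hm : (1 - (1 / 2 : ℝ) • cayInv W) = (2 : ℝ) • (↑u⁻¹ : Mat N) := by
    rw [e]
    nth_rewrite 1 [← h1]
    rw [← sub_mul, hu, show W + 1 - (W - 1) = (2 : ℝ) • (1 : Mat N) by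
      rw [two_smul]; abel]
    simp
  have hp : (1 + (1 / 2 : ℝ) • cayInv W) = (2 : ℝ) • (W * (↑u⁻¹ : Mat N)) := by
    rw [e]
    nth_rewrite 1 [← h1]
    rw [← add_mul, hu, show W + 1 + (W - 1) = (2 : ℝ) • W by
      rw [two_smul]; abel]
    simp
  obtain ⟨v, hv⟩ := isUnit_one_sub (star_half hs)
  rw [cay, ← hv, Ring.inverse_unit, hp, ← mul_smul_comm, ← hm, ← hv, mul_assoc,
    Units.mul_inv, mul_one]

lemma skewPart_coe {X : Mat N} (h : star X = -X) : (skewPart N X : Mat N) = X := by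
  have := skewAdjointPart_apply_coe ℝ X
  show ((skewAdjointPart ℝ X : skewAdjoint (Mat N)) : Mat N) = X
  rw [this, h, invOf_eq_inv, sub_neg_eq_add, ← two_smul ℝ X, smul_smul]
  norm_num

lemma star_coe_skew (X : SkewMat N) : star (X : Mat N) = -(X : Mat N) := X.2

lemma contDiffAt_inverse {n : ℕ∞ω} {W : Mat N} (h : IsUnit W) :
    ContDiffAt ℝ n (Ring.inverse : Mat N → Mat N) W := by
  obtain ⟨u, rfl⟩ := h
  exact contDiffAt_ringInverse ℝ u

lemma contDiffAt_cay {n : ℕ∞ω} {X : Mat N} (h : star X = -X) :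
    ContDiffAt ℝ n (cay : Mat N → Mat N) X := by
  unfold cay
  refine ContDiffAt.mul (by fun_prop) ?_
  exact ContDiffAt.comp X (g := Ring.inverse) (f := fun X : Mat N => 1 - (1 / 2 : ℝ) • X)
    (contDiffAt_inverse (isUnit_one_sub (star_half h))) (by fun_prop)

lemma contDiffAt_cayInv {n : ℕ∞ω} {W : Mat N} (h : IsUnit (W + 1)) :
    ContDiffAt ℝ n (cayInv : Mat N → Mat N) W := by
  unfold cayInv
  refine ContDiffAt.const_smul _ (ContDiffAt.mul (by fun_prop) ?_)
  exact ContDiffAt.comp W (g := Ring.inverse) (f := fun W : Mat N => W + 1)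
    (contDiffAt_inverse h) (by fun_prop)

lemma contDiff_cay_coe {n : ℕ∞ω} : ContDiff ℝ n (fun X : SkewMat N => cay (X : Mat N)) := by
  rw [contDiff_iff_contDiffAt]
  intro X
  exact ContDiffAt.comp X (contDiffAt_cay (star_coe_skew X))
    (Submodule.subtypeL (skewAdjoint.submodule ℝ (Mat N))).contDiff.contDiffAt

/-- The Cayley chart of `U(N)` around `U₀`; its inverse is `X ↦ U₀ * cay X`. -/
def cayChart (U₀ : Matrix.unitaryGroup (Fin N) ℂ) :
    OpenPartialHomeomorph (Matrix.unitaryGroup (Fin N) ℂ) (SkewMat N) where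
  toFun U := skewPart N (cayInv ((U₀⁻¹ * U : Matrix.unitaryGroup (Fin N) ℂ) : Mat N))
  invFun X := U₀ * ⟨cay (X : Mat N), cay_mem (star_coe_skew X)⟩
  source := {U | IsUnit (((U₀⁻¹ * U : Matrix.unitaryGroup (Fin N) ℂ) : Mat N) + 1)}
  target := Set.univ
  map_source' _ _ := Set.mem_univ _
  map_target' X _ := by
    show IsUnit (((U₀⁻¹ * (U₀ * ⟨cay (X : Mat N), cay_mem (star_coe_skew X)⟩) :
      Matrix.unitaryGroup (Fin N) ℂ) : Mat N) + 1)
    rw [inv_mul_cancel_left]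
    exact isUnit_cay_add_one (star_coe_skew X)
  left_inv' U hU := by
    have hU' := star_cayInv (U₀⁻¹ * U).2 hU
    have : (⟨cay (skewPart N (cayInv ((U₀⁻¹ * U : Matrix.unitaryGroup (Fin N) ℂ) : Mat N)) : Mat N),
        cay_mem (star_coe_skew _)⟩ : Matrix.unitaryGroup (Fin N) ℂ) = U₀⁻¹ * U := by
      apply Subtype.ext
      show cay _ = _
      rw [skewPart_coe hU', cay_cayInv (U₀⁻¹ * U).2 hU]
    rw [this, mul_inv_cancel_left]
  right_inv' X _ := by
    apply Subtype.ext
    rw [inv_mul_cancel_left]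
    show (skewPart N (cayInv (cay (X : Mat N))) : Mat N) = X
    rw [cayInv_cay (star_coe_skew X), skewPart_coe (star_coe_skew X)]
  open_source := by
    refine Units.isOpen.preimage (f := fun U : Matrix.unitaryGroup (Fin N) ℂ =>
      ((U₀⁻¹ * U : Matrix.unitaryGroup (Fin N) ℂ) : Mat N) + 1) ?_
    exact (continuous_subtype_val.comp (continuous_const.mul continuous_id)).add continuous_const
  open_target := isOpen_univ
  continuousOn_toFun := by
    intro U hU
    refine ((skewPart N).continuous.continuousAt.comp ?_).continuousWithinAt
    exact ContinuousAt.comp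
      (g := cayInv) (f := fun U : Matrix.unitaryGroup (Fin N) ℂ =>
        ((U₀⁻¹ * U : Matrix.unitaryGroup (Fin N) ℂ) : Mat N))
      (contDiffAt_cayInv (n := 0) hU).continuousAt
      (continuous_subtype_val.comp (continuous_const.mul continuous_id)).continuousAt
  continuousOn_invFun := by
    refine (continuous_const.mul (Continuous.subtype_mk ?_ _)).continuousOn
    exact (contDiff_cay_coe (n := 0)).continuous

/-- The standard manifold structure of `U(N)`, given by the Cayley charts. -/
instance : ChartedSpace (SkewMat N) (Matrix.unitaryGroup (Fin N) ℂ) where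
  atlas := Set.range cayChart
  chartAt := cayChart
  mem_chart_source U := by
    show IsUnit (((U⁻¹ * U : Matrix.unitaryGroup (Fin N) ℂ) : Mat N) + 1)
    rw [inv_mul_cancel]
    show IsUnit ((1 : Mat N) + 1)
    rw [← two_smul ℝ (1 : Mat N)]
    exact IsUnit.smul (Units.mk0 (2 : ℝ) two_ne_zero) isUnit_one
  chart_mem_atlas U := ⟨U, rfl⟩

instance : IsManifold 𝓘(ℝ, SkewMat N) ∞ (Matrix.unitaryGroup (Fin N) ℂ) := by
  apply isManifold_of_contDiffOn
  rintro _ _ ⟨U₀, rfl⟩ ⟨U₁, rfl⟩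
  intro X hX
  refine ContDiffAt.contDiffWithinAt ?_
  have hX' : IsUnit (((U₁⁻¹ * (U₀ * ⟨cay (X : Mat N), cay_mem (star_coe_skew X)⟩) :
      Matrix.unitaryGroup (Fin N) ℂ) : Mat N) + 1) := by
    simpa [cayChart] using hX
  show ContDiffAt ℝ ∞ (fun X : SkewMat N => skewPart N (cayInv
    ((U₁⁻¹ : Matrix.unitaryGroup (Fin N) ℂ) * ((U₀ : Mat N) * cay (X : Mat N))))) X
  refine (skewPart N).contDiff.contDiffAt.comp X ?_
  refine ContDiffAt.comp X (g := cayInv) (contDiffAt_cayInv hX') ?_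
  exact contDiffAt_const.mul (contDiffAt_const.mul contDiff_cay_coe.contDiffAt)

/-- The inclusion of `U(N)` into the matrices is smooth. -/
lemma contMDiff_coe_unitary :
    ContMDiff 𝓘(ℝ, SkewMat N) 𝓘(ℝ, Mat N) ∞
      (fun U : Matrix.unitaryGroup (Fin N) ℂ => (U : Mat N)) := by
  intro U
  rw [contMDiffAt_iff]
  refine ⟨continuous_subtype_val.continuousAt, ContDiffAt.contDiffWithinAt ?_⟩
  show ContDiffAt ℝ ∞ (fun X : SkewMat N => (U : Mat N) * cay (X : Mat N)) _
  exact contDiffAt_const.mul contDiff_cay_coe.contDiffAt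

/-- A map into `U(N)` is smooth when it is smooth as a matrix-valued map. -/
lemma contMDiff_of_coe {E H M : Type*} [NormedAddCommGroup E] [NormedSpace ℝ E]
    [TopologicalSpace H] {I : ModelWithCorners ℝ E H} [TopologicalSpace M] [ChartedSpace H M]
    {f : M → Matrix.unitaryGroup (Fin N) ℂ}
    (hf : ContMDiff I 𝓘(ℝ, Mat N) ∞ (fun x => (f x : Mat N))) :
    ContMDiff I 𝓘(ℝ, SkewMat N) ∞ f := by
  intro x
  rw [contMDiffAt_iff_target]
  refine ⟨(continuous_induced_rng.2 hf.continuous).continuousAt, ?_⟩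
  show ContMDiffAt I 𝓘(ℝ, SkewMat N) ∞ (fun y => skewPart N (cayInv
    (((f x)⁻¹ : Matrix.unitaryGroup (Fin N) ℂ) * (f y : Mat N)))) x
  have h1 : ContDiffAt ℝ ∞ (fun W : Mat N => skewPart N (cayInv
      (((f x)⁻¹ : Matrix.unitaryGroup (Fin N) ℂ) * W))) (f x : Mat N) := by
    refine ContDiffAt.comp _ (g := skewPart N) (skewPart N).contDiff.contDiffAt ?_
    refine ContDiffAt.comp _ (g := cayInv) (contDiffAt_cayInv ?_) (by fun_prop)
    exact mem_chart_source (SkewMat N) (f x)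
  exact ContMDiffAt.comp x (g := fun W : Mat N => skewPart N (cayInv
    (((f x)⁻¹ : Matrix.unitaryGroup (Fin N) ℂ) * W))) h1.contMDiffAt (hf x)

instance : LieGroup 𝓘(ℝ, SkewMat N) ∞ (Matrix.unitaryGroup (Fin N) ℂ) where
  contMDiff_mul := by
    apply contMDiff_of_coe
    exact ContDiff.comp_contMDiff (g := fun p : Mat N × Mat N => p.1 * p.2)
      (contDiff_fst.mul contDiff_snd)
      ((contMDiff_coe_unitary.comp contMDiff_fst).prodMk_space
        (contMDiff_coe_unitary.comp contMDiff_snd))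
  contMDiff_inv := by
    apply contMDiff_of_coe
    exact ContDiff.comp_contMDiff (g := fun p : Mat N => star p)
      (starL' ℝ (A := Mat N)).contDiff contMDiff_coe_unitary


instance : CompactSpace (Matrix.unitaryGroup (Fin N) ℂ) := by
  have h : IsCompact (Matrix.unitaryGroup (Fin N) ℂ : Set (Mat N)) := by
    refine Metric.isCompact_of_isClosed_isBounded isClosed_unitary ?_
    refine (Metric.isBounded_iff_subset_closedBall 0).2 ⟨1, fun U hU => ?_⟩
    rw [mem_closedBall_zero_iff]
    rcases subsingleton_or_nontrivial (Mat N) with hN | hN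
    · rw [Subsingleton.elim U 0, norm_zero]
      exact zero_le_one
    · exact (CStarRing.norm_of_mem_unitary hU).le
  exact isCompact_iff_compactSpace.1 h

instance : MeasurableSpace (Matrix.unitaryGroup (Fin N) ℂ) := borel _
instance : BorelSpace (Matrix.unitaryGroup (Fin N) ℂ) := ⟨rfl⟩


/-- The identification of the Lie algebra of `U(N)` with matrices: the derivative at the identity
of the inclusion of `U(N)` into the matrices. -/
def lieToMat (N : ℕ) : LieAlg (SkewMat N) (Matrix.unitaryGroup (Fin N) ℂ) →L[ℝ] Mat N :=
  mfderiv 𝓘(ℝ, SkewMat N) 𝓘(ℝ, Mat N)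
    (fun U : Matrix.unitaryGroup (Fin N) ℂ => (U : Mat N)) 1

lemma lieToMat_injective : Function.Injective (lieToMat N) := by
  let X₀ : SkewMat N := cayChart 1 (1 : Matrix.unitaryGroup (Fin N) ℂ)
  have hm := (contMDiff_coe_unitary (N := N)).mdifferentiableAt (x := 1) (by simp)
    |>.hasMFDerivAt.2
  rw [show Set.range (𝓘(ℝ, SkewMat N)) = Set.univ from Set.range_id] at hm
  have h : HasFDerivAt (fun X : SkewMat N =>
      ((1 : Matrix.unitaryGroup (Fin N) ℂ) : Mat N) * cay (X : Mat N))
      (lieToMat N : SkewMat N →L[ℝ] Mat N) X₀ := hasFDerivWithinAt_univ.1 hm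
  rw [show (fun X : SkewMat N =>
      ((1 : Matrix.unitaryGroup (Fin N) ℂ) : Mat N) * cay (X : Mat N))
      = fun X : SkewMat N => cay (X : Mat N) from funext fun X => one_mul _] at h
  have hd' : DifferentiableAt ℝ (fun W : Mat N => skewPart N (cayInv W)) (cay (X₀ : Mat N)) :=
    (skewPart N).differentiableAt.comp _
      ((contDiffAt_cayInv (n := 1) (isUnit_cay_add_one (star_coe_skew X₀))).differentiableAt
        (by simp))
  have hid : (fun X : SkewMat N => skewPart N (cayInv (cay (X : Mat N)))) = id := by
    funext X
    apply Subtype.ext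
    rw [cayInv_cay (star_coe_skew X), skewPart_coe (star_coe_skew X)]
    rfl
  have hc := hd'.hasFDerivAt.comp X₀ h
  rw [show ((fun W : Mat N => skewPart N (cayInv W)) ∘ fun X : SkewMat N => cay (X : Mat N)) = id
    from hid] at hc
  have hu := hc.unique (hasFDerivAt_id X₀)
  intro X Y hXY
  have e1 : fderiv ℝ (fun W : Mat N => skewPart N (cayInv W)) (cay (X₀ : Mat N)) (lieToMat N X)
      = X := congrArg (fun L : SkewMat N →L[ℝ] SkewMat N => L X) hu
  have e2 : fderiv ℝ (fun W : Mat N => skewPart N (cayInv W)) (cay (X₀ : Mat N)) (lieToMat N Y)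
      = Y := congrArg (fun L : SkewMat N →L[ℝ] SkewMat N => L Y) hu
  rw [hXY] at e1
  exact e1.symm.trans e2

lemma lieToMat_adjointAction (U : Matrix.unitaryGroup (Fin N) ℂ)
    (X : LieAlg (SkewMat N) (Matrix.unitaryGroup (Fin N) ℂ)) :
    lieToMat N (adjointAction U X) = (U : Mat N) * lieToMat N X * star (U : Mat N) := by
  let c : Matrix.unitaryGroup (Fin N) ℂ → Matrix.unitaryGroup (Fin N) ℂ := fun x => U * x * U⁻¹
  have hc : ContMDiff 𝓘(ℝ, SkewMat N) 𝓘(ℝ, SkewMat N) ∞ c :=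
    (contMDiff_const.mul contMDiff_id).mul contMDiff_const
  have hι := contMDiff_coe_unitary (N := N)
  have e : c 1 = 1 := by simp [c]
  have h1 : mfderiv 𝓘(ℝ, SkewMat N) 𝓘(ℝ, Mat N)
      ((fun U : Matrix.unitaryGroup (Fin N) ℂ => (U : Mat N)) ∘ c) 1 X
      = lieToMat N (adjointAction U X) := by
    rw [mfderiv_comp (I' := 𝓘(ℝ, SkewMat N)) 1 (hι.mdifferentiableAt (by simp))
      (hc.mdifferentiableAt (by simp)), e]
    rfl
  let L : Mat N →L[ℝ] Mat N :=
    (ContinuousLinearMap.mul ℝ (Mat N) (U : Mat N)).comp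
      ((ContinuousLinearMap.mul ℝ (Mat N)).flip (star (U : Mat N)))
  have h2 : mfderiv 𝓘(ℝ, SkewMat N) 𝓘(ℝ, Mat N)
      (L ∘ (fun U : Matrix.unitaryGroup (Fin N) ℂ => (U : Mat N))) 1 X
      = (U : Mat N) * lieToMat N X * star (U : Mat N) := by
    rw [mfderiv_comp (I' := 𝓘(ℝ, Mat N)) 1 L.differentiableAt.mdifferentiableAt
      (hι.mdifferentiableAt (by simp))]
    rw [mfderiv_eq_fderiv, L.fderiv]
    exact (mul_assoc (U : Mat N) (lieToMat N X) (star (U : Mat N))).symm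
  rw [← h1, ← h2]
  congr 2
  funext x
  simp [c, L, mul_assoc]

/-- The bi-invariant metric `⟨X, Y⟩ = N trace (X* Y)` on `U(N)`. -/
def unitaryMetric (N : ℕ) : BiinvariantMetric (SkewMat N) (Matrix.unitaryGroup (Fin N) ℂ) where
  inner := LinearMap.mk₂ ℝ
    (fun X Y => N * ((star (lieToMat N X) * lieToMat N Y).trace).re)
    (fun X X' Y => by simp [add_mul, mul_add])
    (fun c X Y => by simp; ring)
    (fun X Y Y' => by simp [mul_add])
    (fun c X Y => by simp; ring)
  symm X Y := by
    simp only [LinearMap.mk₂_apply]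
    congr 1
    have : star (lieToMat N X) * lieToMat N Y
        = Matrix.conjTranspose (star (lieToMat N Y) * lieToMat N X) := by
      rw [Matrix.conjTranspose_mul, Matrix.star_eq_conjTranspose, Matrix.star_eq_conjTranspose,
        Matrix.conjTranspose_conjTranspose]
    rw [this, Matrix.trace_conjTranspose]
    exact Complex.conj_re _
  pos X hX := by
    simp only [LinearMap.mk₂_apply]
    have h0 : lieToMat N X ≠ 0 := fun h => hX (lieToMat_injective (h.trans (map_zero _).symm))
    have hN : 0 < N := by
      rcases Nat.eq_zero_or_pos N with rfl | h
      · exact absurd (Subsingleton.elim _ _) h0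
      · exact h
    have hps := Matrix.posSemidef_conjTranspose_mul_self (lieToMat N X)
    have h1 := hps.trace_nonneg
    have h2 : (Matrix.conjTranspose (lieToMat N X) * lieToMat N X).trace ≠ 0 := fun h =>
      h0 (Matrix.trace_conjTranspose_mul_self_eq_zero_iff.1 h)
    have h3 := (Complex.pos_iff.1 (lt_of_le_of_ne h1 (Ne.symm h2))).1
    exact mul_pos (Nat.cast_pos.2 hN) h3
  ad_invariant U X Y := by
    simp only [LinearMap.mk₂_apply, lieToMat_adjointAction]
    congr 2
    have hU : star (U : Mat N) * U = 1 := Matrix.mem_unitaryGroup_iff'.1 U.2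
    have : star ((U : Mat N) * lieToMat N X * star (U : Mat N)) *
        ((U : Mat N) * lieToMat N Y * star (U : Mat N))
        = (U : Mat N) * (star (lieToMat N X) * ((star (U : Mat N) * U) * lieToMat N Y)
          * star (U : Mat N)) := by
      simp only [star_mul, star_star, mul_assoc]
    rw [this, hU, one_mul, Matrix.trace_mul_comm, mul_assoc, hU, mul_one]

end UnitaryGroup

section Graphs

/-- A graph in the plane `ℝ² = ℂ`, with positively oriented edges indexed by `E`: each edge is a
continuous map on `[0,1]`, injective except that its endpoints may coincide, and distinct edges
meet only at their endpoints. -/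
structure PlaneGraph (E : Type*) where
  edge : E → unitInterval → ℂ
  continuous_edge : ∀ e, Continuous (edge e)
  injective_edge : ∀ e s t, edge e s = edge e t → s = t ∨ (s = 0 ∧ t = 1) ∨ (s = 1 ∧ t = 0)
  meet_at_ends : ∀ e e' s t, e ≠ e' → edge e s = edge e' t →
    (s = 0 ∨ s = 1) ∧ (t = 0 ∨ t = 1)

namespace PlaneGraph

variable {E : Type*} (G : PlaneGraph E)

/-- The oriented edges are the pairs `(e, b)`: the positively oriented edge `e` for `b = true`,
and its inverse for `b = false`. This is the corresponding parametrized curve. -/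
def path (d : E × Bool) (s : unitInterval) : ℂ :=
  if d.2 then G.edge d.1 s else G.edge d.1 (unitInterval.symm s)

/-- The union of all edges. -/
def support : Set ℂ := ⋃ e, Set.range (G.edge e)

/-- A face is a connected component of the complement of the graph. -/
def IsFace (F : Set ℂ) : Prop := ∃ p ∈ G.supportᶜ, F = connectedComponentIn G.supportᶜ p

/-- The bounded faces. -/
def BoundedFace : Type := {F : Set ℂ // G.IsFace F ∧ Bornology.IsBounded F}

/-- The area of a bounded face. -/
def area (F : G.BoundedFace) : ℝ := (volume F.1).toReal

/-- A sequence `w` of oriented edges goes once around the boundary of the face `F`: the face is an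
open disk attached to the graph along `w`. That is, there is a continuous map on the closed unit
disk that maps the open disk bijectively onto `F`, and that runs through the consecutive edges
of `w` on the consecutive arcs of angle `2π / (length of w)` of the unit circle. The starting
point and the direction of `w` are arbitrary. -/
def IsBoundaryWalk (F : Set ℂ) (w : List (E × Bool)) : Prop :=
  w ≠ [] ∧ ∃ φ : ℂ → ℂ, ContinuousOn φ (Metric.closedBall 0 1) ∧
    Set.BijOn φ (Metric.ball 0 1) F ∧
    ∀ (j : Fin w.length) (s : unitInterval),
      φ (Complex.exp (2 * Real.pi * Complex.I * (((j : ℕ) + (s : ℝ)) / w.length))) =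
        G.path (w.get j) s

/-- The edge `e` is shared by the bounded face `F` and the unbounded face. -/
def SharedWithUnbounded (F : G.BoundedFace) (e : E) : Prop :=
  Set.range (G.edge e) ⊆ frontier F.1 ∧
    ∃ U, G.IsFace U ∧ ¬ Bornology.IsBounded U ∧ Set.range (G.edge e) ⊆ frontier U

/-- A loop traced out on the graph: a nonempty cyclically composable sequence of oriented edges. -/
def IsLoop (L : List (E × Bool)) : Prop :=
  L ≠ [] ∧ L.IsChain (fun d d' => G.path d 1 = G.path d' 0) ∧
    ∀ d ∈ L.getLast?, ∀ d' ∈ L.head?, G.path d 1 = G.path d' 0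

/-- How often `L` traverses the edge `e`, in either direction. -/
def traversals [DecidableEq E] (L : List (E × Bool)) (e : E) : ℕ := (L.map Prod.fst).count e

/-- The graph `G` is a simple closed curve, traced out by the loop `L`: the loop visits no vertex
twice and traverses every edge of the graph exactly once. -/
def IsSimpleClosedCurve [DecidableEq E] (L : List (E × Bool)) : Prop :=
  G.IsLoop L ∧ (L.map fun d => G.path d 0).Nodup ∧ ∀ e, traversals L e = 1

/-- The holonomy along a sequence of oriented edges, for the edge variables `x`; parallel transport
is order-reversing. -/
def hol {K : Type*} [Group K] (x : E → K) (w : List (E × Bool)) : K :=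
  (w.map fun d => if d.2 then x d.1 else (x d.1)⁻¹).reverse.prod

/-- The Yang--Mills measure of the graph, by Driver's formula: product Haar measure in the edge
variables, with density the product over the bounded faces `F` of `ρ (t F) (h F)`, where `h F` is
the holonomy along the boundary walk `w F`. The areas `t F` of the faces are kept as variables in
order to differentiate in them; the measure of the graph itself is the one for `t = G.area`. -/
def ymMeasure [Fintype E] {K : Type*} [TopologicalSpace K] [Group K] [IsTopologicalGroup K]
    [CompactSpace K] [MeasurableSpace K] [BorelSpace K] (ρ : ℝ → K → ℝ)
    (w : G.BoundedFace → List (E × Bool)) (t : G.BoundedFace → ℝ) : Measure (E → K) :=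
  (Measure.pi fun _ : E => haarProb K).withDensity fun x =>
    ENNReal.ofReal (∏ᶠ F : G.BoundedFace, ρ (t F) (hol x (w F)))

open Classical in
/-- The areas `t`, with the area of the face `F` replaced by `s`. -/
def setArea (t : G.BoundedFace → ℝ) (F : G.BoundedFace) (s : ℝ) : G.BoundedFace → ℝ :=
  Function.update t F s

end PlaneGraph

/-- The normalized trace `tr = (1/N) trace` of an element of `U(N)`. -/
def normTrace {N : ℕ} (A : Matrix.unitaryGroup (Fin N) ℂ) : ℂ :=
  (1 / N : ℂ) * Matrix.trace (A : Matrix (Fin N) (Fin N) ℂ)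

end Graphs

end

end PlanarYM

open PlanarYM

/-! The analytic core is short. Differentiating the density in the area t of F and using the heat
equation replaces ρ_t(h) by ½(Δρ_t)(h), where h is the holonomy around F. Suppose that e occurs
exactly once in the boundary walk of F and in no other boundary walk. Then h = u a^{±1} v with u and
v free of a. The Laplacian of a bi-invariant metric commutes with translations and inversion, so
(Δρ_t)(h) = Δ^a(ρ_t(h)), and the other factors of the density do not contain a. Two integrations by
parts, that is, the invariance of Haar measure, move Δ^a to f (`hasDerivAt_integral_ymMeasure`). For
U(N) with the metric N trace(X*Y) the Casimir element is -1, so the normalized trace of the holonomy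
of a loop through e is an eigenfunction with eigenvalue -1 (`laplacian_normTrace`).

The Yang--Mills density is truncated at zero, and positivity is not part of the definition of a heat
kernel. It is proved in `IsHeatKernel.nonneg` from a minimum principle for convolutions with ρ and
from the initial condition; the uniformity needed near t = 0 comes from Banach--Steinhaus.

The topological core is that a shared edge occurs exactly once (`traversals_of_mem_frontier`). A
bounded face is an open disk attached along its walk, so each occurrence of e carries a half disk
whose diameter is the middle part of e and whose other points lie in the face. Half disks of two
different occurrences meet only along the diameter, hence form an injective image of a disk, and
this is a neighbourhood of the midpoint of e (`image_closedBall_mem_nhds`). The midpoint would then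
be surrounded by bounded faces and the graph, although it is in the closure of the unbounded face.
The same argument bounds the number of faces at an edge, so there are finitely many bounded faces.
Planar invariance of domain is itself derived from continuous logarithms: they can be continued
along homotopies, but an odd function on the circle has none.

For a simple closed curve, removing a small piece of an edge leaves a set on which every z - q, with
q off the set, has a logarithm. Such a set cannot contain the frontier of a bounded set with a point
off it (`HasLogs.not_frontier_subset`). Hence every edge borders each bounded face and the unbounded
one, the bounded face is unique if there is one, and its walk is L or the reversed L up to rotation.
Its holonomy is Haar distributed, so the expectation u(t) is the integral of ρ_t against a function
with value 1 at the identity. Thus u tends to 1 as t → 0, and u' = -u/2 gives the exponential. -/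

open PlanarYM

/-! ### Continuous logarithms and planar separation -/

section PlaneTopology

open Set Metric

/-- A logarithm can be continued along a homotopy of nonvanishing functions. -/
lemma exists_log_of_homotopy {A : Type*} [TopologicalSpace A] {H : unitInterval × A → ℂ}
    (hH : Continuous H) (h0 : ∀ p, H p ≠ 0) {g : A → ℂ} (hg : Continuous g)
    (hg0 : ∀ a, Complex.exp (g a) = H (0, a)) :
    ∃ g₁ : A → ℂ, Continuous g₁ ∧ ∀ a, Complex.exp (g₁ a) = H (1, a) := by
  let H' : C(unitInterval × A, {z : ℂ // z ≠ 0}) := ⟨fun p => ⟨H p, h0 p⟩, by fun_prop⟩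
  let f : C(A, ℂ) := ⟨g, hg⟩
  have h : ∀ a, H' (0, a) = (fun z : ℂ ↦ (⟨_, z.exp_ne_zero⟩ : {z : ℂ // z ≠ 0})) (f a) :=
    fun a => Subtype.ext (hg0 a).symm
  refine ⟨fun a => Complex.isCoveringMap_exp.liftHomotopy H' f h (1, a), by fun_prop, fun a => ?_⟩
  exact congrArg Subtype.val
    (congrFun (Complex.isCoveringMap_exp.liftHomotopy_lifts H' f h) (1, a))

/-- An odd function on the unit circle has no logarithm. -/
lemma not_exp_odd_on_sphere {g : sphere (0 : ℂ) 1 → ℂ} (hg : Continuous g)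
    (hodd : ∀ z, Complex.exp (g (-z)) = -Complex.exp (g z)) : False := by
  have hconn : IsConnected (sphere (0 : ℂ) 1) :=
    isConnected_sphere (by simp) 0 zero_le_one
  have := isConnected_iff_connectedSpace.1 hconn
  -- This function is odd on a connected set, so it has a zero. There g(-z) - g(z) is real, while
  -- its exponential is -1.
  let h : sphere (0 : ℂ) 1 → ℝ := fun z => (g (-z) - g z).im
  have hc : Continuous h :=
    Complex.continuous_im.comp ((hg.comp continuous_neg).sub hg)
  have hneg : ∀ z, h (-z) = -h z := fun z => by simp [h]
  have hzero : ∃ z, h z = 0 := by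
    obtain ⟨z⟩ : Nonempty (sphere (0 : ℂ) 1) := this.toNonempty
    rcases le_total (h z) 0 with hz | hz
    · exact mem_range_of_exists_le_of_exists_ge hc ⟨z, hz⟩ ⟨-z, by rw [hneg]; linarith⟩
    · exact mem_range_of_exists_le_of_exists_ge hc ⟨-z, by rw [hneg]; linarith⟩ ⟨z, hz⟩
  obtain ⟨z, hz⟩ := hzero
  have h1 : Complex.exp (g (-z) - g z) = -1 := by
    rw [Complex.exp_sub, hodd, neg_div, div_self (Complex.exp_ne_zero _)]
  have h2 : (g (-z) - g z) = (((g (-z) - g z).re : ℝ) : ℂ) := by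
    apply Complex.ext
    · simp
    · rw [Complex.ofReal_im]; exact hz
  rw [h2, ← Complex.ofReal_exp] at h1
  have h3 := congrArg Complex.re h1
  rw [Complex.ofReal_re] at h3
  have := Real.exp_pos (g (-z) - g z).re
  rw [h3] at this
  norm_num at this

lemma neg_smul_mem_closedBall {z : ℂ} (hz : z ∈ closedBall (0 : ℂ) 1) (s : unitInterval) :
    -((s : ℝ) • z) ∈ closedBall (0 : ℂ) 1 := by
  rw [mem_closedBall_zero_iff] at *
  rw [norm_neg, norm_smul, Real.norm_eq_abs, abs_of_nonneg s.2.1]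
  exact mul_le_one₀ s.2.2 (norm_nonneg _) hz

lemma smul_mem_closedBall {z : ℂ} (hz : z ∈ closedBall (0 : ℂ) 1) (s : unitInterval) :
    ((s : ℝ) • z) ∈ closedBall (0 : ℂ) 1 := by
  have := neg_smul_mem_closedBall hz s
  rw [mem_closedBall_zero_iff] at *
  rwa [norm_neg] at this

/-- An injective continuous map on the closed unit disk maps it to a neighbourhood of the image of
the center. -/
theorem image_closedBall_mem_nhds {ψ : ℂ → ℂ} (hc : ContinuousOn ψ (closedBall 0 1))
    (hi : InjOn ψ (closedBall 0 1)) : ψ '' closedBall 0 1 ∈ 𝓝 (ψ 0) := by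
  have hsD : sphere (0 : ℂ) 1 ⊆ closedBall 0 1 := sphere_subset_closedBall
  have h0D : (0 : ℂ) ∈ closedBall (0 : ℂ) 1 := mem_closedBall_self zero_le_one
  have hψs : Continuous fun z : sphere (0 : ℂ) 1 => ψ z :=
    continuousOn_iff_continuous_domRestrict.1 (hc.mono hsD)
  -- The homotopy ψ(z) - ψ(-sz) leads from ψ(z) - ψ(0) to the odd function ψ(z) - ψ(-z). It does not
  -- vanish, since z = -sz forces z = 0.
  have hnolog : ∀ g : sphere (0 : ℂ) 1 → ℂ, Continuous g →
      (∀ z, Complex.exp (g z) = ψ z - ψ 0) → False := by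
    intro g hg hgz
    obtain ⟨g₁, hg₁, h₁⟩ := exists_log_of_homotopy (A := sphere (0 : ℂ) 1)
      (H := fun p => ψ p.2 - ψ (-((p.1 : ℝ) • (p.2 : ℂ))))
      ((hψs.comp continuous_snd).sub (hc.comp_continuous (by fun_prop)
        fun p => neg_smul_mem_closedBall (hsD p.2.2) p.1))
      (fun p hp => by
        have := hi (hsD p.2.2) (neg_smul_mem_closedBall (hsD p.2.2) p.1) (sub_eq_zero.1 hp)
        have h2 : ((1 : ℝ) + (p.1 : ℝ)) • (p.2 : ℂ) = 0 := by
          rw [add_smul, one_smul]; nth_rewrite 1 [this]; simp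
        have h3 : (1 : ℝ) + (p.1 : ℝ) ≠ 0 := by have := p.1.2.1; positivity
        have h4 := (smul_eq_zero.1 h2).resolve_left h3
        exact ne_of_mem_sphere p.2.2 one_ne_zero h4)
      hg (fun z => by simp [hgz])
    refine not_exp_odd_on_sphere hg₁ fun z => ?_
    rw [h₁, h₁]; simp
  have hU : IsOpen (ψ '' sphere 0 1)ᶜ :=
    ((isCompact_sphere 0 1).image_of_continuousOn (hc.mono hsD)).isClosed.isOpen_compl
  have hp : ψ 0 ∈ (ψ '' sphere 0 1)ᶜ := by
    rintro ⟨z, hz, hz0⟩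
    have := hi (hsD hz) h0D hz0
    exact ne_of_mem_sphere hz one_ne_zero this
  have hC := hU.connectedComponentIn (x := ψ 0)
  refine Filter.mem_of_superset (hC.mem_nhds (mem_connectedComponentIn hp)) fun q hq => ?_
  -- If ψ omits q, then ψ(sz) - q contracts ψ(z) - q to a constant, so the latter has a logarithm on
  -- the circle. Moving q to ψ(0) along a path that avoids the image of the circle gives one for
  -- ψ(z) - ψ(0), which `hnolog` excludes.
  by_contra hqD
  have hpc : IsPathConnected (connectedComponentIn (ψ '' sphere 0 1)ᶜ (ψ 0)) :=
    hC.isConnected_iff_isPathConnected.1 (isConnected_connectedComponentIn_iff.2 hp)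
  obtain ⟨γ, hγ⟩ := hpc.joinedIn q hq (ψ 0) (mem_connectedComponentIn hp)
  obtain ⟨g₀, hg₀, h₀⟩ := exists_log_of_homotopy (A := sphere (0 : ℂ) 1)
      (H := fun p : unitInterval × sphere (0 : ℂ) 1 => ψ ((p.1 : ℝ) • (p.2 : ℂ)) - q)
      ((hc.comp_continuous (by fun_prop) fun p : unitInterval × sphere (0 : ℂ) 1 =>
          smul_mem_closedBall (hsD p.2.2) p.1).sub
        continuous_const)
      (fun p h => hqD ⟨_, smul_mem_closedBall (hsD p.2.2) p.1, sub_eq_zero.1 h⟩)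
      (g := fun _ => Complex.log (ψ 0 - q)) continuous_const
      (fun a => by
        rw [Complex.exp_log (fun h => hqD ⟨0, h0D, sub_eq_zero.1 h⟩)]; simp)
  obtain ⟨g₁, hg₁, h₁⟩ := exists_log_of_homotopy (A := sphere (0 : ℂ) 1)
      (H := fun p => ψ p.2 - γ p.1)
      ((hψs.comp continuous_snd).sub (γ.continuous.comp continuous_fst))
      (fun p h => connectedComponentIn_subset _ _ (hγ p.1) ⟨_, p.2.2, sub_eq_zero.1 h⟩)
      hg₀ (fun z => by simp [h₀])
  exact hnolog g₁ hg₁ fun z => by simp [h₁]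

/-- For `q` outside `S`, the function `z ↦ z - q` has a continuous logarithm on `S`. -/
def HasLogs (S : Set ℂ) : Prop :=
  ∀ q ∉ S, ∃ g : ℂ → ℂ, ContinuousOn g S ∧ ∀ z ∈ S, Complex.exp (g z) = z - q

/-- A closed set with logarithms does not contain the boundary of a bounded set, unless it contains
the bounded set. -/
theorem HasLogs.not_frontier_subset {S C : Set ℂ} (hS : IsClosed S) (hl : HasLogs S)
    (hCb : Bornology.IsBounded C) {q : ℂ} (hq : q ∈ C) (hqS : q ∉ S)
    (hfr : frontier C ⊆ S) : False := by
  obtain ⟨g, hg, hgS⟩ := hl q hqS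
  obtain ⟨G, hG⟩ := ContinuousMap.exists_restrict_eq hS
    (⟨S.domRestrict g, continuousOn_iff_continuous_domRestrict.1 hg⟩ : C(S, ℂ))
  have hGS : ∀ z ∈ S, Complex.exp (G z) = z - q := fun z hz => by
    rw [← hgS z hz]
    exact congrArg Complex.exp (DFunLike.congr_fun hG ⟨z, hz⟩)
  classical
  -- The two formulas agree on the frontier of C, so r is continuous and nowhere zero on the plane.
  -- Shrinking a large circle around q gives r a logarithm there, but on that circle r is z - q,
  -- which is odd about q.
  let r : ℂ → ℂ := fun z => if z ∈ C then Complex.exp (G z) else z - q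
  have hr : Continuous r := Continuous.if (fun z hz => hGS z (hfr hz))
    (Complex.continuous_exp.comp G.continuous) (continuous_id.sub continuous_const)
  have hr0 : ∀ z, r z ≠ 0 := fun z => by
    by_cases h : z ∈ C
    · simp only [r, h, if_true]; exact Complex.exp_ne_zero _
    · simp only [r, h, if_false]; intro h2; exact h (sub_eq_zero.1 h2 ▸ hq)
  obtain ⟨R, hR, hCR⟩ := hCb.subset_ball_lt 0 q
  obtain ⟨g₁, hg₁, h₁⟩ := exists_log_of_homotopy (A := sphere (0 : ℂ) 1)
      (H := fun p => r (q + (p.1 : ℝ) • R • (p.2 : ℂ)))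
      (hr.comp (by fun_prop)) (fun p => hr0 _)
      (g := fun _ => Complex.log (r q)) continuous_const
      (fun a => by rw [Complex.exp_log (hr0 q)]; simp)
  have h2 : ∀ z : sphere (0 : ℂ) 1, Complex.exp (g₁ z) = R • (z : ℂ) := fun z => by
    rw [h₁]
    have : q + R • (z : ℂ) ∉ C := fun h => by
      have := mem_ball_iff_norm.1 (hCR h)
      rw [add_sub_cancel_left, norm_smul, norm_eq_of_mem_sphere z, Real.norm_eq_abs,
        abs_of_pos hR, mul_one] at this
      exact lt_irrefl _ this
    simp only [Set.Icc.coe_one, one_smul, r, this, if_false, add_sub_cancel_left]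
  refine not_exp_odd_on_sphere hg₁ fun z => ?_
  rw [h2, h2]; simp

/-- Two closed sets with logarithms that meet in a single point have a union with logarithms. -/
lemma HasLogs.union {S T : Set ℂ} (hS : IsClosed S) (hT : IsClosed T) (lS : HasLogs S)
    (lT : HasLogs T) (v : ℂ) (hv : S ∩ T ⊆ {v}) : HasLogs (S ∪ T) := by
  intro q hq
  obtain ⟨g, hg, hgS⟩ := lS q fun h => hq (Or.inl h)
  obtain ⟨k, hk, hkT⟩ := lT q fun h => hq (Or.inr h)
  classical
  by_cases hvST : v ∈ S ∧ v ∈ T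
  -- At v the two logarithms have the same exponential, so k can be shifted by the constant that
  -- makes them agree there.
  · let k' : ℂ → ℂ := fun z => k z + (g v - k v)
    have hk'T : ∀ z ∈ T, Complex.exp (k' z) = z - q := fun z hz => by
      rw [Complex.exp_add, Complex.exp_sub, hgS v hvST.1, hkT v hvST.2, hkT z hz,
        div_self, mul_one]
      intro h
      exact hq (Or.inl (sub_eq_zero.1 h ▸ hvST.1))
    refine ⟨S.piecewise g k', ?_, ?_⟩
    · refine ContinuousOn.union_of_isClosed ?_ ?_ hS hT
      · exact hg.congr fun z hz => Set.piecewise_eq_of_mem _ _ _ hz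
      · refine (hk.add (continuousOn_const (c := g v - k v))).congr fun z hz => ?_
        by_cases hzS : z ∈ S
        · obtain rfl : z = v := hv ⟨hzS, hz⟩
          rw [Set.piecewise_eq_of_mem _ _ _ hzS]; exact (add_sub_cancel _ _).symm
        · rw [Set.piecewise_eq_of_notMem _ _ _ hzS]; rfl
    · intro z hz
      by_cases hzS : z ∈ S
      · rw [Set.piecewise_eq_of_mem _ _ _ hzS, hgS z hzS]
      · rw [Set.piecewise_eq_of_notMem _ _ _ hzS, hk'T z (hz.resolve_left hzS)]
  · have hdis : ∀ z ∈ T, z ∉ S := fun z hzT hzS => by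
      obtain rfl : z = v := hv ⟨hzS, hzT⟩
      exact hvST ⟨hzS, hzT⟩
    refine ⟨S.piecewise g k, ?_, ?_⟩
    · refine ContinuousOn.union_of_isClosed ?_ ?_ hS hT
      · exact hg.congr fun z hz => Set.piecewise_eq_of_mem _ _ _ hz
      · exact hk.congr fun z hz => Set.piecewise_eq_of_notMem _ _ _ (hdis z hz)
    · intro z hz
      by_cases hzS : z ∈ S
      · rw [Set.piecewise_eq_of_mem _ _ _ hzS, hgS z hzS]
      · rw [Set.piecewise_eq_of_notMem _ _ _ hzS, hkT z (hz.resolve_left hzS)]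

/-- The image of an interval under an injective continuous map has logarithms. -/
lemma hasLogs_image_Icc {γ : ℝ → ℂ} {a b : ℝ} (hab : a ≤ b) (hc : ContinuousOn γ (Icc a b))
    (hi : InjOn γ (Icc a b)) : HasLogs (γ '' Icc a b) := by
  intro q hq
  let A := Icc a b
  have hγ : Continuous fun s : A => γ s := continuousOn_iff_continuous_domRestrict.1 hc
  have hmem : ∀ (t : unitInterval) (s : A), a + (t : ℝ) * (s - a) ∈ Icc a b := fun t s => by
    have h1 := t.2.1; have h2 := t.2.2; have h3 := s.2.1; have h4 := s.2.2
    constructor <;> nlinarith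
  -- The arc is contracted along itself to its initial point, which keeps it away from q.
  obtain ⟨g, hg, hgs⟩ := exists_log_of_homotopy (A := A)
      (H := fun p : unitInterval × A => γ (a + (p.1 : ℝ) * (p.2 - a)) - q)
      ((hc.comp_continuous (by fun_prop) fun p : unitInterval × A => hmem p.1 p.2).sub
        continuous_const)
      (fun p h => hq ⟨_, hmem p.1 p.2, sub_eq_zero.1 h⟩)
      (g := fun _ => Complex.log (γ a - q)) continuous_const
      (fun s => by
        rw [Complex.exp_log (fun h => hq ⟨a, left_mem_Icc.2 hab, sub_eq_zero.1 h⟩)]; simp)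
  -- The arc is homeomorphic to its parameter interval, so the logarithm in the parameter becomes
  -- one on the image; off the image its value is the irrelevant default 0.
  have hemb : IsClosedEmbedding fun s : A => γ s :=
    hγ.isClosedEmbedding fun s t h => Subtype.ext (hi s.2 t.2 h)
  have hcont : ContinuousOn (Function.extend (fun s : A => γ s) g 0) (γ '' Icc a b) := by
    have hinj := hemb.injective
    let e := hemb.isEmbedding.toHomeomorph
    have hr : range (fun s : A => γ s) = γ '' Icc a b := by
      rw [← Subtype.range_val (s := Icc a b), ← range_comp]; rfl
    rw [← hr, continuousOn_iff_continuous_domRestrict]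
    have : (range fun s : A => γ s).domRestrict (Function.extend (fun s : A => γ s) g 0)
        = g ∘ e.symm := by
      funext z
      obtain ⟨s, rfl⟩ := e.surjective z
      simp only [Function.comp, Homeomorph.symm_apply_apply]
      exact hinj.extend_apply g 0 s
    rw [this]
    exact hg.comp e.symm.continuous
  refine ⟨_, hcont, ?_⟩
  rintro _ ⟨s, hs, rfl⟩
  have := hemb.injective.extend_apply g 0 (⟨s, hs⟩ : A)
  simp only at this
  rw [this, hgs]
  simp

end PlaneTopology

/-! ### Half disks glued along a diameter -/

section HalfDisks

open Set Metric

/-- Two half disks glued along their common diameter cover a neighbourhood of its midpoint. -/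
lemma image_halfDisks_mem_nhds {κ₁ κ₂ : ℝ × ℝ → ℂ}
    (hc₁ : ContinuousOn κ₁ (Icc (-1) 1 ×ˢ Icc 0 1)) (hc₂ : ContinuousOn κ₂ (Icc (-1) 1 ×ˢ Icc 0 1))
    (hi₁ : InjOn κ₁ (Icc (-1) 1 ×ˢ Icc 0 1)) (hi₂ : InjOn κ₂ (Icc (-1) 1 ×ˢ Icc 0 1))
    (heq : ∀ x ∈ Icc (-1 : ℝ) 1, κ₁ (x, 0) = κ₂ (x, 0))
    (hne : ∀ p ∈ Icc (-1 : ℝ) 1 ×ˢ Icc (0 : ℝ) 1, ∀ q ∈ Icc (-1 : ℝ) 1 ×ˢ Ioc (0 : ℝ) 1,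
      κ₁ p ≠ κ₂ q) :
    κ₁ '' (Icc (-1) 1 ×ˢ Icc 0 1) ∪ κ₂ '' (Icc (-1) 1 ×ˢ Icc 0 1) ∈ 𝓝 (κ₁ (0, 0)) := by
  classical
  -- The first half disk is placed above the real axis and the mirrored second one below; the result
  -- is continuous and injective on the unit disk.
  let ψ : ℂ → ℂ := fun z => if 0 ≤ z.im then κ₁ (z.re, z.im) else κ₂ (z.re, -z.im)
  have hmem₁ : ∀ z ∈ closedBall (0 : ℂ) 1, 0 ≤ z.im →
      (z.re, z.im) ∈ Icc (-1 : ℝ) 1 ×ˢ Icc (0 : ℝ) 1 := fun z hz h0 => by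
    rw [mem_closedBall_zero_iff] at hz
    exact ⟨abs_le.1 ((Complex.abs_re_le_norm z).trans hz), h0,
      (abs_le.1 ((Complex.abs_im_le_norm z).trans hz)).2⟩
  have hmem₂ : ∀ z ∈ closedBall (0 : ℂ) 1, z.im ≤ 0 →
      (z.re, -z.im) ∈ Icc (-1 : ℝ) 1 ×ˢ Icc (0 : ℝ) 1 := fun z hz h0 => by
    rw [mem_closedBall_zero_iff] at hz
    exact ⟨abs_le.1 ((Complex.abs_re_le_norm z).trans hz), by simpa using h0,
      by have := (abs_le.1 ((Complex.abs_im_le_norm z).trans hz)).1; simp only; linarith⟩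
  have hψ₂ : ∀ z ∈ closedBall (0 : ℂ) 1, z.im ≤ 0 → ψ z = κ₂ (z.re, -z.im) := fun z hz h0 => by
    by_cases h : 0 ≤ z.im
    · have h1 : z.im = 0 := le_antisymm h0 h
      have := heq z.re (hmem₁ z hz h).1
      simp only [ψ, h, if_true]
      rw [h1, this, neg_zero]
    · simp only [ψ, h, if_false]
  have hcont : ContinuousOn ψ (closedBall 0 1) := by
    have hD : closedBall (0 : ℂ) 1 = (closedBall 0 1 ∩ {z | 0 ≤ z.im}) ∪
        (closedBall 0 1 ∩ {z | z.im ≤ 0}) := by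
      ext z
      have := le_total 0 z.im
      simp only [mem_union, mem_inter_iff, mem_ofPred_eq]
      tauto
    rw [hD]
    refine ContinuousOn.union_of_isClosed ?_ ?_
      (isClosed_closedBall.inter (isClosed_le continuous_const Complex.continuous_im))
      (isClosed_closedBall.inter (isClosed_le Complex.continuous_im continuous_const))
    · refine (hc₁.comp (f := fun z : ℂ => (z.re, z.im)) (by fun_prop)
        fun z hz => hmem₁ z hz.1 hz.2).congr fun z hz => ?_
      have : 0 ≤ z.im := hz.2
      simp [ψ, this]
    · exact (hc₂.comp (f := fun z : ℂ => (z.re, -z.im)) (by fun_prop)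
        fun z hz => hmem₂ z hz.1 hz.2).congr fun z hz => hψ₂ z hz.1 hz.2
  have hinj : InjOn ψ (closedBall 0 1) := by
    have key : ∀ z ∈ closedBall (0 : ℂ) 1, ∀ z' ∈ closedBall (0 : ℂ) 1, 0 ≤ z.im → z'.im < 0 →
        ψ z ≠ ψ z' := fun z hz z' hz' h h' => by
      rw [hψ₂ z' hz' h'.le]
      have : ψ z = κ₁ (z.re, z.im) := by simp [ψ, h]
      rw [this]
      have h2 := hmem₂ z' hz' h'.le
      exact hne _ (hmem₁ z hz h) _ ⟨h2.1, by simpa using h', h2.2.2⟩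
    intro z hz z' hz' hzz'
    rcases le_or_gt 0 z.im with h | h <;> rcases le_or_gt 0 z'.im with h' | h'
    · have h1 : κ₁ (z.re, z.im) = κ₁ (z'.re, z'.im) := by simpa [ψ, h, h'] using hzz'
      have h2 := hi₁ (hmem₁ z hz h) (hmem₁ z' hz' h') h1
      simp only [Prod.mk.injEq] at h2
      exact Complex.ext h2.1 h2.2
    · exact absurd hzz' (key z hz z' hz' h h')
    · exact absurd hzz'.symm (key z' hz' z hz h' h)
    · rw [hψ₂ z hz h.le, hψ₂ z' hz' h'.le] at hzz'
      have h2 := hi₂ (hmem₂ z hz h.le) (hmem₂ z' hz' h'.le) hzz'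
      simp only [Prod.mk.injEq, neg_inj] at h2
      exact Complex.ext h2.1 h2.2
  have h := image_closedBall_mem_nhds hcont hinj
  have h0 : ψ 0 = κ₁ (0, 0) := by simp [ψ]
  rw [h0] at h
  refine Filter.mem_of_superset h ?_
  rintro _ ⟨z, hz, rfl⟩
  rcases le_or_gt 0 z.im with h | h
  · exact Or.inl ⟨_, hmem₁ z hz h, by simp [ψ, h]⟩
  · exact Or.inr ⟨_, hmem₂ z hz h.le, (hψ₂ z hz h.le).symm⟩

/-- Polar coordinates near the middle of the `j`-th of `n` equal arcs of the unit circle. -/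
noncomputable def polarSector (n j : ℕ) (p : ℝ × ℝ) : ℂ :=
  ((1 - p.2 / 2 : ℝ) : ℂ) *
    Complex.exp (2 * Real.pi * Complex.I * (((j : ℕ) + ((1 / 2 + p.1 / 4 : ℝ) : ℂ)) / n))

lemma continuous_polarSector (n j : ℕ) : Continuous (polarSector n j) := by
  unfold polarSector
  fun_prop

lemma norm_polarSector (n j : ℕ) {p : ℝ × ℝ} (hp : p.2 ∈ Icc (0 : ℝ) 1) :
    ‖polarSector n j p‖ = 1 - p.2 / 2 := by
  have : (2 * Real.pi * Complex.I * (((j : ℕ) + ((1 / 2 + p.1 / 4 : ℝ) : ℂ)) / n) : ℂ)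
      = ((2 * Real.pi * ((j + (1 / 2 + p.1 / 4)) / n) : ℝ) : ℂ) * Complex.I := by
    push_cast; ring
  rw [polarSector, norm_mul, this, Complex.norm_exp_ofReal_mul_I, mul_one, Complex.norm_real,
    Real.norm_eq_abs, abs_of_pos]
  have := hp.2
  linarith

/-- The arc parameter 1/2 + x/4 stays in [1/4, 3/4] and the radius 1 - y/2 is at least 1/2. So the
sectors of different arcs are disjoint, and the origin, where polar coordinates degenerate, is
avoided. -/
lemma polarSector_inj {n j j' : ℕ} (hj : j < n) (hj' : j' < n) {p p' : ℝ × ℝ}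
    (hp : p ∈ Icc (-1 : ℝ) 1 ×ˢ Icc (0 : ℝ) 1) (hp' : p' ∈ Icc (-1 : ℝ) 1 ×ˢ Icc (0 : ℝ) 1)
    (h : polarSector n j p = polarSector n j' p') : j = j' ∧ p = p' := by
  have hy : p.2 = p'.2 := by
    have := congrArg norm h
    rw [norm_polarSector n j hp.2, norm_polarSector n j' hp'.2] at this
    linarith
  have hn : 0 < n := by omega
  rw [polarSector, polarSector, ← hy] at h
  have h1 : ((1 - p.2 / 2 : ℝ) : ℂ) ≠ 0 := by
    have := hp.2.2
    exact Complex.ofReal_ne_zero.2 (by linarith)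
  obtain ⟨m, hm⟩ := Complex.exp_eq_exp_iff_exists_int.1 (mul_left_cancel₀ h1 h)
  have h2 : (j + (1 / 2 + p.1 / 4)) / n = (j' + (1 / 2 + p'.1 / 4)) / n + (m : ℝ) := by
    have hpi : (2 * Real.pi * Complex.I : ℂ) ≠ 0 := Complex.two_pi_I_ne_zero
    have : (((j : ℕ) + ((1 / 2 + p.1 / 4 : ℝ) : ℂ)) / n)
        = (((j' : ℕ) + ((1 / 2 + p'.1 / 4 : ℝ) : ℂ)) / n) + m := by
      apply mul_left_cancel₀ hpi
      rw [hm]; ring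
    exact_mod_cast this
  have hn' : (0 : ℝ) < n := by exact_mod_cast hn
  have h3 : (j : ℝ) + (1 / 2 + p.1 / 4) = j' + (1 / 2 + p'.1 / 4) + m * n := by
    field_simp at h2
    linarith
  have hx := hp.1.1; have hx1 := hp.1.2; have hx' := hp'.1.1; have hx1' := hp'.1.2
  -- The two offsets x/4 differ by at most 1/2, so this integer lies strictly between -1 and 1.
  have h4 : (j : ℤ) - j' - m * n < 1 := by
    have : ((j : ℤ) - j' - m * n : ℝ) < 1 := by push_cast; linarith
    exact_mod_cast this
  have h5 : -1 < (j : ℤ) - j' - m * n := by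
    have : (-1 : ℝ) < ((j : ℤ) - j' - m * n : ℝ) := by push_cast; linarith
    exact_mod_cast this
  have h6 : (j : ℤ) = j' + m * n := by omega
  have hm0 : m = 0 := by
    by_contra hm0
    rcases lt_or_gt_of_ne hm0 with h | h
    · have : m * (n : ℤ) ≤ -n := by nlinarith
      omega
    · have : (n : ℤ) ≤ m * (n : ℤ) := by nlinarith
      omega
  have hjj : j = j' := by rw [hm0] at h6; omega
  refine ⟨hjj, Prod.ext ?_ hy⟩
  rw [hm0, hjj] at h3
  simp only [Int.cast_zero, zero_mul, add_zero] at h3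
  linarith

end HalfDisks

/-! ### Faces and the half disks at an edge -/

namespace PlanarYM.PlaneGraph

open Set Metric

variable {E : Type*} (G : PlaneGraph E)

lemma isCompact_support [Finite E] : IsCompact G.support :=
  isCompact_iUnion fun e => isCompact_range (G.continuous_edge e)

lemma edge_mem_support (e : E) (s : unitInterval) : G.edge e s ∈ G.support :=
  mem_iUnion.2 ⟨e, s, rfl⟩

lemma path_mem_support (d : E × Bool) (s : unitInterval) : G.path d s ∈ G.support := by
  unfold path
  split_ifs
  · exact G.edge_mem_support _ _
  · exact G.edge_mem_support _ _

lemma range_path (d : E × Bool) : range (G.path d) = range (G.edge d.1) := by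
  obtain ⟨e, b⟩ := d
  cases b
  · have : G.path (e, false) = G.edge e ∘ unitInterval.symm := by funext s; simp [path]
    rw [this]
    exact unitInterval.symm_bijective.surjective.range_comp _
  · have : G.path (e, true) = G.edge e := by funext s; simp [path]
    rw [this]

variable {G}

lemma IsFace.subset_compl {F : Set ℂ} (hF : G.IsFace F) : F ⊆ G.supportᶜ := by
  obtain ⟨p, -, rfl⟩ := hF
  exact connectedComponentIn_subset _ _

lemma IsFace.notMem_support {F : Set ℂ} (hF : G.IsFace F) {z : ℂ} (hz : z ∈ F) :
    z ∉ G.support := hF.subset_compl hz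

lemma IsFace.nonempty {F : Set ℂ} (hF : G.IsFace F) : F.Nonempty := by
  obtain ⟨p, hp, rfl⟩ := hF
  exact ⟨p, mem_connectedComponentIn hp⟩

lemma IsFace.eq_connectedComponentIn {F : Set ℂ} (hF : G.IsFace F) {z : ℂ} (hz : z ∈ F) :
    F = connectedComponentIn G.supportᶜ z := by
  obtain ⟨p, hp, rfl⟩ := hF
  exact connectedComponentIn_eq hz

lemma IsFace.eq_of_mem {F F' : Set ℂ} (hF : G.IsFace F) (hF' : G.IsFace F') {z : ℂ} (hz : z ∈ F)
    (hz' : z ∈ F') : F = F' := by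
  rw [hF.eq_connectedComponentIn hz, hF'.eq_connectedComponentIn hz']

lemma IsFace.isOpen [Finite E] {F : Set ℂ} (hF : G.IsFace F) : IsOpen F := by
  obtain ⟨p, -, rfl⟩ := hF
  exact G.isCompact_support.isClosed.isOpen_compl.connectedComponentIn

/-- A frontier point off the graph would have an open component of its own. This meets F, hence
equals F, but the open set F contains no frontier point of itself. -/
lemma IsFace.frontier_subset [Finite E] {F : Set ℂ} (hF : G.IsFace F) :
    frontier F ⊆ G.support := by
  intro z hz
  by_contra hzs
  have hC : G.IsFace (connectedComponentIn G.supportᶜ z) := ⟨z, hzs, rfl⟩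
  have hzC : z ∈ connectedComponentIn G.supportᶜ z := mem_connectedComponentIn hzs
  obtain ⟨y, hyC, hyF⟩ := mem_closure_iff.1 (frontier_subset_closure hz) _ hC.isOpen hzC
  have := hC.eq_of_mem hF hyC hyF
  rw [hF.isOpen.frontier_eq] at hz
  exact hz.2 (this ▸ hzC)

/-- The midpoint parameter. -/
noncomputable def midParam : unitInterval := ⟨1 / 2, by norm_num, by norm_num⟩

/-- Distinct edges meet only at endpoints, so a midpoint identifies its edge; midpoints serve below
as witnesses for whole edges. -/
lemma edge_mid_mem_range_iff (e e' : E) : G.edge e midParam ∈ range (G.edge e') ↔ e = e' := by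
  refine ⟨?_, fun h => h ▸ ⟨_, rfl⟩⟩
  rintro ⟨s, hs⟩
  by_contra h
  rcases (G.meet_at_ends e e' midParam s h hs.symm).1 with h0 | h0 <;>
  · have := congrArg Subtype.val h0
    norm_num [midParam] at this

/-- A half disk in a face, attached to the middle part of an edge of its boundary walk. -/
lemma exists_halfDisk {F : Set ℂ} (hF : G.IsFace F) {w : List (E × Bool)} {φ : ℂ → ℂ}
    (hφc : ContinuousOn φ (closedBall 0 1)) (hφb : BijOn φ (ball 0 1) F)
    (hφw : ∀ (j : Fin w.length) (s : unitInterval),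
      φ (Complex.exp (2 * Real.pi * Complex.I * (((j : ℕ) + (s : ℝ)) / w.length))) =
        G.path (w.get j) s) (j : Fin w.length) :
    ∃ σ : ℝ × ℝ → ℝ × ℝ, (∀ p ∈ Icc (-1 : ℝ) 1 ×ˢ Icc (0 : ℝ) 1,
        σ p ∈ Icc (-1 : ℝ) 1 ×ˢ Icc (0 : ℝ) 1) ∧
      let κ := fun p => φ (polarSector w.length j (σ p))
      ContinuousOn κ (Icc (-1) 1 ×ˢ Icc 0 1) ∧ InjOn κ (Icc (-1) 1 ×ˢ Icc 0 1) ∧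
      (∀ p ∈ Icc (-1 : ℝ) 1 ×ˢ Ioc (0 : ℝ) 1, κ p ∈ F ∧
        polarSector w.length j (σ p) ∈ ball (0 : ℂ) 1) ∧
      ∀ x, ∀ hx : x ∈ Icc (-1 : ℝ) 1, κ (x, 0) = G.edge (w.get j).1
        ⟨1 / 2 + x / 4, by constructor <;> linarith [hx.1, hx.2]⟩ := by
  -- When the walk runs through the edge backwards, the first coordinate is reflected. The diameter
  -- is then always parametrized in the positive direction, so half disks of different occurrences
  -- match.
  let c : ℝ := if (w.get j).2 then 1 else -1
  let σ : ℝ × ℝ → ℝ × ℝ := fun p => (c * p.1, p.2)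
  have hc : c = 1 ∨ c = -1 := by
    by_cases h : (w.get j).2
    · exact Or.inl (if_pos h)
    · exact Or.inr (if_neg h)
  have hσ : ∀ p ∈ Icc (-1 : ℝ) 1 ×ˢ Icc (0 : ℝ) 1, σ p ∈ Icc (-1 : ℝ) 1 ×ˢ Icc (0 : ℝ) 1 := by
    rintro ⟨x, y⟩ ⟨hx, hy⟩
    refine ⟨?_, hy⟩
    simp only [σ]
    simp only [mem_Icc] at hx ⊢
    rcases hc with h | h <;> rw [h] <;> constructor <;> linarith [hx.1, hx.2]
  have hσi : Function.Injective σ := by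
    rintro ⟨x, y⟩ ⟨x', y'⟩ h
    simp only [σ, Prod.mk.injEq] at h ⊢
    refine ⟨?_, h.2⟩
    have h1 := h.1
    rcases hc with h | h <;> rw [h] at h1 <;> linarith
  have hball : ∀ p ∈ Icc (-1 : ℝ) 1 ×ˢ Ioc (0 : ℝ) 1,
      polarSector w.length j (σ p) ∈ ball (0 : ℂ) 1 := fun p hp => by
    rw [mem_ball_zero_iff, norm_polarSector (p := σ p) _ _ ⟨hp.2.1.le, hp.2.2⟩]
    have := hp.2.1
    simp only [σ]
    linarith
  have hcball : ∀ p ∈ Icc (-1 : ℝ) 1 ×ˢ Icc (0 : ℝ) 1,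
      polarSector w.length j (σ p) ∈ closedBall (0 : ℂ) 1 := fun p hp => by
    rw [mem_closedBall_zero_iff, norm_polarSector (p := σ p) _ _ hp.2]
    have := hp.2.1
    simp only [σ]
    linarith
  have hedge : ∀ x, ∀ hx : x ∈ Icc (-1 : ℝ) 1, φ (polarSector w.length j (σ (x, 0)))
      = G.edge (w.get j).1 ⟨1 / 2 + x / 4, by constructor <;> linarith [hx.1, hx.2]⟩ := by
    intro x hx
    have hcx : c * x ∈ Icc (-1 : ℝ) 1 := (hσ (x, 0) ⟨hx, by simp⟩).1
    have h := hφw j ⟨1 / 2 + c * x / 4, by constructor <;> linarith [hcx.1, hcx.2]⟩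
    have h2 : polarSector w.length j (σ (x, 0)) = Complex.exp (2 * Real.pi * Complex.I *
        (((j : ℕ) + (((⟨1 / 2 + c * x / 4, by constructor <;> linarith [hcx.1, hcx.2]⟩ :
          unitInterval) : ℝ) : ℂ)) / w.length)) := by
      simp only [polarSector, σ]
      norm_num
    rw [h2, h]
    unfold path
    by_cases hb : (w.get j).2
    · have hc1 : c = 1 := if_pos hb
      rw [if_pos hb]
      congr 2
      rw [hc1, one_mul]
    · have hc1 : c = -1 := if_neg hb
      rw [if_neg hb]
      congr 1
      apply Subtype.ext
      simp only [unitInterval.coe_symm_eq, hc1]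
      ring
  have hinF : ∀ p ∈ Icc (-1 : ℝ) 1 ×ˢ Ioc (0 : ℝ) 1, φ (polarSector w.length j (σ p)) ∈ F :=
    fun p hp => hφb.mapsTo (hball p hp)
  refine ⟨σ, hσ, ?_, ?_, fun p hp => ⟨hinF p hp, hball p hp⟩, hedge⟩
  · refine hφc.comp ((continuous_polarSector _ _).comp ?_).continuousOn hcball
    exact (continuous_const.mul continuous_fst).prodMk continuous_snd
  -- Points with positive second coordinate go into the face and the diameter goes into the graph,
  -- so the two kinds never collide.
  · have hcross : ∀ p ∈ Icc (-1 : ℝ) 1 ×ˢ Ioc (0 : ℝ) 1, ∀ x ∈ Icc (-1 : ℝ) 1,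
        φ (polarSector w.length j (σ p)) ≠ φ (polarSector w.length j (σ (x, 0))) := by
      intro p hp x hx h
      refine hF.notMem_support (hinF p hp) ?_
      rw [h, hedge x hx]
      exact G.edge_mem_support _ _
    rintro ⟨x, y⟩ hp ⟨x', y'⟩ hp' h
    rcases hp.2.1.eq_or_lt with hy | hy <;> rcases hp'.2.1.eq_or_lt with hy' | hy' <;>
      simp only at hy hy'
    · subst hy; subst hy'
      simp only at h
      rw [hedge x hp.1, hedge x' hp'.1] at h
      rcases G.injective_edge _ _ _ h with h | ⟨h, -⟩ | ⟨h, -⟩ <;> have := congrArg Subtype.val h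
      · simp only at this
        rw [show x = x' by linarith]
      · have h1 := hp.1.1
        norm_num at this h1
        linarith
      · have h1 := hp.1.2
        norm_num at this h1
        linarith
    · subst hy
      exact absurd h.symm (hcross _ ⟨hp'.1, hy', hp'.2.2⟩ _ hp.1)
    · subst hy'
      exact absurd h (hcross _ ⟨hp.1, hy, hp.2.2⟩ _ hp'.1)
    · have h1 := hφb.injOn (hball _ ⟨hp.1, hy, hp.2.2⟩) (hball _ ⟨hp'.1, hy', hp'.2.2⟩) h
      exact hσi (polarSector_inj j.2 j.2 (hσ _ hp) (hσ _ hp') h1).2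

/-- If an edge occurs in two different places of the boundary walks of bounded faces, then the
faces together with the graph cover a neighbourhood of its midpoint. -/
lemma union_mem_nhds_of_two_occurrences {w : G.BoundedFace → List (E × Bool)}
    (hw : ∀ F, G.IsBoundaryWalk F.1 (w F)) {F₁ F₂ : G.BoundedFace} (j₁ : Fin (w F₁).length)
    (j₂ : Fin (w F₂).length) (e : E) (h₁ : ((w F₁).get j₁).1 = e) (h₂ : ((w F₂).get j₂).1 = e)
    (hne : F₁ = F₂ → (j₁ : ℕ) ≠ j₂) :
    F₁.1 ∪ F₂.1 ∪ G.support ∈ 𝓝 (G.edge e midParam) := by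
  choose φ hφc hφb hφw using fun F => (hw F).2
  obtain ⟨σ₁, hσ₁, hc₁, hi₁, hF₁, he₁⟩ :=
    exists_halfDisk F₁.2.1 (hφc F₁) (hφb F₁) (hφw F₁) j₁
  obtain ⟨σ₂, hσ₂, hc₂, hi₂, hF₂, he₂⟩ :=
    exists_halfDisk F₂.2.1 (hφc F₂) (hφb F₂) (hφw F₂) j₂
  rw [h₁] at he₁
  rw [h₂] at he₂
  -- A point of the second half disk off the diameter lies in F₂. If the first half disk also
  -- contains it, then it lies in F₁, so the faces agree; injectivity on the open disk and
  -- `polarSector_inj` then force the same position in the walk.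
  have hd := image_halfDisks_mem_nhds hc₁ hc₂ hi₁ hi₂
    (fun x hx => (he₁ x hx).trans (he₂ x hx).symm) (by
      rintro ⟨x, y⟩ hp q hq h
      have hq2 := hF₂ q hq
      rcases hp.2.1.eq_or_lt with hy | hy <;> simp only at hy
      · subst hy
        refine F₂.2.1.notMem_support hq2.1 ?_
        simp only at he₁ ⊢
        rw [← h, he₁ x hp.1]
        exact G.edge_mem_support _ _
      · have hp2 := hF₁ (x, y) ⟨hp.1, hy, hp.2.2⟩
        have hFF : F₁ = F₂ := Subtype.ext (F₁.2.1.eq_of_mem F₂.2.1 hp2.1 (by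
          have h3 := hq2.1
          beta_reduce at h3 ⊢
          rwa [h]))
        subst hFF
        have := (hφb F₁).injOn hp2.2 hq2.2 h
        exact hne rfl (polarSector_inj j₁.2 j₂.2 (hσ₁ _ hp)
          (hσ₂ _ ⟨hq.1, hq.2.1.le, hq.2.2⟩) this).1)
  have h0 := he₁ 0 (by norm_num)
  simp only at h0 hd
  rw [h0] at hd
  have hm : (⟨1 / 2 + 0 / 4, by norm_num, by norm_num⟩ : unitInterval) = midParam :=
    Subtype.ext (by norm_num [midParam])
  rw [hm] at hd
  refine Filter.mem_of_superset hd ?_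
  rintro z (⟨⟨x, y⟩, hp, rfl⟩ | ⟨⟨x, y⟩, hp, rfl⟩)
  · rcases hp.2.1.eq_or_lt with hy | hy <;> simp only at hy
    · subst hy
      right
      simp only at he₁ ⊢
      rw [he₁ x hp.1]
      exact G.edge_mem_support _ _
    · exact Or.inl (Or.inl (hF₁ _ ⟨hp.1, hy, hp.2.2⟩).1)
  · rcases hp.2.1.eq_or_lt with hy | hy <;> simp only at hy
    · subst hy
      right
      simp only at he₂ ⊢
      rw [he₂ x hp.1]
      exact G.edge_mem_support _ _
    · exact Or.inl (Or.inr (hF₂ _ ⟨hp.1, hy, hp.2.2⟩).1)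

end PlanarYM.PlaneGraph

/-! ### Occurrences of an edge in the boundary walks -/

namespace PlanarYM.PlaneGraph

open Set Metric

variable {E : Type*} {G : PlaneGraph E}

/-- The unit circle is in the closure of the open disk, and the attaching map is continuous on the
closed disk. -/
lemma mem_closure_of_occurrence {F : Set ℂ} {w : List (E × Bool)} (hw : G.IsBoundaryWalk F w)
    (j : Fin w.length) : G.edge (w.get j).1 midParam ∈ closure F := by
  obtain ⟨-, φ, hφc, hφb, hφw⟩ := hw
  have hmem : G.edge (w.get j).1 midParam ∈ φ '' closedBall 0 1 := by
    have h1 : G.edge (w.get j).1 midParam ∈ range (G.path (w.get j)) := by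
      rw [range_path]; exact ⟨_, rfl⟩
    obtain ⟨s, hs⟩ := h1
    refine ⟨_, ?_, (hφw j s).trans hs⟩
    rw [mem_closedBall_zero_iff]
    have : (2 * Real.pi * Complex.I * (((j : ℕ) + ((s : ℝ) : ℂ)) / w.length) : ℂ)
        = ((2 * Real.pi * ((j + s) / w.length) : ℝ) : ℂ) * Complex.I := by push_cast; ring
    rw [this, Complex.norm_exp_ofReal_mul_I]
  rw [← closure_ball (0 : ℂ) one_ne_zero] at hmem hφc
  have := hφc.image_closure hmem
  rwa [hφb.image_eq] at this

/-- With the argument written as a fraction θ in [0, 1) of a full turn, the floor of nθ selects the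
arc and the fractional part of nθ is the parameter on it. -/
lemma exists_mem_circle_arc {n : ℕ} (hn : 0 < n) {z : ℂ} (hz : ‖z‖ = 1) :
    ∃ (j : Fin n) (s : unitInterval),
      z = Complex.exp (2 * Real.pi * Complex.I * (((j : ℕ) + ((s : ℝ) : ℂ)) / n)) := by
  have hpi := Real.pi_pos
  set θ : ℝ := Int.fract (Complex.arg z / (2 * Real.pi)) with hθ
  have hn' : (0 : ℝ) < n := by exact_mod_cast hn
  have h0 : 0 ≤ θ := Int.fract_nonneg _
  have h1 : θ < 1 := Int.fract_lt_one _
  have hnθ : 0 ≤ θ * n := by positivity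
  have hj : ⌊θ * n⌋₊ < n := (Nat.floor_lt hnθ).2 (by nlinarith)
  refine ⟨⟨_, hj⟩, ⟨θ * n - ⌊θ * n⌋₊, sub_nonneg.2 (Nat.floor_le hnθ), ?_⟩, ?_⟩
  · have := Nat.lt_floor_add_one (θ * n)
    linarith
  · have e : (2 * Real.pi * Complex.I * ((((⟨⌊θ * n⌋₊, hj⟩ : Fin n) : ℕ) +
        ((θ * n - ⌊θ * n⌋₊ : ℝ) : ℂ)) / n) : ℂ) = Complex.arg z * Complex.I -
        (⌊Complex.arg z / (2 * Real.pi)⌋ : ℂ) * (2 * Real.pi * Complex.I) := by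
      have hnc : (n : ℂ) ≠ 0 := by exact_mod_cast hn.ne'
      have hθ' : (θ : ℂ) = Complex.arg z / (2 * Real.pi)
          - (⌊Complex.arg z / (2 * Real.pi)⌋ : ℂ) := by
        rw [hθ, Int.fract]; push_cast; ring
      have hpc : (Real.pi : ℂ) ≠ 0 := by exact_mod_cast hpi.ne'
      push_cast
      rw [hθ']
      field_simp
      ring
    simp only at e ⊢
    rw [e, Complex.exp_sub, Complex.exp_int_mul_two_pi_mul_I, div_one]
    have := Complex.norm_mul_exp_arg_mul_I z
    rw [hz] at this
    simpa using this.symm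

/-- An edge whose midpoint is on the boundary of a face occurs in the boundary walk. -/
lemma exists_occurrence [Finite E] {F : Set ℂ} (hF : G.IsFace F) {w : List (E × Bool)}
    (hw : G.IsBoundaryWalk F w) {e : E} (he : G.edge e midParam ∈ frontier F) :
    ∃ j : Fin w.length, (w.get j).1 = e := by
  obtain ⟨hne, φ, hφc, hφb, hφw⟩ := hw
  -- The image of the closed disk is compact, so it contains the closure of F. The open disk goes
  -- into F, which misses the graph; so a midpoint on the frontier comes from the circle.
  have hcl : closure F ⊆ φ '' closedBall 0 1 := by
    refine closure_minimal ?_ ((isCompact_closedBall 0 1).image_of_continuousOn hφc).isClosed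
    rw [← hφb.image_eq]
    exact image_mono ball_subset_closedBall
  obtain ⟨z, hz, hze⟩ := hcl (frontier_subset_closure he)
  have hz1 : ‖z‖ = 1 := by
    refine le_antisymm (mem_closedBall_zero_iff.1 hz) (not_lt.1 fun h => ?_)
    have := hφb.mapsTo (mem_ball_zero_iff.2 h)
    rw [hze] at this
    exact hF.notMem_support this (G.edge_mem_support _ _)
  obtain ⟨j, s, rfl⟩ := exists_mem_circle_arc (List.length_pos_iff.2 hne) hz1
  refine ⟨j, ?_⟩
  rw [hφw j s] at hze
  have : G.edge e midParam ∈ range (G.edge (w.get j).1) := by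
    rw [← range_path]; exact ⟨s, hze⟩
  exact ((G.edge_mid_mem_range_iff _ _).1 this).symm

/-- An edge of the boundary of the unbounded face occurs at most once in the boundary walks of the
bounded faces. -/
lemma occurrence_unique [Finite E] {w : G.BoundedFace → List (E × Bool)}
    (hw : ∀ F, G.IsBoundaryWalk F.1 (w F)) {U : Set ℂ} (hU : G.IsFace U)
    (hUb : ¬ Bornology.IsBounded U) {e : E} (he : G.edge e midParam ∈ closure U)
    {F₁ F₂ : G.BoundedFace} (j₁ : Fin (w F₁).length) (j₂ : Fin (w F₂).length)
    (h₁ : ((w F₁).get j₁).1 = e) (h₂ : ((w F₂).get j₂).1 = e) : F₁ = F₂ ∧ (j₁ : ℕ) = j₂ := by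
  by_contra h
  have hd := union_mem_nhds_of_two_occurrences hw j₁ j₂ e h₁ h₂ fun h3 h4 => h ⟨h3, h4⟩
  obtain ⟨y, hy, hyU⟩ := mem_closure_iff_nhds.1 he _ hd
  rcases hy with (hy | hy) | hy
  · exact hUb (hU.eq_of_mem F₁.2.1 hyU hy ▸ F₁.2.2)
  · exact hUb (hU.eq_of_mem F₂.2.1 hyU hy ▸ F₂.2.2)
  · exact hU.notMem_support hyU hy

/-- An edge is adjacent to at most two faces, so there are finitely many bounded faces. -/
lemma finite_boundedFace [Finite E] {w : G.BoundedFace → List (E × Bool)}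
    (hw : ∀ F, G.IsBoundaryWalk F.1 (w F)) : Finite G.BoundedFace := by
  classical
  by_contra hinf
  rw [not_finite_iff_infinite] at hinf
  have hpos : ∀ F, 0 < (w F).length := fun F => List.length_pos_iff.2 (hw F).1
  -- By pigeonhole infinitely many walks begin with the same edge, and three are enough: two of the
  -- faces with the graph fill a neighbourhood of its midpoint, which is also in the closure of the
  -- third.
  obtain ⟨e, he⟩ := Finite.exists_infinite_fiber
    fun F : G.BoundedFace => ((w F).get ⟨0, hpos F⟩).1
  obtain ⟨t, hts, ht⟩ := (infinite_coe_iff.1 he).exists_subset_card_eq 3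
  obtain ⟨F₁, F₂, F₃, h12, h13, h23, rfl⟩ := Finset.card_eq_three.1 ht
  have h1 : ((w F₁).get ⟨0, hpos F₁⟩).1 = e := hts (by simp)
  have h2 : ((w F₂).get ⟨0, hpos F₂⟩).1 = e := hts (by simp)
  have h3 : ((w F₃).get ⟨0, hpos F₃⟩).1 = e := hts (by simp)
  have hd := union_mem_nhds_of_two_occurrences hw _ _ e h1 h2 fun h => absurd h h12
  have hc := mem_closure_of_occurrence (hw F₃) ⟨0, hpos F₃⟩
  rw [h3] at hc
  obtain ⟨y, hy, hyU⟩ := mem_closure_iff_nhds.1 hc _ hd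
  rcases hy with (hy | hy) | hy
  · exact h13 (Subtype.ext (F₁.2.1.eq_of_mem F₃.2.1 hy hyU))
  · exact h23 (Subtype.ext (F₂.2.1.eq_of_mem F₃.2.1 hy hyU))
  · exact F₃.2.1.notMem_support hyU hy

lemma traversals_eq_one_of_unique [DecidableEq E] {l : List (E × Bool)} {e : E}
    (h : ∃ j : Fin l.length, (l.get j).1 = e)
    (hu : ∀ j k : Fin l.length, (l.get j).1 = e → (l.get k).1 = e → (j : ℕ) = k) :
    traversals l e = 1 := by
  unfold traversals
  obtain ⟨j, hj⟩ := h
  have h1 : 0 < (l.map Prod.fst).count e :=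
    List.count_pos_iff.2 (List.mem_map.2 ⟨l.get j, List.get_mem _ _, hj⟩)
  have h2 : ¬ 2 ≤ (l.map Prod.fst).count e := by
    rw [← List.duplicate_iff_two_le_count, List.duplicate_iff_exists_distinct_get]
    rintro ⟨a, b, hab, ha, hb⟩
    have := hu ⟨a, by simpa using a.2⟩ ⟨b, by simpa using b.2⟩ (by simpa using ha.symm)
      (by simpa using hb.symm)
    simp only at this
    exact absurd (Fin.ext this) hab.ne
  omega

/-- An edge shared by a bounded face and the unbounded face occurs exactly once in the boundary
walks of the bounded faces. -/
lemma traversals_of_mem_frontier [Finite E] [DecidableEq E]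
    {w : G.BoundedFace → List (E × Bool)}
    (hw : ∀ F, G.IsBoundaryWalk F.1 (w F)) {U : Set ℂ} (hU : G.IsFace U)
    (hUb : ¬ Bornology.IsBounded U) {e : E} (he : G.edge e midParam ∈ closure U)
    {F : G.BoundedFace} (hF : G.edge e midParam ∈ frontier F.1) :
    traversals (w F) e = 1 ∧ ∀ F', F' ≠ F → e ∉ (w F').map Prod.fst := by
  obtain ⟨j, hj⟩ := exists_occurrence F.2.1 (hw F) hF
  refine ⟨traversals_eq_one_of_unique ⟨j, hj⟩ fun a b ha hb =>
    (occurrence_unique hw hU hUb he a b ha hb).2, fun F' hne hmem => ?_⟩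
  obtain ⟨d, hd, hde⟩ := List.mem_map.1 hmem
  obtain ⟨k, hk⟩ := List.get_of_mem hd
  exact hne (occurrence_unique hw hU hUb he k j (by rw [hk, hde]) hj).1

lemma traversals_of_sharedWithUnbounded [Finite E] [DecidableEq E]
    {w : G.BoundedFace → List (E × Bool)} (hw : ∀ F, G.IsBoundaryWalk F.1 (w F))
    {F : G.BoundedFace} {e : E} (h : G.SharedWithUnbounded F e) :
    traversals (w F) e = 1 ∧ ∀ F', F' ≠ F → e ∉ (w F').map Prod.fst := by
  obtain ⟨h1, U, hU, hUb, h2⟩ := h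
  exact traversals_of_mem_frontier hw hU hUb (frontier_subset_closure (h2 ⟨_, rfl⟩)) (h1 ⟨_, rfl⟩)

lemma area_pos [Finite E] (F : G.BoundedFace) : 0 < G.area F :=
  ENNReal.toReal_pos (F.2.1.isOpen.measure_pos volume F.2.1.nonempty).ne'
    F.2.2.measure_lt_top.ne

/-- The complement of a disk is connected. -/
lemma isPreconnected_compl_closedBall (R : ℝ) (hR : 0 < R) :
    IsPreconnected (closedBall (0 : ℂ) R)ᶜ := by
  have h : (closedBall (0 : ℂ) R)ᶜ =
      (fun p : ℂ × ℝ => p.2 • p.1) '' (sphere (0 : ℂ) 1 ×ˢ Ioi R) := by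
    ext z
    simp only [mem_compl_iff, mem_closedBall_zero_iff, not_le, mem_image, mem_prod, Prod.exists,
      mem_sphere_zero_iff_norm, mem_Ioi]
    constructor
    · intro h
      have h0 : ‖z‖ ≠ 0 := by linarith
      refine ⟨‖z‖⁻¹ • z, ‖z‖, ⟨?_, h⟩, ?_⟩
      · rw [norm_smul, norm_inv, norm_norm, inv_mul_cancel₀ h0]
      · rw [smul_smul, mul_inv_cancel₀ h0, one_smul]
    · rintro ⟨u, r, ⟨hu, hr⟩, rfl⟩
      rw [norm_smul, hu, mul_one, Real.norm_eq_abs, abs_of_pos (hR.trans hr)]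
      exact hr
  rw [h]
  refine IsPreconnected.image ?_ _ (by fun_prop)
  exact (isConnected_sphere (by simp) 0 zero_le_one).isPreconnected.prod isPreconnected_Ioi

lemma exists_support_subset_closedBall [Finite E] (G : PlaneGraph E) :
    ∃ R, 0 < R ∧ G.support ⊆ closedBall 0 R := by
  obtain ⟨R, hR⟩ := G.isCompact_support.isBounded.subset_closedBall 0
  exact ⟨max R 1, by positivity, hR.trans (closedBall_subset_closedBall (le_max_left _ _))⟩

/-- There is an unbounded face, and it contains the complement of a disk. -/
lemma exists_unbounded_face [Finite E] (G : PlaneGraph E) :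
    ∃ U, G.IsFace U ∧ ¬ Bornology.IsBounded U ∧ Bornology.IsBounded Uᶜ := by
  obtain ⟨R, hR, hs⟩ := G.exists_support_subset_closedBall
  have hz : ((R + 1 : ℝ) : ℂ) ∈ (closedBall (0 : ℂ) R)ᶜ := by
    rw [mem_compl_iff, mem_closedBall_zero_iff, Complex.norm_real, Real.norm_eq_abs,
      abs_of_pos (by linarith)]
    linarith
  have hsub : (closedBall (0 : ℂ) R)ᶜ ⊆ connectedComponentIn G.supportᶜ ((R + 1 : ℝ) : ℂ) :=
    (isPreconnected_compl_closedBall R hR).subset_connectedComponentIn hz (compl_subset_compl.2 hs)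
  refine ⟨_, ⟨_, compl_subset_compl.2 hs hz, rfl⟩, fun hb => ?_, ?_⟩
  · have h1 := hb.subset hsub
    have h2 : Bornology.IsBounded (univ : Set ℂ) := by
      rw [← union_compl_self (closedBall (0 : ℂ) R)]
      exact isBounded_closedBall.union h1
    exact NormedSpace.unbounded_univ ℝ ℂ h2
  · exact (isBounded_closedBall (x := (0 : ℂ)) (r := R)).subset (compl_subset_comm.1 hsub)

end PlanarYM.PlaneGraph

/-! ### Cyclic lists -/

/-- The periodic continuation of a list. -/
def List.cyc {α : Type*} (l : List α) (h : 0 < l.length) (k : ℕ) : α :=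
  l.get ⟨k % l.length, Nat.mod_lt _ h⟩

lemma List.cyc_eq_of_modEq {α : Type*} {l : List α} {h : 0 < l.length} {i j : ℕ}
    (hij : i ≡ j [MOD l.length]) : l.cyc h i = l.cyc h j := by
  unfold List.cyc
  congr 2

lemma List.cyc_of_lt {α : Type*} {l : List α} {h : 0 < l.length} {i : ℕ}
    (hi : i < l.length) : l.cyc h i = l.get ⟨i, hi⟩ := by
  unfold List.cyc
  congr 2
  exact Nat.mod_eq_of_lt hi

/-- A list that is chained, also from its last to its first element. -/
lemma List.cyc_chain {α : Type*} {R : α → α → Prop} {l : List α} (h : 0 < l.length)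
    (hc : l.IsChain R) (hl : ∀ d ∈ l.getLast?, ∀ d' ∈ l.head?, R d d') (k : ℕ) :
    R (l.cyc h k) (l.cyc h (k + 1)) := by
  have hk := Nat.mod_lt k h
  rcases Nat.lt_or_ge (k % l.length + 1) l.length with h1 | h1
  · have e1 : l.cyc h (k + 1) = l.get ⟨k % l.length + 1, h1⟩ := by
      rw [← List.cyc_of_lt (h := h) h1]
      exact List.cyc_eq_of_modEq ((Nat.mod_modEq k _).symm.add_right 1)
    rw [e1]
    exact List.isChain_iff_getElem.1 hc _ h1
  · have h2 : k % l.length = l.length - 1 := by omega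
    have hne : l ≠ [] := List.length_pos_iff.1 h
    have e1 : l.cyc h (k + 1) = l.head hne := by
      rw [List.head_eq_getElem]
      have : l.cyc h (k + 1) = l.cyc h 0 := by
        refine List.cyc_eq_of_modEq ?_
        have h3 := (Nat.mod_modEq k l.length).symm.add_right 1
        rw [h2, Nat.sub_add_cancel h] at h3
        exact h3.trans (by simp [Nat.ModEq])
      rw [this, List.cyc_of_lt h]
      rfl
    have e2 : l.cyc h k = l.getLast hne := by
      rw [List.getLast_eq_getElem]
      unfold List.cyc
      simp only [h2, List.get_eq_getElem]
    rw [e1, e2]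
    exact hl _ (List.getLast_mem_getLast? hne) _ (List.head_mem_head? hne)

/-! ### Cycles, and what remains when a piece of an edge is removed -/

namespace PlanarYM.PlaneGraph

open Set Metric

variable {E : Type*} {G : PlaneGraph E}

lemma continuous_path (d : E × Bool) : Continuous (G.path d) := by
  obtain ⟨e, b⟩ := d
  cases b
  · exact (G.continuous_edge e).comp unitInterval.continuous_symm
  · exact G.continuous_edge e

lemma path_injective (d : E × Bool) {s t : unitInterval} (h : G.path d s = G.path d t) :
    s = t ∨ (s = 0 ∧ t = 1) ∨ (s = 1 ∧ t = 0) := by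
  obtain ⟨e, b⟩ := d
  cases b
  · have := G.injective_edge e _ _ h
    simp only [unitInterval.symm_inj, unitInterval.symm_eq_zero, unitInterval.symm_eq_one] at this
    tauto
  · exact G.injective_edge e _ _ h

lemma path_meet {d d' : E × Bool} {s t : unitInterval} (hne : d.1 ≠ d'.1)
    (h : G.path d s = G.path d' t) : (s = 0 ∨ s = 1) ∧ (t = 0 ∨ t = 1) := by
  obtain ⟨e, b⟩ := d
  obtain ⟨e', b'⟩ := d'
  cases b <;> cases b' <;> have := G.meet_at_ends e e' _ _ hne h <;>
    (try simp only [unitInterval.symm_eq_zero, unitInterval.symm_eq_one] at this) <;> tauto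

/-- The parametrization of an oriented edge, on the whole real line. -/
noncomputable def pathR (G : PlaneGraph E) (d : E × Bool) (s : ℝ) : ℂ :=
  G.path d (projIcc 0 1 zero_le_one s)

lemma continuous_pathR (d : E × Bool) : Continuous (G.pathR d) :=
  (continuous_path d).comp continuous_projIcc

lemma pathR_of_mem (d : E × Bool) {s : ℝ} (hs : s ∈ Icc (0 : ℝ) 1) :
    G.pathR d s = G.path d ⟨s, hs⟩ := by
  rw [pathR, projIcc_of_mem _ hs]

/-- An edge may be a closed loop. Omitting an end of the parameter interval, or having distinct
endpoints, makes the piece an injective arc. -/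
lemma hasLogs_pathR (d : E × Bool) {a b : ℝ} (ha : 0 ≤ a) (hab : a ≤ b) (hb : b ≤ 1)
    (h : 0 < a ∨ b < 1 ∨ G.path d 0 ≠ G.path d 1) : HasLogs (G.pathR d '' Icc a b) := by
  refine hasLogs_image_Icc hab (continuous_pathR d).continuousOn ?_
  intro s hs t ht hst
  rw [pathR_of_mem d ⟨ha.trans hs.1, hs.2.trans hb⟩,
    pathR_of_mem d ⟨ha.trans ht.1, ht.2.trans hb⟩] at hst
  rcases path_injective d hst with h1 | ⟨h1, h2⟩ | ⟨h1, h2⟩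
  · exact congrArg Subtype.val h1
  · exfalso
    have e1 := congrArg Subtype.val h1
    have e2 := congrArg Subtype.val h2
    simp only [Set.Icc.coe_zero, Set.Icc.coe_one] at e1 e2
    rcases h with h | h | h
    · linarith [hs.1]
    · linarith [ht.2]
    · exact h (by rwa [h1, h2] at hst)
  · exfalso
    have e1 := congrArg Subtype.val h1
    have e2 := congrArg Subtype.val h2
    simp only [Set.Icc.coe_zero, Set.Icc.coe_one] at e1 e2
    rcases h with h | h | h
    · linarith [ht.1]
    · linarith [hs.2]
    · exact h (by rw [h1, h2] at hst; exact hst.symm)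

lemma pathR_image_unit (d : E × Bool) : G.pathR d '' Icc 0 1 = range (G.path d) := by
  ext z
  constructor
  · rintro ⟨s, hs, rfl⟩; exact ⟨_, rfl⟩
  · rintro ⟨s, rfl⟩
    exact ⟨s, s.2, pathR_of_mem d s.2⟩

/-- The periodic sequence `d` of oriented edges runs around a simple closed curve of `n` edges. -/
structure IsCycle (G : PlaneGraph E) (d : ℕ → E × Bool) (n : ℕ) : Prop where
  pos : 0 < n
  chain : ∀ k, G.path (d k) 1 = G.path (d (k + 1)) 0
  vertex : ∀ i j, G.path (d i) 0 = G.path (d j) 0 → i ≡ j [MOD n]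
  edge : ∀ i j, (d i).1 = (d j).1 → i ≡ j [MOD n]
  periodic : ∀ i j, i ≡ j [MOD n] → d i = d j
  surj : ∀ e, ∃ k, (d k).1 = e

lemma IsCycle.shift {d : ℕ → E × Bool} {n : ℕ} (h : G.IsCycle d n) (k : ℕ) :
    G.IsCycle (fun i => d (k + i)) n where
  pos := h.pos
  chain i := h.chain (k + i)
  vertex i j hij := Nat.ModEq.add_left_cancel' k (h.vertex _ _ hij)
  edge i j hij := Nat.ModEq.add_left_cancel' k (h.edge _ _ hij)
  periodic i j hij := h.periodic _ _ (hij.add_left k)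
  surj e := by
    obtain ⟨m, rfl⟩ := h.surj e
    -- Modulo n this index is m - k.
    refine ⟨m + (n - 1) * k, congrArg Prod.fst (h.periodic _ _ ?_)⟩
    obtain ⟨n, rfl⟩ := Nat.exists_eq_succ_of_ne_zero h.pos.ne'
    have : k + (m + (n + 1 - 1) * k) = m + (n + 1) * k := by
      simp only [Nat.add_sub_cancel]; ring
    simp only [Nat.succ_eq_add_one]
    rw [this]
    simp [Nat.ModEq]

/-- A simple closed curve without an open piece of an edge is a closed set with logarithms. -/
lemma IsCycle.hasLogs_arc {d : ℕ → E × Bool} {n : ℕ} (h : G.IsCycle d n) {a b : ℝ}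
    (ha : 0 ≤ a) (hab : a < b) (hb : b ≤ 1) (ha1 : a < 1) (hb0 : 0 < b) :
    ∃ S : Set ℂ, IsClosed S ∧ HasLogs S ∧ S ⊆ G.support ∧
      ∀ z ∈ G.support, z ∈ S ∨ ∃ s ∈ Ioo a b, z = G.pathR (d 0) s := by
  -- The set `A m` is the final piece of edge 0 together with the edges 1 to m. For m + 1 < n the
  -- next edge meets it only in the starting vertex of that edge, so logarithms extend one edge at a
  -- time; the initial piece of edge 0 is attached last.
  let A : ℕ → Set ℂ := fun m =>
    G.pathR (d 0) '' Icc b 1 ∪ {z | ∃ i, 1 ≤ i ∧ i ≤ m ∧ z ∈ range (G.path (d i))}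
  have hA0 : A 0 = G.pathR (d 0) '' Icc b 1 := by
    ext z
    simp only [A, mem_union, mem_ofPred_eq]
    constructor
    · rintro (h | ⟨i, h1, h2, -⟩)
      · exact h
      · omega
    · exact Or.inl
  have hAs : ∀ m, A (m + 1) = A m ∪ range (G.path (d (m + 1))) := by
    intro m
    ext z
    simp only [A, mem_union, mem_ofPred_eq]
    constructor
    · rintro (h | ⟨i, h1, h2, h3⟩)
      · exact Or.inl (Or.inl h)
      · rcases Nat.lt_or_ge m i with h4 | h4
        · obtain rfl : i = m + 1 := by omega
          exact Or.inr h3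
        · exact Or.inl (Or.inr ⟨i, h1, h4, h3⟩)
    · rintro ((h | ⟨i, h1, h2, h3⟩) | h)
      · exact Or.inl h
      · exact Or.inr ⟨i, h1, by omega, h3⟩
      · exact Or.inr ⟨m + 1, by omega, le_rfl, h⟩
  have hcl : ∀ m, IsClosed (A m) := by
    intro m
    induction m with
    | zero =>
      rw [hA0]
      exact (isCompact_Icc.image (continuous_pathR _)).isClosed
    | succ m ih =>
      rw [hAs]
      exact ih.union (isCompact_range (continuous_path _)).isClosed
  have hlt : ∀ i j, i < n → j < n → i ≡ j [MOD n] → i = j := fun i j hi hj hij =>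
    Nat.ModEq.eq_of_lt_of_lt hij hi hj
  have hA : ∀ m, m < n → HasLogs (A m) := by
    intro m
    induction m with
    | zero =>
      intro _
      rw [hA0]
      exact hasLogs_pathR _ hb0.le hb le_rfl (Or.inl hb0)
    | succ m ih =>
      intro hm
      rw [hAs]
      -- Here n is at least 2, so consecutive vertices differ and the edge is not a loop.
      have hne01 : G.path (d (m + 1)) 0 ≠ G.path (d (m + 1)) 1 := fun h0 => by
        rw [h.chain] at h0
        have h1 := h.vertex _ _ h0
        have h2 : 0 ≡ 1 [MOD n] := Nat.ModEq.add_left_cancel' (m + 1) h1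
        have := hlt 0 1 (by omega) (by omega) h2
        omega
      refine HasLogs.union (hcl m) (isCompact_range (continuous_path _)).isClosed (ih (by omega))
        ?_ (G.path (d (m + 1)) 0) ?_
      · rw [← pathR_image_unit]
        exact hasLogs_pathR _ le_rfl zero_le_one le_rfl (Or.inr (Or.inr hne01))
      · rintro z ⟨hzA, t, rfl⟩
        obtain ⟨i, hi, s, hs, hs0⟩ : ∃ i ≤ m, ∃ s : unitInterval,
            G.path (d i) s = G.path (d (m + 1)) t ∧ (i = 0 → b ≤ s) := by
          rcases hzA with ⟨s, hs, hsz⟩ | ⟨i, h1, h2, s, hsz⟩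
          · have hs' : s ∈ Icc (0 : ℝ) 1 := ⟨hb0.le.trans hs.1, hs.2⟩
            rw [pathR_of_mem _ hs'] at hsz
            exact ⟨0, Nat.zero_le _, ⟨s, hs'⟩, hsz, fun _ => hs.1⟩
          · exact ⟨i, h2, s, hsz, fun h0 => by omega⟩
        have hedge : (d i).1 ≠ (d (m + 1)).1 := fun h0 => by
          have := hlt _ _ (by omega) hm (h.edge _ _ h0)
          omega
        have hmeet := path_meet hedge hs
        rcases hmeet.2 with rfl | rfl
        · rfl
        · exfalso
          rw [h.chain] at hs
          rcases hmeet.1 with rfl | rfl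
          · have h1 := h.vertex _ _ hs
            -- Only the last edge ends at the starting vertex of edge 0, and the piece of edge 0 in
            -- `A m` omits that vertex because b > 0.
            rcases Nat.eq_zero_or_pos i with rfl | hi0
            · have := hs0 rfl
              simp only [Set.Icc.coe_zero] at this
              linarith
            · have h2 : i - 1 ≡ m + 1 [MOD n] := by
                have : i - 1 + 1 ≡ m + 1 + 1 [MOD n] := by rwa [Nat.sub_add_cancel hi0]
                exact Nat.ModEq.add_right_cancel' 1 this
              have := hlt _ _ (by omega) hm h2
              omega
          · rw [h.chain] at hs
            have h1 := Nat.ModEq.add_right_cancel' 1 (h.vertex _ _ hs)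
            have := hlt _ _ (by omega) hm h1
            omega
  have hn := h.pos
  have hB : HasLogs (G.pathR (d 0) '' Icc 0 a) :=
    hasLogs_pathR _ le_rfl ha ha1.le (Or.inr (Or.inl ha1))
  have hBc : IsClosed (G.pathR (d 0) '' Icc 0 a) :=
    (isCompact_Icc.image (continuous_pathR _)).isClosed
  refine ⟨A (n - 1) ∪ G.pathR (d 0) '' Icc 0 a, (hcl _).union hBc,
    (hA (n - 1) (by omega)).union (hcl _) hBc hB (G.path (d 0) 0) ?_, ?_, ?_⟩
  · rintro z ⟨hzA, t, ht, htz⟩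
    have ht' : t ∈ Icc (0 : ℝ) 1 := ⟨ht.1, ht.2.trans ha1.le⟩
    rw [pathR_of_mem _ ht'] at htz
    have ht1 : (⟨t, ht'⟩ : unitInterval) ≠ 1 := fun h1 => by
      have := congrArg Subtype.val h1
      simp only [Set.Icc.coe_one] at this
      linarith [ht.2]
    -- The parameter ranges [0, a] and [b, 1] are disjoint, so the two pieces of edge 0 can meet
    -- only if that edge is a loop, and then at its base point. Other edges meet edge 0 only at its
    -- endpoints, and t = 1 is excluded.
    have key : (⟨t, ht'⟩ : unitInterval) = 0 := by
      rcases hzA with ⟨s, hs, hsz⟩ | ⟨i, h1, h2, s, hsz⟩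
      · have hs' : s ∈ Icc (0 : ℝ) 1 := ⟨hb0.le.trans hs.1, hs.2⟩
        rw [pathR_of_mem _ hs', ← htz] at hsz
        rcases path_injective _ hsz with h3 | ⟨-, h3⟩ | ⟨-, h3⟩
        · have := congrArg Subtype.val h3
          simp only at this
          linarith [hs.1, ht.2]
        · exact absurd h3 ht1
        · exact h3
      · have hedge : (d 0).1 ≠ (d i).1 := fun h0 => by
          have := hlt _ _ (by omega) (by omega) (h.edge _ _ h0)
          omega
        rw [← htz] at hsz
        exact (path_meet hedge hsz.symm).1.resolve_right ht1
    rw [mem_singleton_iff, ← htz, key]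
  · rintro z ((⟨s, -, rfl⟩ | ⟨i, -, -, s, rfl⟩) | ⟨s, -, rfl⟩) <;> exact G.path_mem_support _ _
  · intro z hz
    obtain ⟨e, he⟩ := mem_iUnion.1 hz
    obtain ⟨k, rfl⟩ := h.surj e
    have hk : d k = d (k % n) := h.periodic _ _ (Nat.mod_modEq _ _).symm
    rw [hk, ← range_path] at he
    rcases Nat.eq_zero_or_pos (k % n) with h0 | h0
    · rw [h0] at he
      obtain ⟨s, rfl⟩ := he
      rw [← pathR_of_mem _ s.2]
      rcases le_or_gt (s : ℝ) a with h1 | h1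
      · exact Or.inl (Or.inr ⟨s, ⟨s.2.1, h1⟩, rfl⟩)
      · rcases le_or_gt b s with h2 | h2
        · exact Or.inl (Or.inl (Or.inl ⟨s, ⟨h2, s.2.2⟩, rfl⟩))
        · exact Or.inr ⟨s, ⟨h1, h2⟩, rfl⟩
    · have := Nat.mod_lt k hn
      exact Or.inl (Or.inl (Or.inr ⟨k % n, h0, by omega, he⟩))

/-- A bounded set that is not contained in a simple closed curve, but whose boundary is, has the
whole curve as its boundary. -/
lemma IsCycle.mid_mem_frontier [Finite E] {d : ℕ → E × Bool} {n : ℕ} (h : G.IsCycle d n)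
    {D : Set ℂ} (hDb : Bornology.IsBounded D) {q : ℂ} (hq : q ∈ D) (hqs : q ∉ G.support)
    (hfr : frontier D ⊆ G.support) (e : E) : G.edge e midParam ∈ frontier D := by
  -- Otherwise a whole piece of the edge around its midpoint misses the frontier. The frontier then
  -- lies in the rest of the curve, which has logarithms, contrary to `HasLogs.not_frontier_subset`.
  by_contra hmid
  obtain ⟨k, rfl⟩ := h.surj e
  have h' := h.shift k
  set d' : ℕ → E × Bool := fun i => d (k + i) with hd'
  have hmid' : G.pathR (d' 0) (1 / 2) ∈ (frontier D)ᶜ := by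
    have : G.pathR (d' 0) (1 / 2) = G.edge (d k).1 midParam := by
      rw [pathR_of_mem _ (by norm_num : (1 / 2 : ℝ) ∈ Icc (0 : ℝ) 1)]
      simp only [hd', add_zero, path]
      split_ifs
      · rfl
      · congr 1
        apply Subtype.ext
        rw [unitInterval.coe_symm_eq]
        norm_num [midParam]
    rw [this]
    exact hmid
  have hopen : IsOpen (G.pathR (d' 0) ⁻¹' (frontier D)ᶜ) :=
    isClosed_frontier.isOpen_compl.preimage (continuous_pathR _)
  obtain ⟨ε, hε, hball⟩ := Metric.isOpen_iff.1 hopen _ hmid'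
  -- The bound 1/4 keeps the removed parameter interval around 1/2 inside (0, 1).
  set δ := min ε (1 / 4) with hδ
  have hδ0 : 0 < δ := lt_min hε (by norm_num)
  have hδ1 : δ ≤ 1 / 4 := min_le_right _ _
  obtain ⟨S, hSc, hSl, hSs, hcov⟩ := h'.hasLogs_arc (a := 1 / 2 - δ) (b := 1 / 2 + δ)
    (by linarith) (by linarith) (by linarith) (by linarith) (by linarith)
  refine hSl.not_frontier_subset hSc hDb hq (fun h => hqs (hSs h)) fun z hz => ?_
  rcases hcov z (hfr hz) with h1 | ⟨s, hs, rfl⟩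
  · exact h1
  · refine absurd hz (hball ?_)
    rw [mem_ball, Real.dist_eq, abs_lt]
    have := min_le_left ε (1 / 4 : ℝ)
    constructor <;> linarith [hs.1, hs.2]

end PlanarYM.PlaneGraph

/-! ### The boundary walk and holonomy of a simple closed curve -/

namespace PlanarYM.PlaneGraph

open Set Metric

variable {E : Type*} {G : PlaneGraph E}

/-- The end of one arc and the start of the next are the same point of the circle, also from the
last arc to the first, where the exponents differ by a multiple of 2πi. -/
lemma IsBoundaryWalk.cyc_chain {F : Set ℂ} {w : List (E × Bool)} (hw : G.IsBoundaryWalk F w)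
    (h : 0 < w.length) (k : ℕ) : G.path (w.cyc h k) 1 = G.path (w.cyc h (k + 1)) 0 := by
  obtain ⟨-, φ, -, -, hφw⟩ := hw
  rw [List.cyc, List.cyc, ← hφw, ← hφw]
  congr 1
  rw [Complex.exp_eq_exp_iff_exists_int]
  have hn : (w.length : ℂ) ≠ 0 := by exact_mod_cast h.ne'
  have e1 : ((k % w.length : ℕ) : ℂ) = k - w.length * ((k / w.length : ℕ) : ℂ) := by
    rw [eq_sub_iff_add_eq]; exact_mod_cast Nat.mod_add_div k w.length
  have e2 : (((k + 1) % w.length : ℕ) : ℂ)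
      = (k + 1) - w.length * (((k + 1) / w.length : ℕ) : ℂ) := by
    rw [eq_sub_iff_add_eq]; exact_mod_cast Nat.mod_add_div (k + 1) w.length
  refine ⟨(((k + 1) / w.length : ℕ) : ℤ) - ((k / w.length : ℕ) : ℤ), ?_⟩
  simp only [e1, e2, Set.Icc.coe_one, Set.Icc.coe_zero, Int.cast_sub, Int.cast_natCast,
    Complex.ofReal_one, Complex.ofReal_zero]
  field_simp
  ring

lemma nodup_map_fst [DecidableEq E] {l : List (E × Bool)} (h : ∀ e, traversals l e = 1) :
    (l.map Prod.fst).Nodup :=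
  List.nodup_iff_count_le_one.2 fun e => (h e).le

lemma length_eq_card [Fintype E] [DecidableEq E] {l : List (E × Bool)}
    (h : ∀ e, traversals l e = 1) : l.length = Fintype.card E := by
  rw [← List.length_map (f := Prod.fst), ← List.toFinset_card_of_nodup (nodup_map_fst h),
    ← Finset.card_univ]
  congr 1
  ext e
  simp only [List.mem_toFinset, Finset.mem_univ, iff_true]
  exact List.count_pos_iff.1 (by have := h e; unfold traversals at this; omega)

lemma modEq_of_cyc_eq {α β : Type*} {l : List α} {f : α → β} (hl : (l.map f).Nodup)
    (h : 0 < l.length) {i j : ℕ} (hij : f (l.cyc h i) = f (l.cyc h j)) :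
    i ≡ j [MOD l.length] := by
  have h1 := Nat.mod_lt i h
  have h2 := Nat.mod_lt j h
  refine (hl.getElem_inj_iff (hi := by simpa using h1) (hj := by simpa using h2)).1 ?_
  simpa [List.cyc] using hij

lemma exists_cyc_fst_eq [DecidableEq E] {l : List (E × Bool)} (h : ∀ e, traversals l e = 1)
    (hl : 0 < l.length) (e : E) : ∃ k, (l.cyc hl k).1 = e := by
  have : e ∈ l.map Prod.fst :=
    List.count_pos_iff.1 (by have := h e; unfold traversals at this; omega)
  obtain ⟨d, hd, rfl⟩ := List.mem_map.1 this
  obtain ⟨i, hi⟩ := List.get_of_mem hd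
  exact ⟨i, by rw [List.cyc_of_lt i.2, ← hi]⟩

lemma IsSimpleClosedCurve.length_pos [DecidableEq E] {L : List (E × Bool)}
    (h : G.IsSimpleClosedCurve L) : 0 < L.length := List.length_pos_iff.2 h.1.1

lemma IsSimpleClosedCurve.isCycle [DecidableEq E] {L : List (E × Bool)}
    (h : G.IsSimpleClosedCurve L) : G.IsCycle (L.cyc h.length_pos) L.length where
  pos := h.length_pos
  chain := List.cyc_chain h.length_pos h.1.2.1 h.1.2.2
  vertex _ _ hij := modEq_of_cyc_eq (f := fun d => G.path d 0) h.2.1 h.length_pos hij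
  edge _ _ hij := modEq_of_cyc_eq (nodup_map_fst h.2.2) h.length_pos hij
  periodic _ _ hij := List.cyc_eq_of_modEq hij
  surj := exists_cyc_fst_eq h.2.2 h.length_pos

/-- The inverse of an oriented edge. -/
def flip (d : E × Bool) : E × Bool := (d.1, !d.2)

lemma path_flip (d : E × Bool) (s : unitInterval) :
    G.path (flip d) s = G.path d (unitInterval.symm s) := by
  obtain ⟨e, b⟩ := d
  cases b <;> simp [flip, path]

lemma eq_or_eq_flip {d d' : E × Bool} (h : d.1 = d'.1) : d = d' ∨ d = flip d' := by
  obtain ⟨e, b⟩ := d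
  obtain ⟨e', b'⟩ := d'
  obtain rfl : e = e' := h
  cases b <;> cases b' <;> simp [flip]

/-- The cycle run through in the opposite direction. -/
lemma IsCycle.reverse {d : ℕ → E × Bool} {n : ℕ} (h : G.IsCycle d n) :
    G.IsCycle (fun i => flip (d ((n - 1) * i))) n := by
  -- Multiplication by n - 1 is negation modulo n; being coprime to n, the factor can be cancelled.
  have hcop : Nat.gcd n (n - 1) = 1 := by
    obtain ⟨m, rfl⟩ := Nat.exists_eq_succ_of_ne_zero h.pos.ne'
    simp
  refine ⟨h.pos, fun k => ?_, fun i j hij => ?_, fun i j hij => ?_, fun i j hij => ?_,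
    fun e => ?_⟩
  · rw [path_flip, path_flip, unitInterval.symm_one, unitInterval.symm_zero, h.chain]
    congr 1
    refine h.periodic _ _ ?_
    have : (n - 1) * (k + 1) + 1 = (n - 1) * k + n := by
      have := h.pos
      rw [mul_add, add_assoc]; omega
    rw [this]
    simp [Nat.ModEq]
  · rw [path_flip, path_flip, unitInterval.symm_zero, h.chain, h.chain] at hij
    exact Nat.ModEq.cancel_left_of_coprime hcop
      (Nat.ModEq.add_right_cancel' 1 (h.vertex _ _ hij))
  · exact Nat.ModEq.cancel_left_of_coprime hcop (h.edge _ _ hij)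
  · exact congrArg flip (h.periodic _ _ (hij.mul_left _))
  · obtain ⟨k, hk⟩ := h.surj e
    -- The square of n - 1 is 1 modulo n.
    refine ⟨(n - 1) * k, ?_⟩
    rw [← hk]
    change (d ((n - 1) * ((n - 1) * k))).1 = (d k).1
    refine congrArg Prod.fst (h.periodic _ _ ?_)
    obtain ⟨m, rfl⟩ := Nat.exists_eq_succ_of_ne_zero h.pos.ne'
    have : (m + 1) * (m * k) + k = m * (m * k) + (m + 1) * k := by ring
    have h2 : m * (m * k) + (m + 1) * k ≡ k + (m + 1) * k [MOD m + 1] := by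
      rw [← this]
      simp [Nat.ModEq, add_comm]
    exact Nat.ModEq.add_right_cancel' _ h2

/-- A closed walk that traverses each edge of a cycle once follows the cycle. -/
lemma IsCycle.eq_of_chain {d c : ℕ → E × Bool} {n : ℕ} (h : G.IsCycle d n)
    (hc : ∀ k, G.path (c k) 1 = G.path (c (k + 1)) 0)
    (he : ∀ i j, (c i).1 = (c j).1 → i ≡ j [MOD n]) (hp : ∀ i j, i ≡ j [MOD n] → c i = c j)
    (h0 : c 0 = d 0) (i : ℕ) : c i = d i := by
  induction i with
  | zero => exact h0
  | succ i ih =>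
    obtain ⟨m, hm⟩ := h.surj (c (i + 1)).1
    have hci := hc i
    rw [ih, h.chain] at hci
    -- If the next edge runs along the cycle, its starting vertex determines it. If it runs
    -- backwards, it is the previous edge again; as each edge is used once per period, this happens
    -- only for n = 1, where periodicity settles it.
    rcases eq_or_eq_flip hm.symm with h1 | h1
    · rw [h1] at hci ⊢
      exact (h.periodic _ _ (h.vertex _ _ hci)).symm
    · rw [h1, path_flip, unitInterval.symm_zero, h.chain] at hci
      have hmi := Nat.ModEq.add_right_cancel' 1 (h.vertex _ _ hci)
      have h2 : (c i).1 = (c (i + 1)).1 := by rw [ih, ← hm, h.periodic _ _ hmi]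
      have h3 := he _ _ h2
      rw [← hp _ _ h3, ih]
      exact h.periodic _ _ h3

/-- The boundary walk of a face of a simple closed curve that traverses each edge once is a cyclic
rotation of the curve or of the reversed curve. -/
lemma IsSimpleClosedCurve.boundaryWalk_eq [Fintype E] [DecidableEq E] {L : List (E × Bool)}
    (h : G.IsSimpleClosedCurve L) {F : Set ℂ} {w : List (E × Bool)} (hw : G.IsBoundaryWalk F w)
    (hwe : ∀ e, traversals w e = 1) :
    ∃ k, w = L.rotate k ∨ w = ((L.rotate k).map flip).reverse := by
  have hpos : 0 < w.length := List.length_pos_iff.2 hw.1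
  have hlen : w.length = L.length := by rw [length_eq_card hwe, length_eq_card h.2.2]
  set d := L.cyc h.length_pos with hd
  obtain ⟨k, hk⟩ := h.isCycle.surj (w.cyc hpos 0).1
  have hed : ∀ i j, (w.cyc hpos i).1 = (w.cyc hpos j).1 → i ≡ j [MOD L.length] :=
    fun i j hij => hlen ▸ modEq_of_cyc_eq (nodup_map_fst hwe) hpos hij
  have hper : ∀ i j, i ≡ j [MOD L.length] → w.cyc hpos i = w.cyc hpos j :=
    fun i j hij => List.cyc_eq_of_modEq (hlen ▸ hij)
  rcases eq_or_eq_flip hk.symm with h1 | h1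
  · have key := (h.isCycle.shift k).eq_of_chain (hw.cyc_chain hpos) hed hper h1
    refine ⟨k, Or.inl (List.ext_getElem (by simp [hlen]) fun i hi hi' => ?_)⟩
    have := key i
    rw [List.cyc_of_lt hi] at this
    rw [List.getElem_rotate]
    simpa [List.cyc, add_comm] using this
  · have key := (h.isCycle.shift k).reverse.eq_of_chain (hw.cyc_chain hpos) hed hper
      (by simpa using h1)
    -- Rotation by k + 1 puts the edge of index k last, so after reversal its inverse comes first.
    refine ⟨k + 1, Or.inr (List.ext_getElem (by simp [hlen]) fun i hi hi' => ?_)⟩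
    have := key i
    rw [List.cyc_of_lt hi] at this
    rw [List.getElem_reverse, List.getElem_map, List.getElem_rotate]
    simp only [List.get_eq_getElem] at this
    rw [this]
    congr 1
    unfold List.cyc
    simp only [List.get_eq_getElem]
    congr 1
    simp only [List.length_map, List.length_rotate]
    rw [hlen] at hi
    have hmod : k + (L.length - 1) * i ≡ L.length - 1 - i + (k + 1) [MOD L.length] := by
      have e1 : L.length - 1 - i + (k + 1) + i = k + L.length := by omega
      have e2 : k + (L.length - 1) * i + i = k + L.length * i := by
        obtain ⟨m, hm⟩ := Nat.exists_eq_succ_of_ne_zero h.length_pos.ne'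
        rw [hm]
        simp only [Nat.succ_eq_add_one, Nat.add_sub_cancel]
        ring
      refine Nat.ModEq.add_right_cancel' i ?_
      rw [e1, e2]
      simp [Nat.ModEq]
    exact hmod

section Hol

variable {K : Type*} [Group K]

lemma hol_append (x : E → K) (l₁ l₂ : List (E × Bool)) :
    hol x (l₁ ++ l₂) = hol x l₂ * hol x l₁ := by
  simp [hol]

lemma hol_cons (x : E → K) (d : E × Bool) (l : List (E × Bool)) :
    hol x (d :: l) = hol x l * (if d.2 then x d.1 else (x d.1)⁻¹) := by
  simp [hol]

lemma hol_nil (x : E → K) : hol x [] = 1 := by simp [hol]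

lemma hol_singleton (x : E → K) (d : E × Bool) :
    hol x [d] = if d.2 then x d.1 else (x d.1)⁻¹ := by
  rw [hol_cons, hol_nil, one_mul]

lemma hol_flip_reverse (x : E → K) (l : List (E × Bool)) :
    hol x (l.map flip).reverse = (hol x l)⁻¹ := by
  induction l with
  | nil => simp [hol]
  | cons d l ih =>
    rw [List.map_cons, List.reverse_cons, hol_append, ih, hol_cons x d l, hol_singleton x (flip d),
      mul_inv_rev]
    obtain ⟨e, b⟩ := d
    cases b <;> simp [flip]

/-- Rotation exchanges the two factors of the holonomy; the conjugating element is the holonomy of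
the part that is moved to the end. -/
lemma isConj_hol_rotate (x : E → K) (l : List (E × Bool)) (k : ℕ) :
    IsConj (hol x l) (hol x (l.rotate k)) := by
  have h1 : l.rotate k = l.drop (k % l.length) ++ l.take (k % l.length) :=
    List.rotate_eq_drop_append_take_mod
  have h2 : hol x l = hol x (l.drop (k % l.length)) * hol x (l.take (k % l.length)) := by
    rw [← hol_append, List.take_append_drop]
  rw [h1, hol_append, h2, isConj_iff]
  exact ⟨hol x (l.take (k % l.length)), by group⟩

end Hol

/-- In a simple closed curve, every edge is on the boundary of a bounded face and of an unbounded
one. -/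
lemma IsSimpleClosedCurve.traversals_eq_one [Finite E] [DecidableEq E] {L : List (E × Bool)}
    (h : G.IsSimpleClosedCurve L) {w : G.BoundedFace → List (E × Bool)}
    (hw : ∀ F, G.IsBoundaryWalk F.1 (w F)) (F : G.BoundedFace) (e : E) :
    traversals (w F) e = 1 ∧ ∀ F', F' ≠ F → e ∉ (w F').map Prod.fst := by
  obtain ⟨U, hU, hUb, hUc⟩ := G.exists_unbounded_face
  obtain ⟨q, hq⟩ := F.2.1.nonempty
  have hqs := F.2.1.notMem_support hq
  have hF := h.isCycle.mid_mem_frontier F.2.2 hq hqs F.2.1.frontier_subset e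
  have hqU : q ∈ (closure U)ᶜ := fun hqU => by
    obtain ⟨y, hy, hyU⟩ := mem_closure_iff.1 hqU _ F.2.1.isOpen hq
    exact hUb (hU.eq_of_mem F.2.1 hyU hy ▸ F.2.2)
  -- The complement of the closure of U is bounded, contains q, and has its frontier inside that of
  -- U, so the argument used for F applies to it.
  have hUe := h.isCycle.mid_mem_frontier (D := (closure U)ᶜ)
    (hUc.subset (compl_subset_compl.2 subset_closure)) hqU hqs (by
      rw [frontier_compl]
      exact frontier_closure_subset.trans hU.frontier_subset) e
  rw [frontier_compl] at hUe
  exact traversals_of_mem_frontier hw hU hUb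
    (frontier_subset_closure (frontier_closure_subset hUe)) hF

/-- Every bounded face traverses every edge, yet an edge belongs to the walk of one bounded face
only. This replaces an appeal to the Jordan curve theorem. -/
lemma IsSimpleClosedCurve.eq_boundedFace [Finite E] [DecidableEq E] {L : List (E × Bool)}
    (h : G.IsSimpleClosedCurve L) {w : G.BoundedFace → List (E × Bool)}
    (hw : ∀ F, G.IsBoundaryWalk F.1 (w F)) (F F' : G.BoundedFace) : F' = F := by
  by_contra hne
  let e := (L.head h.1.1).1
  refine (h.traversals_eq_one hw F e).2 F' hne ?_
  have := (h.traversals_eq_one hw F' e).1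
  unfold traversals at this
  exact List.count_pos_iff.1 (by omega)

/-- The holonomy around the bounded face of a simple closed curve is conjugate to the holonomy
of the curve or to its inverse. -/
lemma IsSimpleClosedCurve.isConj_hol [Fintype E] [DecidableEq E] {L : List (E × Bool)}
    (h : G.IsSimpleClosedCurve L) {F : Set ℂ} {w : List (E × Bool)} (hw : G.IsBoundaryWalk F w)
    (hwe : ∀ e, traversals w e = 1) (K : Type*) [Group K] :
    (∀ x : E → K, IsConj (hol x L) (hol x w)) ∨ ∀ x : E → K, IsConj (hol x L) (hol x w)⁻¹ := by
  obtain ⟨k, rfl | rfl⟩ := h.boundaryWalk_eq hw hwe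
  · exact Or.inl fun x => isConj_hol_rotate x L k
  · refine Or.inr fun x => ?_
    rw [hol_flip_reverse, inv_inv]
    exact isConj_hol_rotate x L k

end PlanarYM.PlaneGraph

/-! ### Powers of a manifold -/

section PiManifold

variable {ι : Type*} [Fintype ι] {V K : Type*} [NormedAddCommGroup V] [NormedSpace ℝ V]
  [TopologicalSpace K] [ChartedSpace V K]

instance isManifold_pi [IsManifold 𝓘(ℝ, V) ∞ K] :
    IsManifold (ModelWithCorners.pi fun _ : ι => 𝓘(ℝ, V)) ∞ (ι → K) := by
  apply isManifold_of_contDiffOn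
  rintro _ _ ⟨e, he, rfl⟩ ⟨e', he', rfl⟩
  simp only [Set.mem_univ_pi] at he he'
  rw [contDiffOn_pi]
  intro i
  have h := (contDiffGroupoid ∞ 𝓘(ℝ, V)).compatible (he i) (he' i)
  rw [contDiffGroupoid, mem_groupoid_of_pregroupoid] at h
  have h1 : ContDiffOn ℝ ∞ ((e i).symm ≫ₕ e' i) ((e i).symm ≫ₕ e' i).source := by
    simpa only [contDiffPregroupoid, mfld_simps, Set.preimage_id, Set.inter_univ,
      Function.comp_id, Function.id_comp] using h.1
  refine h1.comp (g := ((e i).symm ≫ₕ e' i)) (f := fun y : ι → V => y i)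
    (contDiff_apply ℝ V i).contDiffOn ?_
  intro y hy
  exact ⟨hy.1.1 i trivial, hy.1.2 i trivial⟩

variable {E' H' M : Type*} [NormedAddCommGroup E'] [NormedSpace ℝ E'] [TopologicalSpace H']
  {I : ModelWithCorners ℝ E' H'} [TopologicalSpace M] [ChartedSpace H' M] {n : ℕ∞ω}

/-- A map into a power of a manifold is smooth when its components are. -/
lemma contMDiff_pi_iff {f : M → ι → K} :
    ContMDiff I (ModelWithCorners.pi fun _ : ι => 𝓘(ℝ, V)) n f ↔
      ∀ i, ContMDiff I 𝓘(ℝ, V) n fun x => f x i := by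
  have key : ∀ x, ContMDiffAt I (ModelWithCorners.pi fun _ : ι => 𝓘(ℝ, V)) n f x ↔
      ∀ i, ContMDiffAt I 𝓘(ℝ, V) n (fun y => f y i) x := by
    intro x
    rw [contMDiffAt_iff_target]
    simp_rw [contMDiffAt_iff_target (f := fun y => f y _)]
    rw [continuousAt_pi, forall_and]
    refine and_congr Iff.rfl ?_
    exact contMDiffAt_pi_space
  exact ⟨fun h i x => (key x).1 (h x) i, fun h x => (key x).2 fun i => h i x⟩

lemma contMDiff_eval (i : ι) :
    ContMDiff (ModelWithCorners.pi fun _ : ι => 𝓘(ℝ, V)) 𝓘(ℝ, V) n fun x : ι → K => x i :=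
  contMDiff_pi_iff.1 contMDiff_id i

end PiManifold

/-! ### Left-invariant derivatives and one-parameter groups -/

namespace PlanarYM

section LieGroups

variable {V K : Type*} [NormedAddCommGroup V] [NormedSpace ℝ V]
  [TopologicalSpace K] [ChartedSpace V K] [Group K] [LieGroup 𝓘(ℝ, V) ∞ K]
  {A : Type*} [NormedAddCommGroup A] [NormedSpace ℝ A]

instance : LieGroup 𝓘(ℝ, V) (minSmoothness ℝ 3) K :=
  LieGroup.of_le (n := ∞) (by
    rw [minSmoothness_of_isRCLikeNormedField]
    exact WithTop.coe_le_coe.2 le_top)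

/-- At the constant base point 1 the coordinate change is trivial, so smoothness of a derivative in
tangent coordinates is smoothness of the plain derivative. -/
lemma inTangentCoordinates_one {M : Type*} (g : M → A) (φ : M → V →L[ℝ] A) (p : M) :
    have : IsManifold 𝓘(ℝ, V) 1 K := IsManifold.of_le (n := ∞) (by simp)
    inTangentCoordinates 𝓘(ℝ, V) 𝓘(ℝ, A) (fun _ : M => (1 : K)) g φ p = φ := by
  intro this
  funext x
  rw [inTangentCoordinates_eq (I := 𝓘(ℝ, V)) (I' := 𝓘(ℝ, A)) (fun _ : M => (1 : K)) g φ
    (x₀ := p) (x := x) (mem_chart_source V (1 : K)) (Set.mem_univ _)]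
  ext v
  rw [tangentBundleCore_coordChange_model_space]
  simp only [ContinuousLinearMap.comp_apply]
  rw [(tangentBundleCore 𝓘(ℝ, V) K).coordChange_self _ _ (mem_achart_source V (1 : K))]
  rfl

/-- The derivative of a family of functions on a Lie group at the identity is smooth in the
parameter. -/
lemma contMDiffAt_mfderiv_one {E' H' M : Type*} [NormedAddCommGroup E'] [NormedSpace ℝ E']
    [TopologicalSpace H'] {I : ModelWithCorners ℝ E' H'} [TopologicalSpace M] [ChartedSpace H' M]
    [IsManifold I ∞ M] {f : M → K → A} {p : M}
    (hf : ContMDiffAt (I.prod 𝓘(ℝ, V)) 𝓘(ℝ, A) ∞ (Function.uncurry f) (p, 1))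
    (X : LieAlg V K) :
    ContMDiffAt I 𝓘(ℝ, A) ∞ (fun q => (mfderiv 𝓘(ℝ, V) 𝓘(ℝ, A) (f q) 1 X : A)) p := by
  have : IsManifold I 1 M := IsManifold.of_le (n := ∞) (by simp)
  have h := ContMDiffAt.mfderiv (m := ∞) f (fun _ => (1 : K)) hf contMDiffAt_const (by simp)
  let D : M → V →L[ℝ] A := fun x => mfderiv 𝓘(ℝ, V) 𝓘(ℝ, A) (f x) 1
  have h' : ContMDiffAt I 𝓘(ℝ, V →L[ℝ] A) ∞ D p :=
    (congrArg (fun F : M → V →L[ℝ] A => ContMDiffAt I 𝓘(ℝ, V →L[ℝ] A) ∞ F p)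
      (inTangentCoordinates_one (K := K) (fun x => f x 1) D p)).mp h
  let X' : V := X
  exact h'.clm_apply (contMDiffAt_const (c := X'))

-- Tangent spaces at equal points are not the same type syntactically; both derivatives are compared
-- as maps on V.
omit [Group K] [LieGroup 𝓘(ℝ, V) ∞ K] in
lemma mfderiv_apply_congr {V' M' : Type*} [NormedAddCommGroup V'] [NormedSpace ℝ V']
    [TopologicalSpace M'] [ChartedSpace V' M'] (f : K → M') {x y : K} (h : y = x) (v : V) :
    (mfderiv 𝓘(ℝ, V) 𝓘(ℝ, V') f y : V →L[ℝ] V') v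
      = (mfderiv 𝓘(ℝ, V) 𝓘(ℝ, V') f x : V →L[ℝ] V') v := by
  subst h
  rfl

lemma mdifferentiableAt_mul_left (a x : K) :
    MDifferentiableAt 𝓘(ℝ, V) 𝓘(ℝ, V) (fun b : K => a * b) x :=
  (contMDiff_mul_left (I := 𝓘(ℝ, V)) (n := ∞)).mdifferentiableAt (by simp)

/-- This is the chain rule for b ↦ a(xb) = (ax)b at the identity. -/
lemma mfderiv_mul_left_mulInvariantVectorField (X : LieAlg V K) (a x : K) :
    (mfderiv 𝓘(ℝ, V) 𝓘(ℝ, V) (fun b : K => a * b) x : V →L[ℝ] V)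
      (mulInvariantVectorField X x : V) = (mulInvariantVectorField X (a * x) : V) := by
  have h := mfderiv_comp (I'' := 𝓘(ℝ, V)) (1 : K) (mdifferentiableAt_mul_left a (x * 1))
    (mdifferentiableAt_mul_left x 1)
  have e : (fun b : K => a * b) ∘ (fun b : K => x * b) = fun b => a * x * b :=
    funext fun b => (mul_assoc a x b).symm
  let X' : V := X
  have h2 : (mfderiv 𝓘(ℝ, V) 𝓘(ℝ, V) ((fun b : K => a * b) ∘ fun b : K => x * b) 1 :
      V →L[ℝ] V) X' = (mfderiv 𝓘(ℝ, V) 𝓘(ℝ, V) (fun b : K => a * b) (x * 1) : V →L[ℝ] V)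
        ((mfderiv 𝓘(ℝ, V) 𝓘(ℝ, V) (fun b : K => x * b) 1 : V →L[ℝ] V) X') :=
    congrArg (fun L : V →L[ℝ] V => L X') h
  have h3 := congrArg (fun F : K → K => (mfderiv 𝓘(ℝ, V) 𝓘(ℝ, V) F 1 : V →L[ℝ] V) X') e
  exact (mfderiv_apply_congr _ (mul_one x) _).symm.trans (h2.symm.trans h3)

/-- At the identity the direction X no longer depends on x, so the smoothness of the derivative in x
can be read off from `contMDiffAt_mfderiv_one`. -/
lemma leftDeriv_eq (X : LieAlg V K) {f : K → A} {x : K}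
    (hf : MDifferentiableAt 𝓘(ℝ, V) 𝓘(ℝ, A) f x) :
    leftDeriv X f x = mfderiv 𝓘(ℝ, V) 𝓘(ℝ, A) (fun a => f (x * a)) 1 X := by
  have h2 : MDifferentiableAt 𝓘(ℝ, V) 𝓘(ℝ, A) f (x * 1) := by rwa [mul_one]
  have := mfderiv_comp (I'' := 𝓘(ℝ, A)) (1 : K) h2 (mdifferentiableAt_mul_left x 1)
  change _ = mfderiv 𝓘(ℝ, V) 𝓘(ℝ, A) (f ∘ fun a => x * a) 1 X
  rw [this]
  exact (mfderiv_apply_congr f (mul_one x) _).symm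

lemma ContMDiff.leftDeriv {f : K → A} (hf : ContMDiff 𝓘(ℝ, V) 𝓘(ℝ, A) ∞ f) (X : LieAlg V K) :
    ContMDiff 𝓘(ℝ, V) 𝓘(ℝ, A) ∞ (leftDeriv X f) := by
  have e : PlanarYM.leftDeriv X f = fun x => mfderiv 𝓘(ℝ, V) 𝓘(ℝ, A) (fun a => f (x * a)) 1 X :=
    funext fun x => leftDeriv_eq X (hf.mdifferentiableAt (by simp))
  rw [e]
  intro x
  refine contMDiffAt_mfderiv_one (f := fun x a => f (x * a)) ?_ X
  exact (hf.comp (contMDiff_mul 𝓘(ℝ, V) ∞)).contMDiffAt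

section Exp

variable [FiniteDimensional ℝ V] [T2Space K]

/-- Every element of the Lie algebra generates a one-parameter group. -/
theorem exists_oneParameterGroup (X : LieAlg V K) :
    ∃ γ : ℝ → K, IsMIntegralCurve (I := 𝓘(ℝ, V)) γ (fun x => mulInvariantVectorField X x) ∧
      γ 0 = 1 ∧ ∀ s t, γ (s + t) = γ s * γ t := by
  have hv : ContMDiff 𝓘(ℝ, V) 𝓘(ℝ, V).tangent 1
      (fun x : K => (⟨x, mulInvariantVectorField X x⟩ : TangentBundle 𝓘(ℝ, V) K)) :=
    (contMDiff_mulInvariantVectorField X).of_le (by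
      rw [minSmoothness_of_isRCLikeNormedField]; norm_num)
  have hM : IsManifold 𝓘(ℝ, V) 1 K := IsManifold.of_le (n := ∞) (by simp)
  have : CompleteSpace V := FiniteDimensional.complete ℝ V
  have htrans : ∀ (a : K) (γ : ℝ → K) (s : Set ℝ),
      IsMIntegralCurveOn (I := 𝓘(ℝ, V)) γ (fun x => mulInvariantVectorField X x) s →
      IsMIntegralCurveOn (I := 𝓘(ℝ, V)) (fun t => a * γ t)
        (fun x => mulInvariantVectorField X x) s := by
    intro a γ s h t ht
    have h1 := h t ht
    have h3 := (mdifferentiableAt_mul_left a (γ t)).hasMFDerivAt.comp_hasMFDerivWithinAt t h1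
    refine h3.congr_mfderiv ?_
    ext
    change (mfderiv 𝓘(ℝ, V) 𝓘(ℝ, V) (fun b : K => a * b) (γ t) : V →L[ℝ] V)
      ((1 : ℝ) • (mulInvariantVectorField X (γ t) : V))
        = (1 : ℝ) • (mulInvariantVectorField X (a * γ t) : V)
    rw [one_smul, one_smul, mfderiv_mul_left_mulInvariantVectorField]
  obtain ⟨γ₀, h0, hγ₀⟩ := exists_isMIntegralCurveAt_of_contMDiffAt_boundaryless (I := 𝓘(ℝ, V)) 0
    (hv.contMDiffAt (x := 1))
  obtain ⟨ε, hε, hon⟩ := isMIntegralCurveAt_iff'.1 hγ₀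
  rw [Real.ball_eq_Ioo, zero_sub, zero_add] at hon
  -- Left translates of the local solution at 1 give integral curves through all points on one
  -- common time interval, which makes solutions global.
  obtain ⟨γ, hγ0, hγ⟩ := exists_isMIntegralCurve_of_isMIntegralCurveOn (I := 𝓘(ℝ, V)) hv hε
    (fun x => ⟨fun t => x * γ₀ t, by simp only [h0, mul_one], htrans x _ _ hon⟩) 1
  refine ⟨γ, hγ, hγ0, fun s t => ?_⟩
  -- Both γ(s)γ(t) and γ(s + t) are integral curves in t with the same value at t = 0, so uniqueness
  -- gives the group law.
  have h1 : IsMIntegralCurve (I := 𝓘(ℝ, V)) (fun t => γ s * γ t)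
      (fun x => mulInvariantVectorField X x) := by
    rw [isMIntegralCurve_iff_isMIntegralCurveOn] at hγ ⊢
    exact htrans _ _ _ hγ
  have h2 := hγ.comp_add s
  have h3 := isMIntegralCurve_Ioo_eq_of_contMDiff_boundaryless (I := 𝓘(ℝ, V)) (t₀ := 0) hv h2 h1
    (by simp [hγ0])
  have := congrFun h3 t
  simpa [add_comm] using this

/-- The one-parameter group generated by an element of the Lie algebra. -/
noncomputable def oneParam (X : LieAlg V K) : ℝ → K := (exists_oneParameterGroup X).choose

lemma oneParam_zero (X : LieAlg V K) : oneParam X 0 = 1 :=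
  (exists_oneParameterGroup X).choose_spec.2.1

lemma oneParam_add (X : LieAlg V K) (s t : ℝ) :
    oneParam X (s + t) = oneParam X s * oneParam X t :=
  (exists_oneParameterGroup X).choose_spec.2.2 s t

lemma oneParam_neg (X : LieAlg V K) (t : ℝ) : oneParam X (-t) = (oneParam X t)⁻¹ := by
  rw [eq_inv_iff_mul_eq_one, ← oneParam_add, neg_add_cancel, oneParam_zero]

lemma hasMFDerivAt_oneParam (X : LieAlg V K) (t : ℝ) :
    HasMFDerivAt 𝓘(ℝ, ℝ) 𝓘(ℝ, V) (oneParam X) t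
      ((1 : ℝ →L[ℝ] ℝ).smulRight (mulInvariantVectorField X (oneParam X t) : V)) :=
  (exists_oneParameterGroup X).choose_spec.1 t

lemma continuous_oneParam (X : LieAlg V K) : Continuous (oneParam X) :=
  continuous_iff_continuousAt.2 fun t => (hasMFDerivAt_oneParam X t).continuousAt

/-- The derivative along a one-parameter group. -/
lemma hasDerivAt_comp_oneParam (X : LieAlg V K) {f : K → A} (x : K) (t : ℝ)
    (hf : MDifferentiableAt 𝓘(ℝ, V) 𝓘(ℝ, A) f (x * oneParam X t)) :
    HasDerivAt (fun s => f (x * oneParam X s)) (leftDeriv X f (x * oneParam X t)) t := by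
  have h1 := ((mdifferentiableAt_mul_left x (oneParam X t)).hasMFDerivAt).comp t
    (hasMFDerivAt_oneParam X t)
  let L : ℝ →L[ℝ] A := (mfderiv 𝓘(ℝ, V) 𝓘(ℝ, A) f (x * oneParam X t) : V →L[ℝ] A).comp
    ((mfderiv 𝓘(ℝ, V) 𝓘(ℝ, V) (fun b : K => x * b) (oneParam X t) : V →L[ℝ] V).comp
      ((1 : ℝ →L[ℝ] ℝ).smulRight (mulInvariantVectorField X (oneParam X t) : V)))
  have h2 : HasFDerivAt (fun s => f (x * oneParam X s)) L t :=
    (hf.hasMFDerivAt.comp t h1).hasFDerivAt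
  refine h2.hasDerivAt.congr_deriv (Eq.symm ?_)
  change (mfderiv 𝓘(ℝ, V) 𝓘(ℝ, A) f (x * oneParam X t) : V →L[ℝ] A)
      (mulInvariantVectorField X (x * oneParam X t) : V) =
    (mfderiv 𝓘(ℝ, V) 𝓘(ℝ, A) f (x * oneParam X t) : V →L[ℝ] A)
      ((mfderiv 𝓘(ℝ, V) 𝓘(ℝ, V) (fun b : K => x * b) (oneParam X t) : V →L[ℝ] V)
        ((1 : ℝ) • (mulInvariantVectorField X (oneParam X t) : V)))
  rw [one_smul, mfderiv_mul_left_mulInvariantVectorField]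

end Exp

end LieGroups

end PlanarYM

/-! ### Independence of the basis and bi-invariance of the Laplacian -/

namespace PlanarYM

section Laplacian

variable {V K : Type*} [NormedAddCommGroup V] [NormedSpace ℝ V]
  [TopologicalSpace K] [ChartedSpace V K] [Group K] [LieGroup 𝓘(ℝ, V) ∞ K]
  {A : Type*} [NormedAddCommGroup A] [NormedSpace ℝ A] [FiniteDimensional ℝ V] [T2Space K]

/-- An element of the Lie algebra, as a vector of the model space. -/
def vec (X : LieAlg V K) : V := X

omit [LieGroup 𝓘(ℝ, V) ∞ K] [FiniteDimensional ℝ V] [T2Space K] in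
lemma mulInvariantVectorField_one (X : LieAlg V K) :
    (mulInvariantVectorField X (1 : K) : V) = X := by
  have : (fun b : K => 1 * b) = id := funext fun b => one_mul b
  have h := congrArg (fun F : K → K => (mfderiv 𝓘(ℝ, V) 𝓘(ℝ, V) F 1 : V →L[ℝ] V)
    (vec (V := V) (K := K) X))
    this
  refine Eq.trans h ?_
  exact congrArg (fun L : V →L[ℝ] V => L (vec (V := V) (K := K) X))
    (mfderiv_id (I := 𝓘(ℝ, V)) (x := (1 : K)))

/-- A one-parameter group is determined by its velocity at the identity. -/
lemma eq_oneParam {η : ℝ → K} (hη : ∀ s t, η (s + t) = η s * η t) {Y : LieAlg V K}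
    (h : HasMFDerivAt 𝓘(ℝ, ℝ) 𝓘(ℝ, V) η 0 ((1 : ℝ →L[ℝ] ℝ).smulRight (vec (V := V) (K := K) Y))) :
    η = oneParam Y := by
  have h0 : η 0 = 1 := by
    have := hη 0 0
    rw [add_zero] at this
    exact (mul_eq_left.1 this.symm)
  have hM : IsManifold 𝓘(ℝ, V) 1 K := IsManifold.of_le (n := ∞) (by simp)
  have hv : ContMDiff 𝓘(ℝ, V) 𝓘(ℝ, V).tangent 1
      (fun x : K => (⟨x, mulInvariantVectorField Y x⟩ : TangentBundle 𝓘(ℝ, V) K)) :=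
    (contMDiff_mulInvariantVectorField Y).of_le (by
      rw [minSmoothness_of_isRCLikeNormedField]; norm_num)
  have : CompleteSpace V := FiniteDimensional.complete ℝ V
  refine isMIntegralCurve_Ioo_eq_of_contMDiff_boundaryless (I := 𝓘(ℝ, V)) (t₀ := 0) hv
    (fun t => ?_) (fun t => hasMFDerivAt_oneParam Y t) (by rw [h0, oneParam_zero])
  -- The derivative of η at t is thus the left translate of its derivative at 0, which makes η an
  -- integral curve.
  have e : η = fun s => η t * η (s - t) := funext fun s => by rw [← hη, add_sub_cancel]
  have h1 : HasMFDerivAt 𝓘(ℝ, ℝ) 𝓘(ℝ, ℝ) (fun s : ℝ => s - t) t (ContinuousLinearMap.id ℝ ℝ) :=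
    ((hasFDerivAt_id t).sub_const t).hasMFDerivAt
  have h' : HasMFDerivAt 𝓘(ℝ, ℝ) 𝓘(ℝ, V) η (t - t)
      ((1 : ℝ →L[ℝ] ℝ).smulRight (vec (V := V) (K := K) Y)) := by rwa [sub_self]
  have h2 := HasMFDerivAt.comp (f := fun s : ℝ => s - t) t h' h1
  have h3 := (mdifferentiableAt_mul_left (η t) (η (t - t))).hasMFDerivAt.comp t h2
  have h4 : HasMFDerivAt 𝓘(ℝ, ℝ) 𝓘(ℝ, V) η t
      ((mfderiv 𝓘(ℝ, V) 𝓘(ℝ, V) (fun b : K => η t * b) (η (t - t)) : V →L[ℝ] V).comp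
        (((1 : ℝ →L[ℝ] ℝ).smulRight (vec (V := V) (K := K) Y)).comp
          (ContinuousLinearMap.id ℝ ℝ))) :=
    h3.congr_of_eventuallyEq (Eventually.of_forall fun s => congrFun e s)
  refine h4.congr_mfderiv ?_
  ext
  change (mfderiv 𝓘(ℝ, V) 𝓘(ℝ, V) (fun b : K => η t * b) (η (t - t)) : V →L[ℝ] V)
    ((1 : ℝ) • (vec (V := V) (K := K) Y)) = (1 : ℝ) • (mulInvariantVectorField Y (η t) : V)
  rw [one_smul, one_smul]
  refine (mfderiv_apply_congr _ (show η (t - t) = 1 by rw [sub_self, h0]) _)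

lemma oneParam_neg_left (X : LieAlg V K) (t : ℝ) : oneParam (-X) t = oneParam X (-t) := by
  have h : HasMFDerivAt 𝓘(ℝ, ℝ) 𝓘(ℝ, ℝ) (fun s : ℝ => -s) 0 (-(ContinuousLinearMap.id ℝ ℝ)) :=
    (hasFDerivAt_id (0 : ℝ)).fun_neg.hasMFDerivAt
  have h' : HasMFDerivAt 𝓘(ℝ, ℝ) 𝓘(ℝ, V) (oneParam X) (-0)
      ((1 : ℝ →L[ℝ] ℝ).smulRight (vec (V := V) (K := K) X)) := by
    rw [neg_zero]
    have := hasMFDerivAt_oneParam X 0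
    refine this.congr_mfderiv ?_
    ext
    change (1 : ℝ) • (mulInvariantVectorField X (oneParam X 0) : V)
      = (1 : ℝ) • (vec (V := V) (K := K) X)
    rw [oneParam_zero, mulInvariantVectorField_one]
    rfl
  refine (congrFun (eq_oneParam (η := fun t => oneParam X (-t))
    (fun s t => by rw [neg_add, oneParam_add]) ?_) t).symm
  refine (h'.comp 0 h).congr_mfderiv ?_
  ext
  change (-1 : ℝ) • (vec (V := V) (K := K) X) = (1 : ℝ) • (-(vec (V := V) (K := K) X))
  rw [one_smul, neg_smul, one_smul]

lemma oneParam_adjointAction (c : K) (X : LieAlg V K) (t : ℝ) :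
    oneParam (adjointAction c X) t = c * oneParam X t * c⁻¹ := by
  have hc : MDifferentiableAt 𝓘(ℝ, V) 𝓘(ℝ, V) (fun x : K => c * x * c⁻¹) (oneParam X 0) :=
    (((contMDiff_const (c := c)).mul (contMDiff_id (I := 𝓘(ℝ, V)) (n := ∞))).mul
      (contMDiff_const (c := c⁻¹))).mdifferentiableAt (by simp)
  refine (congrFun (eq_oneParam (η := fun t => c * oneParam X t * c⁻¹)
    (fun s t => by rw [oneParam_add]; group) ?_) t).symm
  refine (hc.hasMFDerivAt.comp 0 (hasMFDerivAt_oneParam X 0)).congr_mfderiv ?_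
  ext
  change (mfderiv 𝓘(ℝ, V) 𝓘(ℝ, V) (fun x : K => c * x * c⁻¹) (oneParam X 0) : V →L[ℝ] V)
    ((1 : ℝ) • (mulInvariantVectorField X (oneParam X 0) : V))
      = (1 : ℝ) • (mfderiv 𝓘(ℝ, V) 𝓘(ℝ, V) (fun x : K => c * x * c⁻¹) 1 : V →L[ℝ] V)
        (vec (V := V) (K := K) X)
  rw [one_smul, one_smul, oneParam_zero, mulInvariantVectorField_one]
  rfl

section Smooth

variable {f : K → A} (hf : ContMDiff 𝓘(ℝ, V) 𝓘(ℝ, A) ∞ f)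
include hf

lemma hasDerivAt_oneParam (X : LieAlg V K) (x : K) (t : ℝ) :
    HasDerivAt (fun s => f (x * oneParam X s)) (leftDeriv X f (x * oneParam X t)) t :=
  hasDerivAt_comp_oneParam X x t (hf.mdifferentiableAt (by simp))

lemma hasDerivAt_oneParam_zero (X : LieAlg V K) (x : K) :
    HasDerivAt (fun s => f (x * oneParam X s)) (leftDeriv X f x) 0 := by
  have := hasDerivAt_oneParam hf X x 0
  rwa [oneParam_zero, mul_one] at this

/-- Two functions that agree along one-parameter groups have the same second derivatives. -/
lemma leftDeriv_leftDeriv_congr {f' : K → A} (hf' : ContMDiff 𝓘(ℝ, V) 𝓘(ℝ, A) ∞ f')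
    {X Y : LieAlg V K} {x y : K} (h : ∀ s, f (x * oneParam X s) = f' (y * oneParam Y s)) :
    leftDeriv X (leftDeriv X f) x = leftDeriv Y (leftDeriv Y f') y := by
  have h1 : ∀ s, leftDeriv X f (x * oneParam X s) = leftDeriv Y f' (y * oneParam Y s) := fun s =>
    ((hasDerivAt_oneParam hf X x s).congr_of_eventuallyEq
      (Eventually.of_forall fun s => (h s).symm)).unique (hasDerivAt_oneParam hf' Y y s)
  exact ((hasDerivAt_oneParam_zero (ContMDiff.leftDeriv hf X) X x).congr_of_eventuallyEq
    (Eventually.of_forall fun s => (h1 s).symm)).unique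
      (hasDerivAt_oneParam_zero (ContMDiff.leftDeriv hf' Y) Y y)

end Smooth

omit [FiniteDimensional ℝ V] [T2Space K] in
lemma leftDeriv_sum_smul {κ : Type*} (s : Finset κ) (c : κ → ℝ) (X : κ → LieAlg V K) {f : K → A}
    (hf : ContMDiff 𝓘(ℝ, V) 𝓘(ℝ, A) ∞ f) (x : K) :
    leftDeriv (∑ i ∈ s, c i • X i) f x = ∑ i ∈ s, c i • leftDeriv (X i) f x := by
  have h : ∀ Y : LieAlg V K, leftDeriv Y f x
      = (mfderiv 𝓘(ℝ, V) 𝓘(ℝ, A) (fun a => f (x * a)) 1 : V →L[ℝ] A) (vec (V := V) (K := K) Y) :=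
    fun Y => leftDeriv_eq Y (hf.mdifferentiableAt (by simp))
  simp_rw [h]
  exact (map_sum (mfderiv 𝓘(ℝ, V) 𝓘(ℝ, A) (fun a => f (x * a)) 1 : V →L[ℝ] A)
    (fun i => c i • vec (V := V) (K := K) (X i)) s).trans (Finset.sum_congr rfl fun i _ =>
      map_smul (mfderiv 𝓘(ℝ, V) 𝓘(ℝ, A) (fun a => f (x * a)) 1 : V →L[ℝ] A) (c i)
        (vec (V := V) (K := K) (X i)))

lemma leftDeriv_fun_sum_smul {κ : Type*} (s : Finset κ) (c : κ → ℝ) (X : LieAlg V K)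
    {f : κ → K → A} (hf : ∀ i, ContMDiff 𝓘(ℝ, V) 𝓘(ℝ, A) ∞ (f i)) (x : K) :
    leftDeriv X (fun y => ∑ i ∈ s, c i • f i y) x = ∑ i ∈ s, c i • leftDeriv X (f i) x := by
  have h1 : ContMDiff 𝓘(ℝ, V) 𝓘(ℝ, A) ∞ (fun y => ∑ i ∈ s, c i • f i y) :=
    contMDiff_finsetSum fun i _ => (contDiff_const_smul (c i)).comp_contMDiff (hf i)
  refine (hasDerivAt_oneParam_zero h1 X x).unique ?_
  exact HasDerivAt.fun_sum fun i _ => (hasDerivAt_oneParam_zero (hf i) X x).const_smul (c i)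

/-- The Laplacian can be computed in any orthonormal basis. -/
lemma laplacian_eq_of_orthonormal (g : BiinvariantMetric V K) {f : K → A}
    (hf : ContMDiff 𝓘(ℝ, V) 𝓘(ℝ, A) ∞ f)
    (Y : Fin (Module.finrank ℝ (LieAlg V K)) → LieAlg V K)
    (hY : ∀ i j, g.inner (Y i) (Y j) = if i = j then 1 else 0) (x : K) :
    laplacian g f x = ∑ i, leftDeriv (Y i) (leftDeriv (Y i) f) x := by
  set b := g.orthonormalBasis with hb
  have hbb := g.orthonormalBasis_spec
  rw [← hb] at hbb
  let c : Matrix (Fin (Module.finrank ℝ (LieAlg V K))) (Fin (Module.finrank ℝ (LieAlg V K))) ℝ :=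
    fun i j => b.repr (Y i) j
  have hYc : ∀ i, Y i = ∑ j, c i j • b j := fun i => (b.sum_repr (Y i)).symm
  -- The matrix between orthonormal bases is orthogonal; the transposed identity collapses the
  -- double sum to its diagonal.
  have hcc : c * c.transpose = 1 := by
    ext i k
    rw [Matrix.mul_apply, Matrix.one_apply, ← hY i k, hYc i, hYc k]
    simp only [map_sum, map_smul, LinearMap.sum_apply, LinearMap.smul_apply, hbb, smul_eq_mul,
      Matrix.transpose_apply]
    simp [mul_comm]
  have hcc' : c.transpose * c = 1 := mul_eq_one_comm.1 hcc
  have hB : ∀ i, leftDeriv (Y i) (leftDeriv (Y i) f) x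
      = ∑ j, ∑ k, (c i j * c i k) • leftDeriv (b j) (leftDeriv (b k) f) x := by
    intro i
    have e1 : leftDeriv (Y i) f = fun y => ∑ k, c i k • leftDeriv (b k) f y := by
      funext y
      rw [hYc i, leftDeriv_sum_smul _ _ _ hf]
    rw [e1, leftDeriv_fun_sum_smul _ _ _ fun k => ContMDiff.leftDeriv hf (b k)]
    have e2 : ∀ k, leftDeriv (Y i) (leftDeriv (b k) f) x
        = ∑ j, c i j • leftDeriv (b j) (leftDeriv (b k) f) x := fun k => by
      rw [hYc i, leftDeriv_sum_smul _ _ _ (ContMDiff.leftDeriv hf (b k))]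
    simp_rw [e2, Finset.smul_sum, smul_smul]
    rw [Finset.sum_comm]
    exact Finset.sum_congr rfl fun j _ => Finset.sum_congr rfl fun k _ => by rw [mul_comm]
  simp_rw [hB]
  rw [Finset.sum_comm, laplacian]
  refine Finset.sum_congr rfl fun j _ => ?_
  rw [Finset.sum_comm]
  have e3 : ∀ k, ∑ i, (c i j * c i k) • leftDeriv (b j) (leftDeriv (b k) f) x
      = if j = k then leftDeriv (b j) (leftDeriv (b k) f) x else 0 := fun k => by
    rw [← Finset.sum_smul]
    have := congrFun (congrFun hcc' j) k
    rw [Matrix.mul_apply, Matrix.one_apply] at this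
    simp only [Matrix.transpose_apply] at this
    rw [this]
    split_ifs <;> simp
  rw [Finset.sum_congr rfl fun k _ => e3 k]
  simp [hb]

/-- The Laplacian of a function that agrees with another one along conjugated one-parameter
groups. -/
lemma laplacian_congr_adjoint (g : BiinvariantMetric V K) {f f' : K → A}
    (hf : ContMDiff 𝓘(ℝ, V) 𝓘(ℝ, A) ∞ f) (hf' : ContMDiff 𝓘(ℝ, V) 𝓘(ℝ, A) ∞ f') {x y : K} (c : K)
    {ε : ℝ} (hε : ε * ε = 1)
    (h : ∀ X : LieAlg V K, ∀ s,
      f (x * oneParam X s) = f' (y * oneParam (ε • adjointAction c X) s)) :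
    laplacian g f x = laplacian g f' y := by
  -- The image of the orthonormal basis under ε Ad(c) is again orthonormal, and in it the second
  -- derivatives agree term by term.
  rw [laplacian_eq_of_orthonormal g hf' (fun i => ε • adjointAction c (g.orthonormalBasis i)),
    laplacian]
  · exact Finset.sum_congr rfl fun i _ => leftDeriv_leftDeriv_congr hf hf' (h _)
  · intro i j
    simp only [map_smul, LinearMap.smul_apply, g.ad_invariant, g.orthonormalBasis_spec, smul_eq_mul]
    rw [← mul_assoc, hε, one_mul]

/-- The Laplacian commutes with left and right translations. -/
lemma laplacian_mul_mul (g : BiinvariantMetric V K) {f : K → A}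
    (hf : ContMDiff 𝓘(ℝ, V) 𝓘(ℝ, A) ∞ f) (u v x : K) :
    laplacian g (fun a => f (u * a * v)) x = laplacian g f (u * x * v) := by
  have h : ContMDiff 𝓘(ℝ, V) 𝓘(ℝ, A) ∞ fun a => f (u * a * v) :=
    hf.comp ((contMDiff_const.mul contMDiff_id).mul contMDiff_const)
  -- Here u x exp(sX) v = (u x v)(v⁻¹ exp(sX) v).
  refine laplacian_congr_adjoint g h hf v⁻¹ (ε := 1) (by norm_num) fun X s => ?_
  rw [one_smul, oneParam_adjointAction]
  congr 1
  group

/-- The Laplacian commutes with inversion and translations. -/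
lemma laplacian_mul_inv_mul (g : BiinvariantMetric V K) {f : K → A}
    (hf : ContMDiff 𝓘(ℝ, V) 𝓘(ℝ, A) ∞ f) (u v x : K) :
    laplacian g (fun a => f (u * a⁻¹ * v)) x = laplacian g f (u * x⁻¹ * v) := by
  have h : ContMDiff 𝓘(ℝ, V) 𝓘(ℝ, A) ∞ fun a => f (u * a⁻¹ * v) :=
    hf.comp ((contMDiff_const.mul (contMDiff_inv 𝓘(ℝ, V) ∞)).mul contMDiff_const)
  -- With c = v⁻¹ x, one has u (x exp(sX))⁻¹ v = (u x⁻¹ v)(c exp(-sX) c⁻¹).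
  refine laplacian_congr_adjoint g h hf (v⁻¹ * x) (ε := -1) (by norm_num) fun X s => ?_
  rw [neg_one_smul, oneParam_neg_left, oneParam_adjointAction, oneParam_neg]
  congr 1
  group

end Laplacian

end PlanarYM

/-! ### Differentiation under the integral and integration by parts -/

/-- Differentiation under the integral sign over a compact space. -/
lemma hasDerivAt_integral_of_continuousOn {Y : Type*} [TopologicalSpace Y] [CompactSpace Y]
    [SecondCountableTopology Y] [MeasurableSpace Y] [OpensMeasurableSpace Y] {μ : Measure Y}
    [IsFiniteMeasure μ] {A : Type*} [NormedAddCommGroup A] [NormedSpace ℝ A]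
    {Q Q' : ℝ → Y → A} {U : Set ℝ} {s₀ : ℝ} (hU : U ∈ 𝓝 s₀)
    (hQ : ∀ s ∈ U, Continuous (Q s))
    (hd : ∀ s ∈ U, ∀ y, HasDerivAt (fun r => Q r y) (Q' s y) s)
    (hQ' : ContinuousOn (fun p : ℝ × Y => Q' p.1 p.2) (U ×ˢ Set.univ)) :
    HasDerivAt (fun s => ∫ y, Q s y ∂μ) (∫ y, Q' s₀ y ∂μ) s₀ := by
  obtain ⟨ε, hε, hball⟩ := Metric.nhds_basis_closedBall.mem_iff.1 hU
  have hs₀ : s₀ ∈ U := mem_of_mem_nhds hU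
  obtain ⟨C, hC⟩ := ((isCompact_closedBall s₀ ε).prod
    (isCompact_univ (X := Y))).exists_bound_of_continuousOn
    (hQ'.mono (Set.prod_mono_left hball))
  have hc0 : Continuous (Q' s₀) := by
    rw [← continuousOn_univ]
    exact hQ'.comp (f := fun y : Y => (s₀, y)) (by fun_prop) fun y _ => ⟨hs₀, trivial⟩
  have hint : Integrable (Q s₀) μ :=
    (hQ s₀ hs₀).integrable_of_hasCompactSupport (HasCompactSupport.of_compactSpace _)
  refine (hasDerivAt_integral_of_dominated_loc_of_deriv_le (bound := fun _ => C)
    (Metric.closedBall_mem_nhds s₀ hε) ?_ hint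
    hc0.aestronglyMeasurable ?_ (integrable_const C) ?_).2
  · filter_upwards [hU] with s hs
    exact (hQ s hs).aestronglyMeasurable
  · exact Eventually.of_forall fun y s hs => hC (s, y) ⟨hs, trivial⟩
  · exact Eventually.of_forall fun y s hs => hd s (hball hs) y

namespace PlanarYM

section Haar

variable {K : Type*} [TopologicalSpace K] [Group K] [IsTopologicalGroup K] [CompactSpace K]
    [MeasurableSpace K] [BorelSpace K]

instance : IsProbabilityMeasure (haarProb K) := ⟨Measure.haarMeasure_self (K₀ := ⊤)⟩

instance : (haarProb K).IsHaarMeasure := Measure.isHaarMeasure_haarMeasure _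

/-- A right translate of Haar measure is again a left Haar probability measure, and that is unique.
-/
instance : (haarProb K).IsMulRightInvariant where
  map_mul_right_eq_self g := by
    have := Measure.isProbabilityMeasure_map (μ := haarProb K)
      (measurable_mul_const g).aemeasurable
    exact Measure.isHaarMeasure_eq_of_isProbabilityMeasure _ _

instance : (haarProb K).IsInvInvariant where
  inv_eq_self := by
    have h := Measure.isMulInvariant_eq_smul_of_compactSpace (haarProb K).inv (haarProb K)
    have h1 := congrArg (fun ν : Measure K => ν Set.univ) h
    simp only [Measure.inv_apply, Set.inv_univ, measure_univ, Measure.smul_apply] at h1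
    rw [h]
    have : Measure.haarScalarFactor (haarProb K).inv (haarProb K) = 1 := by
      have h2 : (1 : ENNReal) = Measure.haarScalarFactor (haarProb K).inv (haarProb K) := by
        simpa [ENNReal.smul_def] using h1
      exact_mod_cast h2.symm
    rw [this, one_smul]

end Haar

section EdgeDerivative

variable {V K : Type*} [NormedAddCommGroup V] [NormedSpace ℝ V]
  [TopologicalSpace K] [ChartedSpace V K] [Group K]
  {A : Type*} [NormedAddCommGroup A] [NormedSpace ℝ A]
  {E : Type*} [Fintype E] [DecidableEq E]

/-- The derivative in the edge variable `e` along a left-invariant vector field. -/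
noncomputable def edgeDeriv (X : LieAlg V K) (e : E) (f : (E → K) → A) (x : E → K) : A :=
  leftDeriv X (fun a => f (Function.update x e a)) (x e)

omit [Fintype E] in
lemma edgeLaplacian_eq_sum [FiniteDimensional ℝ V] (g : BiinvariantMetric V K) (e : E)
    (f : (E → K) → A) (x : E → K) :
    edgeLaplacian g e f x
      = ∑ i, edgeDeriv (g.orthonormalBasis i) e (edgeDeriv (g.orthonormalBasis i) e f) x := by
  have h : ∀ X : LieAlg V K, leftDeriv X (fun a => f (Function.update x e a))
      = fun a => edgeDeriv X e f (Function.update x e a) := fun X => by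
    funext a
    simp [edgeDeriv]
  simp only [edgeLaplacian, laplacian, h]
  rfl

variable [LieGroup 𝓘(ℝ, V) ∞ K]

omit [Group K] [LieGroup 𝓘(ℝ, V) ∞ K] in
lemma contMDiff_update (x : E → K) (e : E) :
    ContMDiff 𝓘(ℝ, V) (ModelWithCorners.pi fun _ : E => 𝓘(ℝ, V)) ∞
      (fun a : K => Function.update x e a) := by
  rw [contMDiff_pi_iff]
  intro i
  by_cases h : i = e
  · subst h
    simp only [Function.update_self]
    exact contMDiff_id
  · simpa [Function.update_of_ne h] using contMDiff_const

variable {f : (E → K) → A}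
  (hf : ContMDiff (ModelWithCorners.pi fun _ : E => 𝓘(ℝ, V)) 𝓘(ℝ, A) ∞ f)
include hf

lemma ContMDiff.edgeDeriv (X : LieAlg V K) (e : E) :
    ContMDiff (ModelWithCorners.pi fun _ : E => 𝓘(ℝ, V)) 𝓘(ℝ, A) ∞ (edgeDeriv X e f) := by
  have h1 : PlanarYM.edgeDeriv X e f
      = fun x => mfderiv 𝓘(ℝ, V) 𝓘(ℝ, A) (fun a => f (Function.update x e (x e * a))) 1 X :=
    funext fun x => leftDeriv_eq X ((hf.comp (contMDiff_update x e)).mdifferentiableAt (by simp))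
  rw [h1]
  have hM : IsManifold 𝓘(ℝ, V) ∞ K := inferInstance
  intro x
  refine contMDiffAt_mfderiv_one (f := fun x a => f (Function.update x e (x e * a))) ?_ X
  refine ContMDiff.contMDiffAt (hf.comp (f := fun p : (E → K) × K =>
    Function.update p.1 e (p.1 e * p.2)) ?_)
  rw [contMDiff_pi_iff]
  intro i
  by_cases h : i = e
  · subst h
    simp only [Function.update_self]
    exact ((contMDiff_eval i).comp contMDiff_fst).mul contMDiff_snd
  · simp only [Function.update_of_ne h]
    exact (contMDiff_eval i).comp contMDiff_fst

variable [FiniteDimensional ℝ V] [T2Space K]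

/-- The edge derivative becomes one along right translations of the group E → K, which preserve the
product Haar measure. -/
lemma hasDerivAt_edge (X : LieAlg V K) (e : E) (x : E → K) (s : ℝ) :
    HasDerivAt (fun s => f (x * Pi.mulSingle e (oneParam X s)))
      (edgeDeriv X e f (x * Pi.mulSingle e (oneParam X s))) s := by
  have h : ∀ s, x * Pi.mulSingle e (oneParam X s) = Function.update x e (x e * oneParam X s) := by
    intro s
    funext i
    by_cases h : i = e
    · subst h; simp
    · simp [h]
  simp_rw [h, edgeDeriv, Function.update_idem, Function.update_self]
  exact hasDerivAt_oneParam (f := fun a => f (Function.update x e a))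
    (hf.comp (contMDiff_update x e)) X (x e) s

lemma hasDerivAt_edge_zero (X : LieAlg V K) (e : E) (x : E → K) :
    HasDerivAt (fun s => f (x * Pi.mulSingle e (oneParam X s))) (edgeDeriv X e f x) 0 := by
  simpa [oneParam_zero] using hasDerivAt_edge hf X e x 0

lemma edgeDeriv_smul {c : (E → K) → ℝ}
    (hc : ContMDiff (ModelWithCorners.pi fun _ : E => 𝓘(ℝ, V)) 𝓘(ℝ, ℝ) ∞ c)
    (X : LieAlg V K) (e : E) (x : E → K) :
    edgeDeriv X e (fun x => c x • f x) x = c x • edgeDeriv X e f x + edgeDeriv X e c x • f x := by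
  have := (hasDerivAt_edge_zero hc X e x).fun_smul (hasDerivAt_edge_zero hf X e x)
  simp only [oneParam_zero, Pi.mulSingle_one, mul_one] at this
  exact (hasDerivAt_edge_zero (hc.smul hf) X e x).unique this

variable [IsTopologicalGroup K] [CompactSpace K] [SecondCountableTopology K] [MeasurableSpace K]
  [BorelSpace K]

/-- The integral of a right translate of f is constant in the translation parameter, and its
derivative may be taken under the integral. -/
lemma integral_edgeDeriv (X : LieAlg V K) (e : E) :
    ∫ x, edgeDeriv X e f x ∂(Measure.pi fun _ : E => haarProb K) = 0 := by
  have hD := ContMDiff.edgeDeriv hf X e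
  have hs : Continuous fun p : ℝ × (E → K) => p.2 * Pi.mulSingle e (oneParam X p.1) :=
    continuous_snd.mul ((continuous_mulSingle e).comp ((continuous_oneParam X).comp continuous_fst))
  have h1 := hasDerivAt_integral_of_continuousOn (μ := Measure.pi fun _ : E => haarProb K)
    (Q := fun s x => f (x * Pi.mulSingle e (oneParam X s)))
    (Q' := fun s x => edgeDeriv X e f (x * Pi.mulSingle e (oneParam X s)))
    (U := Set.univ) (s₀ := 0) univ_mem
    (fun s _ => hf.continuous.comp (continuous_mul_const _))
    (fun s _ x => hasDerivAt_edge hf X e x s)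
    (hD.continuous.comp hs).continuousOn
  simp only [oneParam_zero, Pi.mulSingle_one, mul_one] at h1
  have h2 : (fun s => ∫ x, f (x * Pi.mulSingle e (oneParam X s))
      ∂(Measure.pi fun _ : E => haarProb K))
      = fun _ => ∫ x, f x ∂(Measure.pi fun _ : E => haarProb K) :=
    funext fun s => integral_mul_right_eq_self f _
  rw [h2] at h1
  exact h1.unique (hasDerivAt_const _ _)

/-- Integration by parts in an edge variable. -/
lemma integral_smul_edgeDeriv {c : (E → K) → ℝ}
    (hc : ContMDiff (ModelWithCorners.pi fun _ : E => 𝓘(ℝ, V)) 𝓘(ℝ, ℝ) ∞ c)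
    (X : LieAlg V K) (e : E) :
    ∫ x, c x • edgeDeriv X e f x ∂(Measure.pi fun _ : E => haarProb K)
      = -∫ x, edgeDeriv X e c x • f x ∂(Measure.pi fun _ : E => haarProb K) := by
  have hcf : ContMDiff (ModelWithCorners.pi fun _ : E => 𝓘(ℝ, V)) 𝓘(ℝ, A) ∞ fun x => c x • f x :=
    hc.smul hf
  have h := integral_edgeDeriv hcf X e
  have hint : ∀ h : (E → K) → A, Continuous h →
      Integrable h (Measure.pi fun _ : E => haarProb K) := fun h hh =>
    hh.integrable_of_hasCompactSupport (HasCompactSupport.of_compactSpace _)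
  rw [integral_congr_ae (Eventually.of_forall fun x => edgeDeriv_smul hf hc X e x), integral_add
    (hint _ (Continuous.fun_smul hc.continuous (ContMDiff.edgeDeriv hf X e).continuous))
    (hint _ (Continuous.fun_smul (ContMDiff.edgeDeriv hc X e).continuous hf.continuous))] at h
  exact eq_neg_of_add_eq_zero_left h

/-- Two integrations by parts in each direction of the basis, with cancelling signs. -/
lemma integral_smul_edgeLaplacian (g : BiinvariantMetric V K) {c : (E → K) → ℝ}
    (hc : ContMDiff (ModelWithCorners.pi fun _ : E => 𝓘(ℝ, V)) 𝓘(ℝ, ℝ) ∞ c) (e : E) :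
    ∫ x, c x • edgeLaplacian g e f x ∂(Measure.pi fun _ : E => haarProb K)
      = ∫ x, edgeLaplacian g e c x • f x ∂(Measure.pi fun _ : E => haarProb K) := by
  have hint : ∀ h : (E → K) → A, Continuous h →
      Integrable h (Measure.pi fun _ : E => haarProb K) := fun h hh =>
    hh.integrable_of_hasCompactSupport (HasCompactSupport.of_compactSpace _)
  have hff := fun X => ContMDiff.edgeDeriv hf X e
  have hcc := fun X => ContMDiff.edgeDeriv hc X e
  have hff' := fun X => ContMDiff.edgeDeriv (hff X) X e
  have hcc' := fun X => ContMDiff.edgeDeriv (hcc X) X e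
  simp_rw [edgeLaplacian_eq_sum, Finset.smul_sum, Finset.sum_smul]
  rw [integral_finsetSum _ fun i _ => hint _ (Continuous.fun_smul hc.continuous (hff' _).continuous),
    integral_finsetSum _ fun i _ => hint _ (Continuous.fun_smul (hcc' _).continuous hf.continuous)]
  refine Finset.sum_congr rfl fun i _ => ?_
  rw [integral_smul_edgeDeriv (hff _) hc, integral_smul_edgeDeriv hf (hcc _), neg_neg]

end EdgeDerivative

/-! ### Holonomy as a function of one edge variable -/

namespace PlaneGraph

section Holonomy

variable {V K : Type*} [NormedAddCommGroup V] [NormedSpace ℝ V]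
  [TopologicalSpace K] [ChartedSpace V K] [Group K] [LieGroup 𝓘(ℝ, V) ∞ K]
  {A : Type*} [NormedAddCommGroup A] [NormedSpace ℝ A]
  {E : Type*} [Fintype E]

lemma contMDiff_hol (l : List (E × Bool)) :
    ContMDiff (ModelWithCorners.pi fun _ : E => 𝓘(ℝ, V)) 𝓘(ℝ, V) ∞ fun x : E → K => hol x l := by
  induction l with
  | nil => simpa only [hol_nil] using contMDiff_const
  | cons d l ih =>
    simp only [hol_cons]
    refine ih.mul ?_
    split_ifs
    · exact contMDiff_eval d.1
    · exact (contMDiff_inv 𝓘(ℝ, V) ∞).comp (contMDiff_eval d.1)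

omit [Fintype E] in
lemma hol_congr {G : Type*} [Group G] {x y : E → G} {l : List (E × Bool)}
    (h : ∀ e ∈ l.map Prod.fst, x e = y e) : hol x l = hol y l := by
  induction l with
  | nil => simp [hol_nil]
  | cons d l ih =>
    rw [hol_cons, hol_cons, ih fun e he => h e (List.mem_cons_of_mem _ he), h d.1 (by simp)]

variable [DecidableEq E]

omit [Fintype E] in
lemma hol_update_of_notMem {G : Type*} [Group G] (x : E → G) {e : E} {l : List (E × Bool)}
    (h : e ∉ l.map Prod.fst) (a : G) : hol (Function.update x e a) l = hol x l :=
  hol_congr fun i hi => Function.update_of_ne (by rintro rfl; exact h hi) _ _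

-- The walk is split at the only occurrence of e; u and v are the holonomies of the remaining
-- pieces, which do not involve a.
omit [Fintype E] in
lemma hol_update_of_traversals {G : Type*} [Group G] {e : E} {l : List (E × Bool)}
    (h : traversals l e = 1) : ∃ b : Bool, ∃ u v : (E → G) → G, ∀ x a,
      hol (Function.update x e a) l = u x * (if b then a else a⁻¹) * v x := by
  have he : e ∈ l.map Prod.fst := List.count_pos_iff.1 (by rw [← traversals, h]; norm_num)
  obtain ⟨d, hd, rfl⟩ := List.mem_map.1 he
  obtain ⟨l₁, l₂, rfl⟩ := List.append_of_mem hd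
  rw [traversals] at h
  simp only [List.map_append, List.map_cons, List.count_append, List.count_cons_self] at h
  refine ⟨d.2, fun x => hol x l₂, fun x => hol x l₁, fun x a => ?_⟩
  rw [hol_append, hol_cons, hol_update_of_notMem x (List.count_eq_zero.1 (by omega)),
    hol_update_of_notMem x (List.count_eq_zero.1 (by omega))]
  simp

variable [FiniteDimensional ℝ V] [T2Space K]

omit [Fintype E] in
/-- The Laplacian in an edge variable of a function of the holonomy along a walk that traverses
the edge exactly once. -/
lemma edgeLaplacian_comp_hol (g : BiinvariantMetric V K) {f : K → A}
    (hf : ContMDiff 𝓘(ℝ, V) 𝓘(ℝ, A) ∞ f) {e : E} {l : List (E × Bool)}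
    (h : traversals l e = 1) (x : E → K) :
    edgeLaplacian g e (fun x => f (hol x l)) x = laplacian g f (hol x l) := by
  obtain ⟨b, u, v, huv⟩ := hol_update_of_traversals (G := K) h
  have hx := huv x (x e)
  rw [Function.update_eq_self] at hx
  rw [hx, edgeLaplacian]
  simp_rw [huv]
  cases b
  · exact laplacian_mul_inv_mul g hf (u x) (v x) (x e)
  · exact laplacian_mul_mul g hf (u x) (v x) (x e)

omit [LieGroup 𝓘(ℝ, V) ∞ K] [Fintype E] [FiniteDimensional ℝ V] [T2Space K] in
lemma edgeDeriv_of_forall_update {c : (E → K) → A} {e : E}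
    (h : ∀ x a, c (Function.update x e a) = c x) (X : LieAlg V K) (x : E → K) :
    edgeDeriv X e c x = 0 := by
  rw [edgeDeriv]
  simp_rw [h]
  rw [leftDeriv, mfderiv_const]
  rfl

/-- Factors that do not depend on the edge variable come out of the Laplacian. -/
lemma edgeLaplacian_smul_of_forall_update (g : BiinvariantMetric V K) {c : (E → K) → ℝ}
    (hc : ContMDiff (ModelWithCorners.pi fun _ : E => 𝓘(ℝ, V)) 𝓘(ℝ, ℝ) ∞ c) {f : (E → K) → A}
    (hf : ContMDiff (ModelWithCorners.pi fun _ : E => 𝓘(ℝ, V)) 𝓘(ℝ, A) ∞ f) {e : E}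
    (h : ∀ x a, c (Function.update x e a) = c x) (x : E → K) :
    edgeLaplacian g e (fun x => c x • f x) x = c x • edgeLaplacian g e f x := by
  have key : ∀ (X : LieAlg V K) {f : (E → K) → A},
      ContMDiff (ModelWithCorners.pi fun _ : E => 𝓘(ℝ, V)) 𝓘(ℝ, A) ∞ f →
      edgeDeriv X e (fun x => c x • f x) = fun x => c x • edgeDeriv X e f x := by
    intro X f hf
    funext y
    rw [edgeDeriv_smul hf hc, edgeDeriv_of_forall_update h, zero_smul, add_zero]
  rw [edgeLaplacian_eq_sum, edgeLaplacian_eq_sum, Finset.smul_sum]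
  refine Finset.sum_congr rfl fun i _ => ?_
  rw [key _ hf, key _ (ContMDiff.edgeDeriv hf _ e)]

end Holonomy

end PlaneGraph

end PlanarYM

/-! ### Nonnegativity of the heat kernel -/

/-- The second derivative at a minimum is nonnegative. -/
lemma second_deriv_nonneg_of_forall_le {φ φ' : ℝ → ℝ} {c : ℝ} (h1 : ∀ s, HasDerivAt φ (φ' s) s)
    (h2 : HasDerivAt φ' c 0) (hmin : ∀ s, φ 0 ≤ φ s) : 0 ≤ c := by
  by_contra! hc
  have e : deriv φ = φ' := funext fun s => (h1 s).deriv
  have hd : deriv φ 0 = 0 := IsLocalMin.deriv_eq_zero (Eventually.of_forall hmin)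
  -- With c < 0 the minimum would also be a local maximum, so the function would be constant near 0
  -- and c would vanish.
  have hmax : IsLocalMax φ 0 := isLocalMax_of_deriv_deriv_neg (by rwa [e, h2.deriv]) hd
    (h1 0).continuousAt
  have h3 : φ =ᶠ[𝓝 0] fun _ => φ 0 := hmax.mono fun s hs => le_antisymm hs (hmin s)
  have h4 := h3.deriv.deriv_eq
  rw [e, h2.deriv] at h4
  simp at h4
  exact hc.ne h4

/-- A derivative is nonpositive where a function is smaller than at earlier times. -/
lemma deriv_nonpos_of_forall_le {v : ℝ → ℝ} {d a t : ℝ} (h : HasDerivAt v d t) (ha : a < t)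
    (hmin : ∀ s ∈ Set.Ioo a t, v t ≤ v s) : d ≤ 0 := by
  have h1 := (hasDerivAt_iff_tendsto_slope.1 h).mono_left (nhdsLT_le_nhdsNE t)
  refine le_of_tendsto h1 ?_
  filter_upwards [Ioo_mem_nhdsLT ha] with s hs
  rw [slope_def_field]
  exact div_nonpos_of_nonneg_of_nonpos (by linarith [hmin s hs]) (by linarith [hs.2])

namespace PlanarYM

section HeatKernel

variable {V K : Type*} [NormedAddCommGroup V] [NormedSpace ℝ V]
  [TopologicalSpace K] [ChartedSpace V K] [Group K] [LieGroup 𝓘(ℝ, V) ∞ K]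

omit [Group K] [LieGroup 𝓘(ℝ, V) ∞ K] in
lemma contMDiff_slice {A : Type*} [NormedAddCommGroup A] [NormedSpace ℝ A] {F : ℝ × K → A}
    (hF : ContMDiffOn (𝓘(ℝ, ℝ).prod 𝓘(ℝ, V)) 𝓘(ℝ, A) ∞ F (Set.Ioi 0 ×ˢ Set.univ)) {t : ℝ}
    (ht : 0 < t) : ContMDiff 𝓘(ℝ, V) 𝓘(ℝ, A) ∞ fun z => F (t, z) := by
  rw [← contMDiffOn_univ]
  exact hF.comp (f := fun z : K => (t, z)) (contMDiff_const.prodMk contMDiff_id).contMDiffOn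
    fun z _ => ⟨ht, trivial⟩

/-- Applied twice, this makes the Laplacian of the heat kernel jointly continuous in time and space,
as differentiation under the integral requires. -/
lemma contMDiffOn_leftDeriv_slice {A : Type*} [NormedAddCommGroup A] [NormedSpace ℝ A]
    {F : ℝ × K → A}
    (hF : ContMDiffOn (𝓘(ℝ, ℝ).prod 𝓘(ℝ, V)) 𝓘(ℝ, A) ∞ F (Set.Ioi 0 ×ˢ Set.univ))
    (X : LieAlg V K) :
    ContMDiffOn (𝓘(ℝ, ℝ).prod 𝓘(ℝ, V)) 𝓘(ℝ, A) ∞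
      (fun p : ℝ × K => leftDeriv X (fun z => F (p.1, z)) p.2) (Set.Ioi 0 ×ˢ Set.univ) := by
  have h1 : ∀ p ∈ Set.Ioi (0 : ℝ) ×ˢ (Set.univ : Set K), leftDeriv X (fun z => F (p.1, z)) p.2
      = mfderiv 𝓘(ℝ, V) 𝓘(ℝ, A) (fun a => F (p.1, p.2 * a)) 1 X := fun p hp =>
    leftDeriv_eq X ((contMDiff_slice hF hp.1).mdifferentiableAt (by simp))
  have hM : IsManifold 𝓘(ℝ, V) ∞ K := inferInstance
  refine ContMDiffOn.congr (fun p hp => ContMDiffAt.contMDiffWithinAt ?_) h1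
  refine contMDiffAt_mfderiv_one (I := 𝓘(ℝ, ℝ).prod 𝓘(ℝ, V))
    (f := fun (p : ℝ × K) a => F (p.1, p.2 * a)) ?_ X
  have h2 : ContMDiffAt (𝓘(ℝ, ℝ).prod 𝓘(ℝ, V)) 𝓘(ℝ, A) ∞ F (p.1, p.2 * 1) :=
    hF.contMDiffAt ((isOpen_Ioi.prod isOpen_univ).mem_nhds ⟨hp.1, trivial⟩)
  refine ContMDiffAt.comp (f := fun q : (ℝ × K) × K => (q.1.1, q.1.2 * q.2)) (p, 1) h2 ?_
  exact ((contMDiff_fst.comp contMDiff_fst).prodMk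
    ((contMDiff_snd.comp contMDiff_fst).mul contMDiff_snd)).contMDiffAt

variable [FiniteDimensional ℝ V] [IsTopologicalGroup K] [CompactSpace K] [T2Space K]
  [MeasurableSpace K] [BorelSpace K] {g : BiinvariantMetric V K} {ρ : ℝ → K → ℝ}

namespace IsHeatKernel

variable (h : IsHeatKernel g ρ)
include h

omit [LieGroup 𝓘(ℝ, V) ∞ K] [T2Space K] in
lemma contMDiff {t : ℝ} (ht : 0 < t) : ContMDiff 𝓘(ℝ, V) 𝓘(ℝ, ℝ) ∞ (ρ t) :=
  contMDiff_slice h.smooth ht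

omit [T2Space K] in
lemma continuousOn_laplacian :
    ContinuousOn (fun p : ℝ × K => laplacian g (ρ p.1) p.2) (Set.Ioi 0 ×ˢ Set.univ) := by
  unfold laplacian
  exact continuousOn_finsetSum _ fun i _ => (contMDiffOn_leftDeriv_slice
    (contMDiffOn_leftDeriv_slice h.smooth (g.orthonormalBasis i))
      (g.orthonormalBasis i)).continuousOn

variable [SecondCountableTopology K]

omit [LieGroup 𝓘(ℝ, V) ∞ K] [SecondCountableTopology K] [T2Space K] in
lemma continuous {t : ℝ} (ht : 0 < t) : Continuous (ρ t) := (h.contMDiff ht).continuous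

omit [T2Space K] in
/-- The time derivative of the solution of the heat equation with initial value `f`. -/
lemma hasDerivAt_convolution_time {f : K → ℝ} (hf : Continuous f) {t : ℝ} (ht : 0 < t) (x : K) :
    HasDerivAt (fun s => ∫ y, f y * ρ s (y⁻¹ * x) ∂(haarProb K))
      (∫ y, f y * (1 / 2 * laplacian g (ρ t) (y⁻¹ * x)) ∂(haarProb K)) t := by
  refine hasDerivAt_integral_of_continuousOn (μ := haarProb K)
    (Q' := fun s y => f y * (1 / 2 * laplacian g (ρ s) (y⁻¹ * x))) (U := Set.Ioi 0)
    (Ioi_mem_nhds ht)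
    (fun s hs => hf.mul ((h.continuous hs).comp (by fun_prop)))
    (fun s hs y => (h.heat_equation s hs _).const_mul _) ?_
  refine ContinuousOn.mul (by fun_prop) (ContinuousOn.mul continuousOn_const ?_)
  exact h.continuousOn_laplacian.comp (f := fun p : ℝ × K => (p.1, p.2⁻¹ * x)) (by fun_prop)
    fun p hp => ⟨hp.1, trivial⟩

omit h in
lemma hasDerivAt_convolution_space {f ψ : K → ℝ} (hf : Continuous f)
    (hψ : ContMDiff 𝓘(ℝ, V) 𝓘(ℝ, ℝ) ∞ ψ) (X : LieAlg V K) (x : K) (s : ℝ) :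
    HasDerivAt (fun s => ∫ y, f y * ψ (y⁻¹ * (x * oneParam X s)) ∂(haarProb K))
      (∫ y, f y * leftDeriv X ψ (y⁻¹ * (x * oneParam X s)) ∂(haarProb K)) s := by
  have hD := (ContMDiff.leftDeriv hψ X).continuous
  have hc := continuous_oneParam X
  refine hasDerivAt_integral_of_continuousOn (μ := haarProb K)
    (Q' := fun s y => f y * leftDeriv X ψ (y⁻¹ * (x * oneParam X s))) (U := Set.univ) univ_mem
    (fun s _ => hf.mul (hψ.continuous.comp (by fun_prop))) (fun s _ y => ?_) ?_
  · have := (hasDerivAt_oneParam hψ X (y⁻¹ * x) s).const_mul (f y)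
    simpa only [mul_assoc] using this
  · exact ((hf.comp continuous_snd).mul (hD.comp (by fun_prop))).continuousOn

/-- Minimum principle for solutions of the heat equation. -/
lemma convolution_ge {f : K → ℝ} (hf : Continuous f) {a T m : ℝ} (ha : 0 < a) (haT : a < T)
    (hm : ∀ x, m ≤ ∫ y, f y * ρ a (y⁻¹ * x) ∂(haarProb K)) (x : K) :
    m ≤ ∫ y, f y * ρ T (y⁻¹ * x) ∂(haarProb K) := by
  set u : ℝ → K → ℝ := fun t x => ∫ y, f y * ρ t (y⁻¹ * x) ∂(haarProb K) with hu
  have hcont : ContinuousOn (fun p : ℝ × K => u p.1 p.2) (Set.Icc a T ×ˢ Set.univ) := by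
    have hρ : ContinuousOn (fun p : ℝ × K => ρ p.1 p.2) (Set.Ioi 0 ×ˢ Set.univ) :=
      h.smooth.continuousOn
    refine continuousOn_integral_of_compact_support (k := Set.univ) (μ := haarProb K)
      (f := fun (p : ℝ × K) y => f y * ρ p.1 (y⁻¹ * p.2)) isCompact_univ ?_ (by simp)
    refine ContinuousOn.mul (by fun_prop) ?_
    exact hρ.comp (f := fun q : (ℝ × K) × K => (q.1.1, q.2⁻¹ * q.1.2)) (by fun_prop)
      fun q hq => ⟨ha.trans_le hq.1.1.1, trivial⟩
  -- The term εt makes the principle strict: at a minimum with time after a, the time derivative is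
  -- at most 0, but it equals ½Δu + ε with Δu ≥ 0. So the minimum is attained at time a.
  have key : ∀ ε > 0, m + ε * a ≤ u T x + ε * T := by
    intro ε hε
    obtain ⟨⟨t₀, x₀⟩, h0, hmin⟩ := (isCompact_Icc.prod isCompact_univ).exists_isMinOn
      (s := Set.Icc a T ×ˢ (Set.univ : Set K)) ⟨(T, x), ⟨haT.le, le_rfl⟩, trivial⟩
      (f := fun p : ℝ × K => u p.1 p.2 + ε * p.1) (hcont.add (by fun_prop))
    have hmin' : ∀ t ∈ Set.Icc a T, ∀ z, u t₀ x₀ + ε * t₀ ≤ u t z + ε * t :=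
      fun t ht z => hmin (show (t, z) ∈ Set.Icc a T ×ˢ (Set.univ : Set K) from ⟨ht, trivial⟩)
    rcases h0.1.1.eq_or_lt with hat | hat
    · have := hmin' T ⟨haT.le, le_rfl⟩ x
      dsimp only at hat
      rw [← hat] at this
      exact (add_le_add_left (hm x₀) _).trans this
    · exfalso
      dsimp only at hat
      have ht₀ : 0 < t₀ := ha.trans hat
      have hψ := h.contMDiff ht₀
      have h1 : HasDerivAt (fun t => u t x₀ + ε * t)
          (∫ y, f y * (1 / 2 * laplacian g (ρ t₀) (y⁻¹ * x₀)) ∂(haarProb K) + ε * 1) t₀ :=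
        (h.hasDerivAt_convolution_time hf ht₀ x₀).add ((hasDerivAt_id t₀).const_mul ε)
      have h2 := deriv_nonpos_of_forall_le h1 hat fun s hs =>
        hmin' s ⟨hs.1.le, hs.2.le.trans h0.1.2⟩ x₀
      have h3 : ∀ X : LieAlg V K,
          0 ≤ ∫ y, f y * leftDeriv X (leftDeriv X (ρ t₀)) (y⁻¹ * x₀) ∂(haarProb K) := by
        intro X
        have h4 := hasDerivAt_convolution_space hf (ContMDiff.leftDeriv hψ X) X x₀ 0
        simp only [oneParam_zero, mul_one] at h4
        refine second_deriv_nonneg_of_forall_le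
          (fun s => hasDerivAt_convolution_space hf hψ X x₀ s) h4 fun s => ?_
        simp only [oneParam_zero, mul_one]
        linarith [hmin' t₀ h0.1 (x₀ * oneParam X s)]
      have h5 : ∫ y, f y * (1 / 2 * laplacian g (ρ t₀) (y⁻¹ * x₀)) ∂(haarProb K)
          = ∑ i, 1 / 2 * ∫ y, f y * leftDeriv (g.orthonormalBasis i)
              (leftDeriv (g.orthonormalBasis i) (ρ t₀)) (y⁻¹ * x₀) ∂(haarProb K) := by
        simp_rw [← integral_const_mul]
        rw [← integral_finsetSum]
        · congr 1
          funext y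
          rw [laplacian, Finset.mul_sum, Finset.mul_sum]
          exact Finset.sum_congr rfl fun i _ => by ring
        · intro i _
          have hc := (ContMDiff.leftDeriv (ContMDiff.leftDeriv hψ (g.orthonormalBasis i))
            (g.orthonormalBasis i)).continuous
          refine Continuous.integrable_of_hasCompactSupport ?_ (HasCompactSupport.of_compactSpace _)
          exact continuous_const.mul (hf.mul (hc.comp (by fun_prop)))
      have h6 : 0 ≤ ∫ y, f y * (1 / 2 * laplacian g (ρ t₀) (y⁻¹ * x₀)) ∂(haarProb K) := by
        rw [h5]
        exact Finset.sum_nonneg fun i _ => mul_nonneg (by norm_num) (h3 _)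
      linarith
  by_contra! hlt
  have h1 : u T x < m := hlt
  -- For this ε the correction ε(T - a) is half of the supposed gap m - u T x.
  have := key ((m - u T x) / (2 * (T - a))) (by
    have : 0 < T - a := by linarith
    have : 0 < m - u T x := by linarith
    positivity)
  have h2 : (m - u T x) / (2 * (T - a)) * (T - a) = (m - u T x) / 2 := by
    have : T - a ≠ 0 := by linarith
    field_simp
  nlinarith

omit [LieGroup 𝓘(ℝ, V) ∞ K] [T2Space K] [SecondCountableTopology K] in
/-- The integrals of a continuous function against the heat kernel converge uniformly on
compact families of functions. -/
lemma eventually_integral_gt {f : K → ℝ} (hf : Continuous f) (hf0 : ∀ x, 0 ≤ f x) {δ : ℝ}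
    (hδ : 0 < δ) : ∃ᶠ a in 𝓝[>] 0, ∀ x, -δ < ∫ y, f (x * y⁻¹) * ρ a y ∂(haarProb K) := by
  -- Along a sequence convergence implies boundedness, which Banach--Steinhaus needs; the conclusion
  -- therefore holds only frequently.
  let a : ℕ → ℝ := fun n => 1 / ((n : ℝ) + 1)
  have ha : ∀ n, 0 < a n := fun n => Nat.one_div_pos_of_nat
  have ha0 : Tendsto a atTop (𝓝[>] 0) := tendsto_nhdsWithin_iff.2
    ⟨tendsto_one_div_add_atTop_nhds_zero_nat, Eventually.of_forall ha⟩
  have hint : ∀ h : K → ℝ, Continuous h → Integrable h (haarProb K) := fun h hh =>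
    hh.integrable_of_hasCompactSupport (HasCompactSupport.of_compactSpace _)
  have hi : ∀ (n : ℕ) (φ : C(K, ℝ)), Integrable (fun y => φ y * ρ (a n) y) (haarProb K) :=
    fun n φ => hint _ (φ.continuous.mul (h.continuous (ha n)))
  -- The sign of ρ is still unknown, so the L¹ norms of the kernels are not under control directly;
  -- pointwise convergence of these functionals bounds their norms.
  let T : ℕ → C(K, ℝ) →L[ℝ] ℝ := fun n => LinearMap.mkContinuous
    { toFun := fun φ => ∫ y, φ y * ρ (a n) y ∂(haarProb K)
      map_add' := fun φ ψ => by
        rw [← integral_add (hi n φ) (hi n ψ)]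
        simp [add_mul]
      map_smul' := fun c φ => by
        rw [RingHom.id_apply, smul_eq_mul, ← integral_const_mul]
        simp [mul_assoc] }
    (∫ y, |ρ (a n) y| ∂(haarProb K)) fun φ => by
      refine (norm_integral_le_integral_norm _).trans ?_
      rw [mul_comm, ← integral_const_mul]
      refine integral_mono (hi n φ).norm ((hint _ (h.continuous (ha n)).abs).const_mul _)
        fun y => ?_
      rw [norm_mul]
      exact mul_le_mul_of_nonneg_right (φ.norm_coe_le_norm y) (norm_nonneg _)
  have hT : ∀ φ : C(K, ℝ), Tendsto (fun n => T n φ) atTop (𝓝 (φ 1)) := fun φ =>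
    (h.initial φ φ.continuous).comp ha0
  obtain ⟨C, hC⟩ := banach_steinhaus (g := T) fun φ => by
    obtain ⟨C, hC⟩ := (hT φ).norm.bddAbove_range
    exact ⟨C, fun n => hC ⟨n, rfl⟩⟩
  have hC0 : 0 ≤ C := (norm_nonneg _).trans (hC 0)
  -- The functions y ↦ f(xy⁻¹) depend continuously on x in the supremum norm. Convergence at one x
  -- and the bound C control nearby x, and compactness of K does the rest.
  let Φ : C(K, C(K, ℝ)) := ContinuousMap.curry ⟨fun p : K × K => f (p.1 * p.2⁻¹), by fun_prop⟩
  have hloc : ∀ x : K, {p : ℕ × K | -δ < T p.1 (Φ p.2)} ∈ (atTop : Filter ℕ) ×ˢ 𝓝 x := by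
    intro x
    have h1 : ∀ᶠ n in (atTop : Filter ℕ), -(δ / 2) < T n (Φ x) := by
      refine (hT (Φ x)).eventually_const_lt ?_
      have : 0 ≤ Φ x 1 := hf0 _
      linarith
    have h2 : ∀ᶠ z in 𝓝 x, ‖Φ z - Φ x‖ < δ / (2 * (C + 1)) := by
      have h3 : Tendsto (fun z => ‖Φ z - Φ x‖) (𝓝 x) (𝓝 0) := by
        have := ((Φ.continuous.sub continuous_const).norm (f := fun z => Φ z - Φ x)).tendsto x
        simpa using this
      exact h3.eventually_lt_const (by positivity)
    filter_upwards [h1.prod_mk h2] with p hp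
    have h4 : T p.1 (Φ p.2) = T p.1 (Φ x) + T p.1 (Φ p.2 - Φ x) := by
      rw [map_sub]; ring
    have h5 : ‖T p.1 (Φ p.2 - Φ x)‖ ≤ C * (δ / (2 * (C + 1))) :=
      ((T p.1).le_opNorm _).trans (mul_le_mul (hC _) hp.2.le (norm_nonneg _) hC0)
    have h6 : C * (δ / (2 * (C + 1))) ≤ δ / 2 := by
      rw [mul_div_assoc', div_le_div_iff₀ (by positivity) (by norm_num)]
      nlinarith
    have h7 := (abs_le.1 h5).1
    show -δ < _
    rw [h4]
    linarith [hp.1]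
  have hev := (isCompact_univ (X := K)).mem_prod_nhdsSet_of_forall fun x _ => hloc x
  rw [nhdsSet_univ] at hev
  have hev' : ∀ᶠ n in (atTop : Filter ℕ), ∀ x : K, -δ < T n (Φ x) := by
    exact mem_prod_top.1 hev
  exact ha0.frequently hev'.frequently

/-- The heat kernel is nonnegative. -/
theorem nonneg {T : ℝ} (hT : 0 < T) (x : K) : 0 ≤ ρ T x := by
  -- At a small time a the convolution is at least -δ everywhere; the minimum principle carries this
  -- to time T, and δ is arbitrary.
  have key : ∀ f : K → ℝ, Continuous f → (∀ x, 0 ≤ f x) →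
      0 ≤ ∫ y, f y * ρ T y⁻¹ ∂(haarProb K) := by
    intro f hf hf0
    refine le_of_forall_pos_le_add fun δ hδ => ?_
    obtain ⟨a, h1, ha⟩ := ((h.eventually_integral_gt hf hf0 hδ).and_eventually
      (Ioo_mem_nhdsGT hT)).exists
    have h2 : ∀ x, -δ ≤ ∫ y, f y * ρ a (y⁻¹ * x) ∂(haarProb K) := by
      intro x
      have h3 : ∫ y, f (x * y⁻¹) * ρ a y ∂(haarProb K)
          = ∫ y, f y * ρ a (y⁻¹ * x) ∂(haarProb K) := by
        rw [← integral_inv_eq_self, ← integral_mul_left_eq_self _ x⁻¹]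
        simp
      rw [← h3]
      exact (h1 x).le
    have h4 := h.convolution_ge hf ha.1 ha.2 h2 1
    simp only [mul_one] at h4
    linarith
  -- The test function is the negative part of the kernel itself. Its integral against the kernel is
  -- minus the integral of its square, so it vanishes.
  have hc : Continuous fun y => max (-ρ T y⁻¹) 0 :=
    (((h.continuous hT).comp continuous_inv).neg).max continuous_const
  have h1 := key _ hc fun y => le_max_right _ _
  have h2 : (fun y => max (-ρ T y⁻¹) 0 * ρ T y⁻¹) = fun y => -(max (-ρ T y⁻¹) 0) ^ 2 := by
    funext y
    rcases le_total (-ρ T y⁻¹) 0 with h | h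
    · simp [max_eq_right h]
    · rw [max_eq_left h]; ring
  rw [h2, integral_neg] at h1
  have h3 : ∫ y, (max (-ρ T y⁻¹) 0) ^ 2 ∂(haarProb K) = 0 :=
    le_antisymm (by linarith) (integral_nonneg fun y => sq_nonneg _)
  by_contra! hx
  refine (Continuous.integral_pos_of_hasCompactSupport_nonneg_nonzero (hc.pow 2)
    (HasCompactSupport.of_compactSpace _) (fun y => sq_nonneg _) (x := x⁻¹) ?_).ne' h3
  change (max (-ρ T x⁻¹⁻¹) 0) ^ 2 ≠ 0
  rw [inv_inv, max_eq_left (by linarith)]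
  exact pow_ne_zero _ (by linarith)

end IsHeatKernel

end HeatKernel

end PlanarYM

/-! ### The area derivative of a Yang--Mills integral -/

namespace PlanarYM.PlaneGraph

section YangMills

variable {V K : Type*} [NormedAddCommGroup V] [NormedSpace ℝ V] [FiniteDimensional ℝ V]
  [TopologicalSpace K] [ChartedSpace V K] [Group K] [LieGroup 𝓘(ℝ, V) ∞ K]
  [IsTopologicalGroup K] [CompactSpace K] [T2Space K] [MeasurableSpace K] [BorelSpace K]
  [SecondCountableTopology K]
  {A : Type*} [NormedAddCommGroup A] [NormedSpace ℝ A]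
  {E : Type*} [Fintype E] {G : PlaneGraph E} {w : G.BoundedFace → List (E × Bool)}
  {g : BiinvariantMetric V K} {ρ : ℝ → K → ℝ} (h : IsHeatKernel g ρ)
include h

/-- Integrals with respect to the Yang--Mills measure. -/
lemma integral_ymMeasure [Fintype G.BoundedFace] {t : G.BoundedFace → ℝ} (ht : ∀ F, 0 < t F)
    (f : (E → K) → A) :
    ∫ x, f x ∂(G.ymMeasure ρ w t)
      = ∫ x, (∏ F, ρ (t F) (hol x (w F))) • f x ∂(Measure.pi fun _ : E => haarProb K) := by
  have hc : Continuous fun x : E → K => ∏ F, ρ (t F) (hol x (w F)) :=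
    continuous_finsetProd _ fun F _ => (h.continuous (ht F)).comp
      (contMDiff_hol (V := V) (w F)).continuous
  rw [ymMeasure]
  simp_rw [finprod_eq_prod_of_fintype]
  rw [integral_withDensity_eq_integral_toReal_smul hc.measurable.ennreal_ofReal
    (Eventually.of_forall fun x => ENNReal.ofReal_lt_top)]
  refine integral_congr_ae (Eventually.of_forall fun x => ?_)
  simp only
  -- Nonnegativity of the heat kernel makes the truncation in the density harmless.
  rw [ENNReal.toReal_ofReal (Finset.prod_nonneg fun F _ => h.nonneg (ht F) _)]

omit [T2Space K] [SecondCountableTopology K] in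
lemma contMDiff_prod_hol {κ : Type*} (s : Finset κ) {t : κ → ℝ} (ht : ∀ F, 0 < t F)
    (w : κ → List (E × Bool)) :
    ContMDiff (ModelWithCorners.pi fun _ : E => 𝓘(ℝ, V)) 𝓘(ℝ, ℝ) ∞
      fun x : E → K => ∏ F ∈ s, ρ (t F) (hol x (w F)) := by
  classical
  induction s using Finset.induction_on with
  | empty => simpa using contMDiff_const
  | insert F s hF ih =>
    simp_rw [Finset.prod_insert hF]
    exact ((h.contMDiff (ht F)).comp (contMDiff_hol (w F))).mul ih

/-- The derivative of a Yang--Mills integral in the area of a face whose boundary walk traverses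
an edge once that belongs to no other boundary walk. -/
theorem hasDerivAt_integral_ymMeasure [DecidableEq E] [Finite G.BoundedFace] {f : (E → K) → ℂ}
    (hf : ContMDiff (ModelWithCorners.pi fun _ : E => 𝓘(ℝ, V)) 𝓘(ℝ, ℂ) ∞ f)
    {t : G.BoundedFace → ℝ} (ht : ∀ F, 0 < t F) {F : G.BoundedFace} {e : E}
    (he : traversals (w F) e = 1) (he' : ∀ F', F' ≠ F → e ∉ (w F').map Prod.fst) :
    HasDerivAt (fun s => ∫ x, f x ∂(G.ymMeasure ρ w (G.setArea t F s)))
      (1 / 2 * ∫ x, edgeLaplacian g e f x ∂(G.ymMeasure ρ w t)) (t F) := by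
  classical
  have := Fintype.ofFinite G.BoundedFace
  set μ : Measure (E → K) := Measure.pi fun _ : E => haarProb K
  set R : (E → K) → ℝ := fun x => ∏ F' ∈ Finset.univ.erase F, ρ (t F') (hol x (w F')) with hR
  have hRs : ContMDiff (ModelWithCorners.pi fun _ : E => 𝓘(ℝ, V)) 𝓘(ℝ, ℝ) ∞ R :=
    contMDiff_prod_hol h _ ht w
  have hol_s := contMDiff_hol (V := V) (K := K) (w F)
  have hset : ∀ s > 0, ∀ F', 0 < G.setArea t F s F' := by
    intro s hs F'
    by_cases hF : F' = F
    · subst hF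
      simpa [setArea] using hs
    · simpa [setArea, hF] using ht F'
  have hI : ∀ s > 0, ∫ x, f x ∂(G.ymMeasure ρ w (G.setArea t F s))
      = ∫ x, (R x * ρ s (hol x (w F))) • f x ∂μ := by
    intro s hs
    rw [integral_ymMeasure h (hset s hs)]
    congr 1
    funext x
    rw [← Finset.mul_prod_erase _ _ (Finset.mem_univ F), mul_comm]
    congr 2
    · exact Finset.prod_congr rfl fun F' hF' => by
        simp [setArea, Finset.ne_of_mem_erase hF']
    · simp [setArea]
  have hD : HasDerivAt (fun s => ∫ x, (R x * ρ s (hol x (w F))) • f x ∂μ)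
      (∫ x, (R x * (1 / 2 * laplacian g (ρ (t F)) (hol x (w F)))) • f x ∂μ) (t F) := by
    refine hasDerivAt_integral_of_continuousOn (U := Set.Ioi 0)
      (Q' := fun s x => (R x * (1 / 2 * laplacian g (ρ s) (hol x (w F)))) • f x)
      (Ioi_mem_nhds (ht F)) (fun s hs => ?_) (fun s hs x => ?_) ?_
    · exact (hRs.continuous.mul ((h.continuous hs).comp hol_s.continuous)).smul hf.continuous
    · exact ((h.heat_equation s hs _).const_mul (R x)).smul_const (f x)
    · refine ContinuousOn.smul (ContinuousOn.mul (hRs.continuous.comp continuous_snd).continuousOn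
        (continuousOn_const.mul ?_)) (hf.continuous.comp continuous_snd).continuousOn
      exact h.continuousOn_laplacian.comp (f := fun p : ℝ × (E → K) => (p.1, hol p.2 (w F)))
        (continuous_fst.prodMk (hol_s.continuous.comp continuous_snd)).continuousOn
        fun p hp => ⟨hp.1, trivial⟩
  have hc : ContMDiff (ModelWithCorners.pi fun _ : E => 𝓘(ℝ, V)) 𝓘(ℝ, ℝ) ∞
      fun x => R x • ρ (t F) (hol x (w F)) := hRs.smul ((h.contMDiff (ht F)).comp hol_s)
  have hRe : ∀ x a, R (Function.update x e a) = R x := fun x a =>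
    Finset.prod_congr rfl fun F' hF' => by
      rw [hol_update_of_notMem x (he' F' (Finset.ne_of_mem_erase hF'))]
  -- Only the factor of F contains the edge variable, exactly once, so the edge Laplacian of the
  -- density is the expression that the heat equation produces.
  have hL : ∀ x, edgeLaplacian g e (fun x => R x • ρ (t F) (hol x (w F))) x
      = R x • laplacian g (ρ (t F)) (hol x (w F)) := fun x => by
    rw [edgeLaplacian_smul_of_forall_update g hRs
        (f := fun x => ρ (t F) (hol x (w F))) ((h.contMDiff (ht F)).comp hol_s) hRe,
      edgeLaplacian_comp_hol g (h.contMDiff (ht F)) he]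
  have hparts := integral_smul_edgeLaplacian hf g hc e
  have hval : ∫ x, (R x * (1 / 2 * laplacian g (ρ (t F)) (hol x (w F)))) • f x ∂μ
      = 1 / 2 * ∫ x, edgeLaplacian g e f x ∂(G.ymMeasure ρ w t) := by
    have h1 : ∫ x, edgeLaplacian g e f x ∂(G.ymMeasure ρ w t)
        = ∫ x, (R x • ρ (t F) (hol x (w F))) • edgeLaplacian g e f x ∂μ := by
      rw [integral_ymMeasure h ht]
      congr 1
      funext x
      rw [← Finset.mul_prod_erase _ _ (Finset.mem_univ F), mul_comm, smul_eq_mul]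
    rw [h1, hparts, ← integral_const_mul]
    congr 1
    funext x
    rw [hL]
    simp only [smul_eq_mul, Complex.real_smul]
    push_cast
    ring
  rw [← hval]
  refine hD.congr_of_eventuallyEq ?_
  filter_upwards [Ioi_mem_nhds (ht F)] with s hs using hI s hs

end YangMills

end PlanarYM.PlaneGraph

/-! ### The normalized trace as an eigenfunction on U(N) -/

namespace PlanarYM

section Trace

variable {N : ℕ}

/-- The Lie algebra of `U(N)` consists of the skew-Hermitian matrices. -/
lemma lieToMat_apply (X : SkewMat N) : lieToMat N X = (X : Mat N) := by
  let X₀ : SkewMat N := cayChart 1 (1 : Matrix.unitaryGroup (Fin N) ℂ)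
  have hX₀ : X₀ = 0 := by
    show skewPart N (cayInv (((1 : Matrix.unitaryGroup (Fin N) ℂ)⁻¹ * 1 :
      Matrix.unitaryGroup (Fin N) ℂ) : Mat N)) = 0
    rw [inv_mul_cancel]
    simp [cayInv]
  have hm := (contMDiff_coe_unitary (N := N)).mdifferentiableAt (x := 1) (by simp)
    |>.hasMFDerivAt.2
  rw [show Set.range (𝓘(ℝ, SkewMat N)) = Set.univ from Set.range_id] at hm
  have h : HasFDerivAt (fun X : SkewMat N =>
      ((1 : Matrix.unitaryGroup (Fin N) ℂ) : Mat N) * cay (X : Mat N))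
      (lieToMat N : SkewMat N →L[ℝ] Mat N) X₀ := hasFDerivWithinAt_univ.1 hm
  let S : SkewMat N →L[ℝ] Mat N := Submodule.subtypeL (skewAdjoint.submodule ℝ (Mat N))
  let R : SkewMat N → Mat N := fun X => Ring.inverse (1 - (1 / 2 : ℝ) • (X : Mat N))
  -- Since cay X = 1 + X(1 - X/2)⁻¹, the derivative at 0 is the inclusion.
  have e : (fun X : SkewMat N => ((1 : Matrix.unitaryGroup (Fin N) ℂ) : Mat N) * cay (X : Mat N))
      = fun X : SkewMat N => S X * R X + 1 := funext fun X =>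
    (one_mul _).trans (sub_eq_iff_eq_add.1 (cay_add_one (star_coe_skew X)).2)
  rw [e, hX₀] at h
  have hR : DifferentiableAt ℝ R 0 := by
    refine DifferentiableAt.comp (g := Ring.inverse)
      (f := fun X : SkewMat N => 1 - (1 / 2 : ℝ) • S X) 0 ?_ (by fun_prop)
    exact (contDiffAt_inverse (n := 1)
      (isUnit_one_sub (star_half (star_coe_skew 0)))).differentiableAt
      (by simp)
  have h2 := (S.hasFDerivAt (x := 0).mul' hR.hasFDerivAt).add_const (1 : Mat N)
  let L : SkewMat N →L[ℝ] Mat N := lieToMat N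
  have hL : HasFDerivAt (fun X : SkewMat N => S X * R X + 1) L 0 := h
  have h3 := congrArg (fun L : SkewMat N →L[ℝ] Mat N => L X) (HasFDerivAt.unique hL h2)
  have hR0 : R 0 = 1 := by simp [R]
  refine h3.trans ?_
  simp [hR0, S]

/-- The matrix coefficient function `U ↦ (1/N) trace (U * B)`. -/
noncomputable def traceMul (B : Mat N) : Mat N →L[ℝ] ℂ :=
  LinearMap.toContinuousLinearMap
    { toFun := fun W => (1 / N : ℂ) * Matrix.trace (W * B)
      map_add' := fun W W' => by rw [add_mul, Matrix.trace_add, mul_add]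
      map_smul' := fun c W => by
        rw [smul_mul_assoc, Matrix.trace_smul, RingHom.id_apply, mul_smul_comm] }

lemma contMDiff_traceMul (B : Mat N) : ContMDiff 𝓘(ℝ, SkewMat N) 𝓘(ℝ, ℂ) ∞
    fun U : Matrix.unitaryGroup (Fin N) ℂ => traceMul B (U : Mat N) :=
  (traceMul B).contDiff.comp_contMDiff contMDiff_coe_unitary

lemma normTrace_eq (U : Matrix.unitaryGroup (Fin N) ℂ) :
    normTrace U = traceMul 1 (U : Mat N) := by
  simp [normTrace, traceMul]

lemma contMDiff_normTrace : ContMDiff 𝓘(ℝ, SkewMat N) 𝓘(ℝ, ℂ) ∞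
    (normTrace : Matrix.unitaryGroup (Fin N) ℂ → ℂ) := by
  rw [show (normTrace : Matrix.unitaryGroup (Fin N) ℂ → ℂ)
    = fun U : Matrix.unitaryGroup (Fin N) ℂ => traceMul 1 (U : Mat N)
    from funext normTrace_eq]
  exact contMDiff_traceMul 1

lemma leftDeriv_traceMul (X : LieAlg (SkewMat N) (Matrix.unitaryGroup (Fin N) ℂ)) (B : Mat N)
    (U : Matrix.unitaryGroup (Fin N) ℂ) :
    leftDeriv X (fun U : Matrix.unitaryGroup (Fin N) ℂ => traceMul B (U : Mat N)) U
      = traceMul (lieToMat N X * B) (U : Mat N) := by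
  rw [leftDeriv_eq X ((contMDiff_traceMul B).mdifferentiableAt (by simp))]
  let L : Mat N →L[ℝ] ℂ := (traceMul B).comp (ContinuousLinearMap.mul ℝ (Mat N) (U : Mat N))
  have h2 : mfderiv 𝓘(ℝ, SkewMat N) 𝓘(ℝ, ℂ)
      (L ∘ (fun U : Matrix.unitaryGroup (Fin N) ℂ => (U : Mat N))) 1 X
      = traceMul B ((U : Mat N) * lieToMat N X) := by
    rw [mfderiv_comp (I' := 𝓘(ℝ, Mat N)) 1 L.differentiableAt.mdifferentiableAt
      ((contMDiff_coe_unitary (N := N)).mdifferentiableAt (by simp))]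
    rw [mfderiv_eq_fderiv, L.fderiv]
    rfl
  refine h2.trans ?_
  show (1 / N : ℂ) * Matrix.trace ((U : Mat N) * lieToMat N X * B)
    = (1 / N : ℂ) * Matrix.trace ((U : Mat N) * (lieToMat N X * B))
  rw [mul_assoc (U : Mat N)]

/-- The Casimir element of `U(N)`. -/
lemma sum_lieToMat_mul_self (hN : 0 < N) :
    ∑ i, lieToMat N ((unitaryMetric N).orthonormalBasis i)
      * lieToMat N ((unitaryMetric N).orthonormalBasis i) = -1 := by
  set b := (unitaryMetric N).orthonormalBasis with hb
  have hbb := (unitaryMetric N).orthonormalBasis_spec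
  rw [← hb] at hbb
  have hN' : (N : ℂ) ≠ 0 := Nat.cast_ne_zero.2 hN.ne'
  have hskew : ∀ X : LieAlg (SkewMat N) (Matrix.unitaryGroup (Fin N) ℂ),
      star (lieToMat N X) = -lieToMat N X := fun X => by
    rw [lieToMat_apply (show SkewMat N from X)]
    exact star_coe_skew _
  -- Expansion in the orthonormal basis; on skew-Hermitian matrices the inner product is -N
  -- trace(XY), which is real.
  have h1 : ∀ Y, lieToMat N Y
      = (-N : ℂ) • ∑ i, (lieToMat N (b i) * lieToMat N Y).trace • lieToMat N (b i) := by
    intro Y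
    have hc : ∀ i, b.repr Y i = (unitaryMetric N).inner (b i) Y := by
      intro i
      conv_rhs => rw [← b.sum_repr Y]
      simp only [map_sum, map_smul, hbb, smul_eq_mul]
      simp
    have hreal : ∀ i, ((unitaryMetric N).inner (b i) Y : ℂ)
        = -N * (lieToMat N (b i) * lieToMat N Y).trace := by
      intro i
      have him : (starRingEnd ℂ) (lieToMat N (b i) * lieToMat N Y).trace
          = (lieToMat N (b i) * lieToMat N Y).trace := by
        have h2 := Matrix.trace_conjTranspose (lieToMat N (b i) * lieToMat N Y)
        rw [← Matrix.star_eq_conjTranspose, star_mul, hskew, hskew, neg_mul_neg,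
          Matrix.trace_mul_comm] at h2
        exact h2.symm
      have h3 : (unitaryMetric N).inner (b i) Y
          = N * ((star (lieToMat N (b i)) * lieToMat N Y).trace).re := rfl
      rw [h3, hskew, neg_mul, Matrix.trace_neg, Complex.neg_re]
      push_cast
      rw [Complex.conj_eq_iff_re.1 him]
      ring
    conv_lhs => rw [← b.sum_repr Y]
    rw [map_sum, Finset.smul_sum]
    refine Finset.sum_congr rfl fun i _ => ?_
    rw [map_smul, hc, smul_smul, ← hreal]
    exact (Complex.coe_smul _ _).symm
  -- Both sides are complex linear in Y, and every matrix is a complex combination of skew-Hermitian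
  -- ones.
  have h2 : ∀ Y : Mat N, Y = (-N : ℂ) • ∑ i, (lieToMat N (b i) * Y).trace • lieToMat N (b i) := by
    have hs : ∀ Y : Mat N, star Y = -Y →
        Y = (-N : ℂ) • ∑ i, (lieToMat N (b i) * Y).trace • lieToMat N (b i) := by
      intro Y hY
      have := h1 (show SkewMat N from ⟨Y, hY⟩)
      rwa [lieToMat_apply (⟨Y, hY⟩ : SkewMat N)] at this
    let Λ : Mat N →ₗ[ℂ] Mat N :=
      { toFun := fun Y => (-N : ℂ) • ∑ i, (lieToMat N (b i) * Y).trace • lieToMat N (b i)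
        map_add' := fun Y Y' => by
          simp only [mul_add, Matrix.trace_add, add_smul, Finset.sum_add_distrib, smul_add]
        map_smul' := fun c Y => by
          simp only [mul_smul_comm, Matrix.trace_smul, RingHom.id_apply, smul_eq_mul]
          rw [smul_comm c, Finset.smul_sum (r := c)]
          simp only [smul_smul] }
    intro Y
    have e1 : Λ (Y - star Y) = Y - star Y := (hs _ (by simp)).symm
    have e2 : Λ (Complex.I • (Y + star Y)) = Complex.I • (Y + star Y) := (hs _ (by
      rw [star_smul, star_add, star_star, add_comm (star Y) Y, Complex.star_def, Complex.conj_I,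
        neg_smul])).symm
    rw [map_smul] at e2
    have e3 : Λ (Y + star Y) = Y + star Y := smul_right_injective _ Complex.I_ne_zero e2
    have e4 : (2 : ℂ) • Y = (Y - star Y) + (Y + star Y) := by rw [two_smul]; abel
    have e5 : Λ ((2 : ℂ) • Y) = (2 : ℂ) • Y := by rw [e4, map_add, e1, e3]
    rw [map_smul] at e5
    exact (smul_right_injective _ (two_ne_zero (α := ℂ)) e5).symm
  ext p q
  rw [Matrix.sum_apply]
  simp_rw [Matrix.mul_apply]
  rw [Finset.sum_comm]
  -- Entry (a, q) of the expansion of the matrix unit with a 1 at (a, p). Summing over a turns -1/N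
  -- into -1.
  have h3 : ∀ a, ∑ i, lieToMat N (b i) p a * lieToMat N (b i) a q
      = if p = q then -(1 / N : ℂ) else 0 := by
    intro a
    have h4 := congrFun (congrFun (h2 (Matrix.single a p 1)) a) q
    simp only [Matrix.smul_apply, Matrix.sum_apply, Matrix.trace_mul_single, smul_eq_mul,
      Matrix.single_apply, true_and, MulOpposite.op_one, one_smul] at h4
    rw [← mul_right_inj' (neg_ne_zero.2 hN'), ← h4]
    split_ifs
    · field_simp
    · simp
  rw [Finset.sum_congr rfl fun a _ => h3 a]
  simp only [Finset.sum_const, Finset.card_univ, Fintype.card_fin, Matrix.neg_apply,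
    Matrix.one_apply, nsmul_eq_mul]
  split_ifs
  · field_simp
  · simp

/-- The normalized trace is an eigenfunction of the Laplacian of `U(N)`. -/
theorem laplacian_normTrace (hN : 0 < N) (U : Matrix.unitaryGroup (Fin N) ℂ) :
    laplacian (unitaryMetric N) normTrace U = -normTrace U := by
  have h0 : (normTrace : Matrix.unitaryGroup (Fin N) ℂ → ℂ) =
      fun U : Matrix.unitaryGroup (Fin N) ℂ => traceMul 1 (U : Mat N) := funext normTrace_eq
  rw [h0, laplacian]
  have h1 : ∀ X : LieAlg (SkewMat N) (Matrix.unitaryGroup (Fin N) ℂ),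
      leftDeriv X (leftDeriv X fun U : Matrix.unitaryGroup (Fin N) ℂ => traceMul 1 (U : Mat N)) U
        = traceMul (lieToMat N X * lieToMat N X) (U : Mat N) := fun X => by
    rw [show leftDeriv X (fun U : Matrix.unitaryGroup (Fin N) ℂ => traceMul 1 (U : Mat N))
      = fun U : Matrix.unitaryGroup (Fin N) ℂ => traceMul (lieToMat N X * 1) (U : Mat N)
      from funext fun U => leftDeriv_traceMul X 1 U, leftDeriv_traceMul, mul_one]
  simp_rw [h1]
  have h2 : ∀ B : Mat N, traceMul B (U : Mat N) = (1 / N : ℂ) * Matrix.trace ((U : Mat N) * B) :=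
    fun B => rfl
  simp_rw [h2]
  rw [← Finset.mul_sum, ← Matrix.trace_sum, ← Finset.mul_sum, sum_lieToMat_mul_self hN]
  simp

end Trace

end PlanarYM

/-! ### Haar distribution of holonomies and the simple closed curve -/

/-- A function on a product of probability spaces whose partial integrals are constant in each
variable has equal constants. -/
lemma integral_integral_of_invariant {X K A : Type*} [TopologicalSpace X] [CompactSpace X]
    [SecondCountableTopology X] [MeasurableSpace X] [BorelSpace X] [TopologicalSpace K]
    [CompactSpace K] [SecondCountableTopology K] [MeasurableSpace K] [BorelSpace K]
    [NormedAddCommGroup A] [NormedSpace ℝ A] [CompleteSpace A] (μ : Measure X) (ν : Measure K)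
    [IsProbabilityMeasure μ] [IsProbabilityMeasure ν] {f : X → K → A}
    (hf : Continuous fun p : X × K => f p.1 p.2) {a b : A} (ha : ∀ x, ∫ k, f x k ∂ν = a)
    (hb : ∀ k, ∫ x, f x k ∂μ = b) : b = a := by
  have hint : Integrable (Function.uncurry f) (μ.prod ν) :=
    Continuous.integrable_of_hasCompactSupport hf (HasCompactSupport.of_compactSpace _)
  have hswap := integral_integral_swap hint
  rw [funext ha, funext hb] at hswap
  simpa using hswap.symm

namespace PlanarYM

section Pushforward

variable {K : Type*} [TopologicalSpace K] [Group K] [IsTopologicalGroup K] [CompactSpace K]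
  [MeasurableSpace K] [BorelSpace K] {A : Type*} [NormedAddCommGroup A] [NormedSpace ℝ A]

namespace PlaneGraph

variable {E : Type*}

omit [CompactSpace K] [MeasurableSpace K] [BorelSpace K] in
lemma continuous_hol (l : List (E × Bool)) : Continuous fun x : E → K => hol x l := by
  induction l with
  | nil => simpa only [hol_nil] using continuous_const
  | cons d l ih =>
    simp only [hol_cons]
    refine ih.mul ?_
    split_ifs
    · exact continuous_apply d.1
    · exact (continuous_apply d.1).inv

variable [Fintype E] [DecidableEq E] [SecondCountableTopology K] [CompleteSpace A]

/-- The holonomy along a walk that traverses an edge exactly once is Haar distributed. -/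
lemma integral_comp_hol {ψ : K → A} (hψ : Continuous ψ) {e : E} {l : List (E × Bool)}
    (h : traversals l e = 1) :
    ∫ x, ψ (hol x l) ∂(Measure.pi fun _ : E => haarProb K) = ∫ k, ψ k ∂(haarProb K) := by
  obtain ⟨b, u, v, huv⟩ := hol_update_of_traversals (G := K) h
  have hx : ∀ (x : E → K) (k : K), hol (x * Pi.mulSingle e k) l
      = u x * (if b then x e * k else (x e * k)⁻¹) * v x := by
    intro x k
    rw [← huv]
    congr 1
    funext i
    by_cases hi : i = e
    · subst hi; simp
    · simp [hi]
  have hk : ∀ x : E → K, ∫ k, ψ (hol (x * Pi.mulSingle e k) l) ∂(haarProb K)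
      = ∫ k, ψ k ∂(haarProb K) := by
    intro x
    simp_rw [hx]
    rw [integral_mul_left_eq_self (fun k => ψ (u x * (if b then k else k⁻¹) * v x)) (x e)]
    cases b
    · simp only [Bool.false_eq_true, if_false]
      rw [integral_inv_eq_self (fun k => ψ (u x * k * v x)),
        integral_mul_left_eq_self (fun k => ψ (k * v x)), integral_mul_right_eq_self]
    · simp only [if_true]
      rw [integral_mul_left_eq_self (fun k => ψ (k * v x)), integral_mul_right_eq_self]
  have hc : Continuous fun p : (E → K) × K => ψ (hol (p.1 * Pi.mulSingle e p.2) l) :=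
    hψ.comp ((continuous_hol l).comp
      (continuous_fst.mul ((continuous_mulSingle e).comp continuous_snd)))
  -- The variable of e is multiplied by an auxiliary k. Averaging over k gives the Haar integral of
  -- ψ for each x, averaging over x gives the left side for each k, and Fubini equates the two.
  exact integral_integral_of_invariant (Measure.pi fun _ : E => haarProb K) (haarProb K)
    (f := fun x k => ψ (hol (x * Pi.mulSingle e k) l)) hc hk
    fun k => integral_mul_right_eq_self (fun x => ψ (hol x l)) _

end PlaneGraph

variable {V : Type*} [NormedAddCommGroup V] [NormedSpace ℝ V] [FiniteDimensional ℝ V]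
  [ChartedSpace V K] [LieGroup 𝓘(ℝ, V) ∞ K] {g : BiinvariantMetric V K} {ρ : ℝ → K → ℝ}

omit [LieGroup 𝓘(ℝ, V) ∞ K] in
/-- The initial condition of the heat kernel, for complex-valued functions. -/
lemma IsHeatKernel.initial_complex (h : IsHeatKernel g ρ) {φ : K → ℂ} (hφ : Continuous φ) :
    Tendsto (fun t => ∫ k, ρ t k • φ k ∂(haarProb K)) (𝓝[>] 0) (𝓝 (φ 1)) := by
  have h1 := h.initial _ (Complex.continuous_re.comp hφ)
  have h2 := h.initial _ (Complex.continuous_im.comp hφ)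
  have h3 := ((Complex.continuous_ofReal.tendsto _).comp h1).add
    (((Complex.continuous_ofReal.tendsto _).comp h2).mul_const Complex.I)
  rw [show ((((Complex.re ∘ φ) 1 : ℝ) : ℂ) + ((Complex.im ∘ φ) 1 : ℝ) * Complex.I) = φ 1
    from Complex.re_add_im _] at h3
  refine h3.congr' ?_
  filter_upwards [self_mem_nhdsWithin] with t ht
  have hint : Integrable (fun k => ρ t k • φ k) (haarProb K) :=
    ((h.continuous ht).smul hφ).integrable_of_hasCompactSupport (HasCompactSupport.of_compactSpace _)
  rw [← integral_re_add_im hint]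
  simp [mul_comm]

end Pushforward

lemma normTrace_eq_of_isConj {N : ℕ} {a b : Matrix.unitaryGroup (Fin N) ℂ} (h : IsConj a b) :
    normTrace a = normTrace b := by
  obtain ⟨c, rfl⟩ := isConj_iff.1 h
  have h1 : ((c * a * c⁻¹ : Matrix.unitaryGroup (Fin N) ℂ) : Mat N)
      = (c : Mat N) * a * ((c⁻¹ : Matrix.unitaryGroup (Fin N) ℂ) : Mat N) := rfl
  have h2 : ((c⁻¹ : Matrix.unitaryGroup (Fin N) ℂ) : Mat N) * (c : Mat N) = 1 :=
    congrArg Subtype.val (inv_mul_cancel c)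
  rw [normTrace, normTrace, h1, Matrix.trace_mul_comm, ← mul_assoc, h2, one_mul]

lemma normTrace_one {N : ℕ} (hN : 0 < N) : normTrace (1 : Matrix.unitaryGroup (Fin N) ℂ) = 1 := by
  have : (N : ℂ) ≠ 0 := Nat.cast_ne_zero.2 hN.ne'
  simp [normTrace, this]

instance {N : ℕ} : SecondCountableTopology (Matrix.unitaryGroup (Fin N) ℂ) :=
  ChartedSpace.secondCountable_of_sigmaCompact (SkewMat N) _

/-- A solution of `u' = -u/2` on the positive reals with initial value `1`. -/
lemma eq_exp_of_hasDerivAt {u : ℝ → ℂ} (h : ∀ t > 0, HasDerivAt u (-(1 / 2) * u t) t)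
    (h0 : Tendsto u (𝓝[>] 0) (𝓝 1)) {t : ℝ} (ht : 0 < t) : u t = Real.exp (-t / 2) := by
  let v : ℝ → ℂ := fun s => u s * Real.exp (s / 2)
  have hv : ∀ s > 0, HasDerivAt v 0 s := by
    intro s hs
    have h1 : HasDerivAt (fun s : ℝ => Real.exp (s / 2)) (Real.exp (s / 2) * (1 / 2)) s :=
      ((hasDerivAt_id s).div_const 2).exp
    refine ((h s hs).mul h1.ofReal_comp).congr_deriv ?_
    push_cast
    ring
  have hc : ∀ s > 0, v s = v t := fun s hs =>
    isOpen_Ioi.is_const_of_deriv_eq_zero (s := Set.Ioi 0) isPreconnected_Ioi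
      (fun s hs => (hv s hs).differentiableAt.differentiableWithinAt)
      (fun s hs => (hv s hs).deriv) hs ht
  have hlim : Tendsto v (𝓝[>] 0) (𝓝 1) := by
    have h1 : Tendsto (fun s : ℝ => ((Real.exp (s / 2) : ℝ) : ℂ)) (𝓝[>] 0) (𝓝 1) := by
      have : Continuous fun s : ℝ => ((Real.exp (s / 2) : ℝ) : ℂ) := by fun_prop
      simpa using (this.tendsto 0).mono_left nhdsWithin_le_nhds
    have := h0.mul h1
    rwa [one_mul] at this
  have hv1 : v t = 1 := tendsto_nhds_unique (tendsto_const_nhds.congr' (by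
    filter_upwards [self_mem_nhdsWithin] with s hs using (hc s hs).symm)) hlim
  have h2 : u t * Real.exp (t / 2) = 1 := hv1
  rw [neg_div, Real.exp_neg, Complex.ofReal_inv]
  exact eq_inv_of_mul_eq_one_left h2

namespace PlaneGraph

variable {E : Type*} [Fintype E] [DecidableEq E] {G : PlaneGraph E}
  {w : G.BoundedFace → List (E × Bool)} {N : ℕ} {ρ : ℝ → Matrix.unitaryGroup (Fin N) ℂ → ℝ}

/-- Since L traverses e once, its trace inherits the eigenvalue -1 under the edge Laplacian from the
trace on U(N). -/
lemma hasDerivAt_integral_normTrace_hol [Finite G.BoundedFace] (hN : 0 < N)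
    (h : IsHeatKernel (unitaryMetric N) ρ) {t : G.BoundedFace → ℝ} (ht : ∀ F, 0 < t F)
    {F : G.BoundedFace} {e : E} (he : traversals (w F) e = 1)
    (he' : ∀ F', F' ≠ F → e ∉ (w F').map Prod.fst) {L : List (E × Bool)}
    (hL : traversals L e = 1) :
    HasDerivAt (fun s => ∫ x, normTrace (hol x L) ∂(G.ymMeasure ρ w (G.setArea t F s)))
      (-(1 / 2) * ∫ x, normTrace (hol x L) ∂(G.ymMeasure ρ w t)) (t F) := by
  have hf : ContMDiff (ModelWithCorners.pi fun _ : E => 𝓘(ℝ, SkewMat N)) 𝓘(ℝ, ℂ) ∞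
      fun x : E → Matrix.unitaryGroup (Fin N) ℂ => normTrace (hol x L) :=
    contMDiff_normTrace.comp (contMDiff_hol L)
  have h1 := hasDerivAt_integral_ymMeasure h hf ht he he'
  refine h1.congr_deriv ?_
  simp_rw [edgeLaplacian_comp_hol (unitaryMetric N) contMDiff_normTrace hL,
    laplacian_normTrace hN]
  rw [integral_neg]
  ring

/-- The expectation, as a function of the area of the only bounded face, solves u' = -u/2 on t > 0
and tends to 1 as t → 0. -/
theorem IsSimpleClosedCurve.integral_normTrace_hol {L : List (E × Bool)}
    (hL : G.IsSimpleClosedCurve L) (hw : ∀ F, G.IsBoundaryWalk F.1 (w F)) (hN : 0 < N)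
    (h : IsHeatKernel (unitaryMetric N) ρ) (F : G.BoundedFace) :
    ∫ x, normTrace (hol x L) ∂(G.ymMeasure ρ w G.area) = Real.exp (-(G.area F) / 2) := by
  have hfin := finite_boundedFace hw
  have := Fintype.ofFinite G.BoundedFace
  have huniq := hL.eq_boundedFace hw F
  -- With a single bounded face, an assignment of areas is a single number.
  have hconst : ∀ t : G.BoundedFace → ℝ, t = fun _ => t F := fun t =>
    funext fun F' => by rw [huniq F']
  let e := (L.head hL.1.1).1
  obtain ⟨he, he'⟩ := hL.traversals_eq_one hw F e
  let u : ℝ → ℂ := fun t => ∫ x, normTrace (hol x L) ∂(G.ymMeasure ρ w fun _ => t)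
  have hu : ∀ t > 0, HasDerivAt u (-(1 / 2) * u t) t := by
    intro t ht
    have h1 := hasDerivAt_integral_normTrace_hol hN h (t := fun _ => t) (fun _ => ht) he he'
      (hL.2.2 e)
    refine h1.congr_of_eventuallyEq (Eventually.of_forall fun s => ?_)
    have h2 : G.setArea (fun _ => t) F s = fun _ => s := by
      rw [hconst (G.setArea (fun _ => t) F s)]
      simp [setArea]
    simp only [h2, u]
  -- The walk may start elsewhere or run backwards, so the trace of L is the trace of its holonomy
  -- or of the inverse; either function is 1 at the identity.
  have hcl : ∃ φ : Matrix.unitaryGroup (Fin N) ℂ → ℂ, Continuous φ ∧ φ 1 = 1 ∧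
      ∀ x : E → Matrix.unitaryGroup (Fin N) ℂ, normTrace (hol x L) = φ (hol x (w F)) := by
    rcases hL.isConj_hol (hw F) (fun e => (hL.traversals_eq_one hw F e).1)
      (Matrix.unitaryGroup (Fin N) ℂ) with hc | hc
    · exact ⟨normTrace, contMDiff_normTrace.continuous, normTrace_one hN,
        fun x => normTrace_eq_of_isConj (hc x)⟩
    · exact ⟨fun k => normTrace k⁻¹, contMDiff_normTrace.continuous.comp continuous_inv,
        by simp only [inv_one, normTrace_one hN], fun x => normTrace_eq_of_isConj (hc x)⟩
  obtain ⟨φ, hφ, hφ1, hφL⟩ := hcl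
  have h0 : Tendsto u (𝓝[>] 0) (𝓝 1) := by
    rw [← hφ1]
    refine (h.initial_complex hφ).congr' ?_
    filter_upwards [self_mem_nhdsWithin] with t ht
    show _ = ∫ x, normTrace (hol x L) ∂(G.ymMeasure ρ w fun _ => t)
    rw [integral_ymMeasure h fun _ => ht]
    have h3 : ∀ x : E → Matrix.unitaryGroup (Fin N) ℂ, ∏ F', ρ t (hol x (w F'))
        = ρ t (hol x (w F)) := fun x => by
      rw [Finset.prod_eq_single F (fun F' _ hF' => absurd (huniq F') hF') (by simp)]
    simp_rw [h3, hφL]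
    exact (integral_comp_hol ((h.continuous ht).smul hφ) he).symm
  rw [hconst G.area]
  exact eq_exp_of_hasDerivAt hu h0 (area_pos F)

end PlaneGraph

end PlanarYM
-- The theorem
/-- The unbounded face condition, for a plane graph `G` in which each bounded face `F` has a boundary
walk `w F`. The area derivatives are taken at arbitrary positive areas `t` of the bounded faces, in
particular at the areas `G.area` of the faces of `G`. -/
theorem mainTheorem5 {E : Type*} [Fintype E] [DecidableEq E] (G : PlaneGraph E)
    (w : G.BoundedFace → List (E × Bool)) (hw : ∀ F, G.IsBoundaryWalk F.1 (w F)) :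
    (∀ {V K : Type*} [NormedAddCommGroup V] [NormedSpace ℝ V] [FiniteDimensional ℝ V]
        [TopologicalSpace K] [ChartedSpace V K] [Group K] [LieGroup 𝓘(ℝ, V) ∞ K]
        [IsTopologicalGroup K] [CompactSpace K] [T2Space K] [MeasurableSpace K] [BorelSpace K]
        (g : BiinvariantMetric V K) (ρ : ℝ → K → ℝ), IsHeatKernel g ρ →
      ∀ f : (E → K) → ℂ,
        ContMDiff (ModelWithCorners.pi fun _ : E => 𝓘(ℝ, V)) 𝓘(ℝ, ℂ) ∞ f →
      ∀ t : G.BoundedFace → ℝ, (∀ F, 0 < t F) →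
      ∀ (F : G.BoundedFace) (e : E), G.SharedWithUnbounded F e →
        HasDerivAt (fun s => ∫ x, f x ∂(G.ymMeasure ρ w (G.setArea t F s)))
          (1 / 2 * ∫ x, edgeLaplacian g e f x ∂(G.ymMeasure ρ w t)) (t F)) ∧
    (∀ (N : ℕ), 0 < N → ∀ ρ : ℝ → Matrix.unitaryGroup (Fin N) ℂ → ℝ,
        IsHeatKernel (unitaryMetric N) ρ →
      (∀ t : G.BoundedFace → ℝ, (∀ F, 0 < t F) →
        ∀ (F : G.BoundedFace) (e : E), G.SharedWithUnbounded F e →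
        ∀ L : List (E × Bool), G.IsLoop L → PlaneGraph.traversals L e = 1 →
          HasDerivAt
            (fun s => ∫ x, normTrace (PlaneGraph.hol x L) ∂(G.ymMeasure ρ w (G.setArea t F s)))
            (-(1 / 2) * ∫ x, normTrace (PlaneGraph.hol x L) ∂(G.ymMeasure ρ w t)) (t F)) ∧
      (∀ L : List (E × Bool), G.IsSimpleClosedCurve L → ∀ F : G.BoundedFace,
          ∫ x, normTrace (PlaneGraph.hol x L) ∂(G.ymMeasure ρ w G.area) =
            Real.exp (-(G.area F) / 2))) := by
  have hfin := PlaneGraph.finite_boundedFace hw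
  refine ⟨?_, fun N hN ρ h => ⟨?_, fun L hL F => hL.integral_normTrace_hol hw hN h F⟩⟩
  · intro V K _ _ _ _ _ _ _ _ _ _ _ _ g ρ h f hf t ht F e hFe
    -- A compact space with charts in a finite-dimensional V is covered by finitely many of them, so
    -- this is no extra assumption.
    have : SecondCountableTopology K := ChartedSpace.secondCountable_of_sigmaCompact V K
    obtain ⟨he, he'⟩ := PlaneGraph.traversals_of_sharedWithUnbounded hw hFe
    exact PlaneGraph.hasDerivAt_integral_ymMeasure h hf ht he he'
  · intro t ht F e hFe L _ hL
    obtain ⟨he, he'⟩ := PlaneGraph.traversals_of_sharedWithUnbounded hw hFe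
    exact PlaneGraph.hasDerivAt_integral_normTrace_hol hN h ht he he' hL
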